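/- Conventions. All manifolds and forms are smooth. A form $\rho$ of mixed degree, even or odd, on a 7-manifold (8-manifold) $N$ is a generalised $G_2$-structure (generalised $Spin(7)$-structure) of even or odd type if at every point its stabiliser in the identity component of $Spin(TN\oplus T^*N)\cong Spin(n,n)$, acting on $\Lambda^*T^*N$ by extension of $(v\oplus\xi)\bullet\rho=v\llcorner\rho+\xi\wedge\rho$, is conjugate to $G_2\times G_2\subset SO(7)\times SO(7)$ (to $Spin(7)\times Spin(7)\subset SO(8)\times SO(8)$), i.e. it is this product for suitable orthonormal frames of the summands of a splitting $TN\oplus T^*N=V_+\oplus V_-$ into a positive and a negative definite subspace. The splitting determines a metric $g$ and a 2-form $b$. For a generalised $G_2$-structure on an oriented 7-manifold put $\hat\rho=e^{b/2}\wedge\star_g\sigma(e^{-b/2}\wedge\rho)$, where $\sigma$ is $+1$ on forms of degree $0,3$ and $-1$ on forms of degree $1,2$ modulo $4$, and where $b$ is normalised so that $V_+$ is the image of $\{-x\oplus g(x,\cdot)\}$ under conjugation with $e^{b/2}\wedge\cdot$. For a 3-form $T$ put $d_T\rho=d\rho+T\wedge\rho$. Let $T$ be closed. A generalised $G_2$-structure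 $\rho$ is closed strongly integrable with torsion $T$ if $d_T\rho=0$ and $d_T\hat\rho=0$; it is closed weakly integrable with torsion $T$ and Killing number $\lambda\in\mathbb{R}\setminus\{0\}$ if $d_T\rho=\lambda\hat\rho$. A generalised $Spin(7)$-structure $\rho$ is closed integrable with torsion $T$ if $d_T\rho=0$. Setting. Let $p:P\to M$ and $p^t:P^t\to M$ be principal $S^1$-bundles with connection forms $\theta$, $\theta^t$ and curvature forms $\mathcal F,\mathcal F^t\in\Omega^2(M)$, so that $d\theta=p^*\mathcal F$ and $d\theta^t=(p^t)^*\mathcal F^t$. Let $X$ be the vertical vector field on $P$ with $\theta(X)=1$. Let $T$ be an $S^1$-invariant 3-form on $P$ with $X\llcorner T=-p^*\mathcal F^t$, so that $T=-\theta\wedge p^*\mathcal F^t+p^*\mathcal T$ with $\mathcal T\in\Omega^3(M)$, and let $T^t=-\theta^t\wedge (p^t)^*\mathcal F+(p^t)^*\mathcal T$ be its T-dual. (If $T$ and $X\llcorner T$ are closed and integral, such a $P^t$ and $\theta^t$ exist.) Let $\rho=\theta\wedge p^*\rho_0+p^*\rho_1$ be an $S^1$-invariant form on $P$, with $\rho_0,\rho_1\in\Omega^*(M)$,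 and let $\rho^t=\theta^t\wedge (p^t)^*\rho_1+(p^t)^*\rho_0$ be its T-dual. Suppose first that $\dim M=6$ and that $M$ is oriented by a nowhere vanishing 6-form $\nu$; orient $P$ by $\theta\wedge p^*\nu$ and $P^t$ by $-\theta^t\wedge (p^t)^*\nu$. (i) $\rho$ is a closed strongly integrable generalised $G_2$-structure on $P$ with torsion $T$ if and only if $\rho^t$ is a closed strongly integrable generalised $G_2$-structure on $P^t$ with torsion $T^t$. (ii) $\rho$ is a closed weakly integrable generalised $G_2$-structure on $P$ of even (odd) type with torsion $T$ and Killing number $\lambda$ if and only if $\rho^t$ is a closed weakly integrable generalised $G_2$-structure on $P^t$ of odd (even) type with torsion $T^t$ and Killing number $-\lambda$. (iii) Suppose instead that $\dim M=7$. Then $\rho$ is a closed integrable generalised $Spin(7)$-structure on $P$ of even (odd) type with torsion $T$ if and only if $\rho^t$ is a closed integrable generalised $Spin(7)$-structure on $P^t$ of odd (even) type with torsion $T^t$. -/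

import Mathlib

open scoped Manifold ContDiff

noncomputable section

namespace GenGeom

/-! ## Linear algebra on `V ⊕ V*` -/

/-- The exterior algebra `Λ*V*` of (mixed degree) forms on a vector space `V`. -/
abbrev Forms (V : Type*) [AddCommGroup V] [Module ℝ V] : Type _ :=
  ExteriorAlgebra ℝ (Module.Dual ℝ V)

section LinearAlgebra

variable {V : Type*} [AddCommGroup V] [Module ℝ V]

/-- Contraction `v ⌟ α` of a form with a vector. -/
def contract (v : V) : Forms V →ₗ[ℝ] Forms V :=
  CliffordAlgebra.contractLeft (Module.Dual.eval ℝ V v)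

/-- The even forms (`ε = 0`) or the odd forms (`ε = 1`). -/
def parityForms (V : Type*) [AddCommGroup V] [Module ℝ V] (ε : ZMod 2) :
    Submodule ℝ (Forms V) :=
  CliffordAlgebra.evenOdd (0 : QuadraticForm ℝ (Module.Dual ℝ V)) ε

/-- The pullback of forms along a linear map. -/
def linPullback {W : Type*} [AddCommGroup W] [Module ℝ W] (f : V →ₗ[ℝ] W) :
    Forms W →ₐ[ℝ] Forms V :=
  ExteriorAlgebra.map f.dualMap

/-- The action `(ξ, v) • α = ξ ∧ α + v ⌟ α` of `V* ⊕ V` on forms, as a linear map. -/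
def vectorAction (V : Type*) [AddCommGroup V] [Module ℝ V] :
    (Module.Dual ℝ V × V) →ₗ[ℝ] Module.End ℝ (Forms V) :=
  ((LinearMap.mul ℝ (Forms V)).comp (ExteriorAlgebra.ι ℝ)).coprod
    (CliffordAlgebra.contractLeft.comp (Module.Dual.eval ℝ V))

theorem vectorAction_apply (a : Module.Dual ℝ V × V) (α : Forms V) :
    vectorAction V a α = ExteriorAlgebra.ι ℝ a.1 * α + contract a.2 α := rfl

theorem vectorAction_sq (a : Module.Dual ℝ V × V) :
    vectorAction V a * vectorAction V a =
      algebraMap ℝ _ (QuadraticForm.dualProd ℝ V a) := by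
  refine LinearMap.ext fun α => ?_
  have h1 : ExteriorAlgebra.ι ℝ a.1 * (ExteriorAlgebra.ι ℝ a.1 * α) = 0 := by
    rw [← mul_assoc, ExteriorAlgebra.ι_sq_zero, zero_mul]
  have h2 : contract a.2 (contract a.2 α) = 0 :=
    CliffordAlgebra.contractLeft_contractLeft _ _
  have h3 : contract a.2 (ExteriorAlgebra.ι ℝ a.1 * α) =
      a.1 a.2 • α - ExteriorAlgebra.ι ℝ a.1 * contract a.2 α :=
    CliffordAlgebra.contractLeft_ι_mul _ _ _
  rw [Module.End.mul_apply, vectorAction_apply, vectorAction_apply, mul_add, map_add, h1, h2, h3]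
  simp [Module.algebraMap_end_apply]

/-- The spin representation of `Cliff(V ⊕ V*)` on forms, extending
`(ξ, v) • α = ξ ∧ α + v ⌟ α`.  The quadratic form on `V* ⊕ V` is the natural pairing
`(ξ, v) ↦ ξ v`, in the convention `a² = Q(a)`. -/
def cliffordAction (V : Type*) [AddCommGroup V] [Module ℝ V] :
    CliffordAlgebra (QuadraticForm.dualProd ℝ V) →ₐ[ℝ] Module.End ℝ (Forms V) :=
  CliffordAlgebra.lift _ ⟨vectorAction V, vectorAction_sq⟩

/-- The stabiliser of `ρ` in `Spin(V ⊕ V*)`, as a group of isometries `A = Ad x` of `V ⊕ V*`.  For `ρ ≠ 0` the stabiliser maps isomorphically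
onto it, as `-1` does not fix `ρ`. (`spinGroup` consists of the even products of vectors with
`x * star x = 1`, i.e. it is the identity component of `Spin(n,n)`.) -/
def stabiliser (ρ : Forms V) : Set (Module.End ℝ (Module.Dual ℝ V × V)) :=
  {A | ∃ x ∈ spinGroup (QuadraticForm.dualProd ℝ V), cliffordAction V x ρ = ρ ∧
    ∀ a, CliffordAlgebra.ι _ (A a) * x = x * CliffordAlgebra.ι _ a}

/-- Isometric frames `w₊` and `w₋` of the two summands of a metric splitting
`V ⊕ V* = V₊ ⊕ V₋`.  As Clifford multiplication by `(ξ, v)` squares to `ξ v`, the positive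
summand `V₊` (the one on whose vectors it squares to `-|u|²`) is the range of `w₊`. -/
structure IsMetricSplitting {n : ℕ} (wp wm : (Fin n → ℝ) →ₗ[ℝ] (Module.Dual ℝ V × V)) :
    Prop where
  pos : ∀ u, QuadraticForm.dualProd ℝ V (wp u) = -∑ i, u i ^ 2
  neg : ∀ u, QuadraticForm.dualProd ℝ V (wm u) = ∑ i, u i ^ 2
  orthogonal : ∀ u u', LinearMap.dualProd ℝ V (wp u) (wm u') = 0

/-- The subgroup `G × G` of `SO(V₊) × SO(V₋)`, where `V₊` and `V₋` are identified with `ℝⁿ`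
through the frames `w₊` and `w₋`. -/
def productGroup {n : ℕ} (G : Set ((Fin n → ℝ) ≃ₗ[ℝ] (Fin n → ℝ)))
    (wp wm : (Fin n → ℝ) →ₗ[ℝ] (Module.Dual ℝ V × V)) :
    Set (Module.End ℝ (Module.Dual ℝ V × V)) :=
  {A | ∃ h ∈ G, ∃ k ∈ G, ∀ u, A (wp u) = wp (h u) ∧ A (wm u) = wm (k u)}

/-- The stabiliser of `ρ` is `G × G` inside `SO(V₊) × SO(V₋)`, for the metric splitting with
frames `w₊` and `w₋`. -/
def HasStabiliser {n : ℕ} (G : Set ((Fin n → ℝ) ≃ₗ[ℝ] (Fin n → ℝ))) (ρ : Forms V)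
    (wp wm : (Fin n → ℝ) →ₗ[ℝ] (Module.Dual ℝ V × V)) : Prop :=
  IsMetricSplitting wp wm ∧ stabiliser ρ = productGroup G wp wm

/-- The monomial `dx_{i₁} ∧ … ∧ dx_{iₖ}` on `ℝⁿ`. -/
def monomial {n : ℕ} (l : List (Fin n)) : Forms (Fin n → ℝ) :=
  (l.map fun i => ExteriorAlgebra.ι ℝ (LinearMap.proj (R := ℝ) (φ := fun _ => ℝ) i)).prod

/-- The linear automorphisms of `ℝⁿ` that fix a given form. -/
def glStabiliser {n : ℕ} (φ : Forms (Fin n → ℝ)) : Set ((Fin n → ℝ) ≃ₗ[ℝ] (Fin n → ℝ)) :=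
  {h | linPullback h.toLinearMap φ = φ}

/-- The stable 3-form on `ℝ⁷` that defines `G₂` (coordinates are numbered from `0`). -/
def phi0 : Forms (Fin 7 → ℝ) :=
  monomial [0, 1, 2] + monomial [0, 3, 4] - monomial [0, 5, 6] + monomial [1, 3, 5]
    + monomial [1, 4, 6] + monomial [2, 3, 6] - monomial [2, 4, 5]

/-- The self-dual 4-form on `ℝ⁸` that defines `Spin(7) ⊂ SO(8)`. -/
def omega0 : Forms (Fin 8 → ℝ) :=
  monomial [0, 1, 2, 3] + monomial [0, 1, 4, 5] - monomial [0, 1, 6, 7]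
    + monomial [0, 2, 4, 6] + monomial [0, 2, 5, 7] + monomial [0, 3, 4, 7]
    - monomial [0, 3, 5, 6] - monomial [1, 2, 4, 7] + monomial [1, 2, 5, 6]
    + monomial [1, 3, 4, 6] + monomial [1, 3, 5, 7] - monomial [2, 3, 4, 5]
    + monomial [2, 3, 6, 7] + monomial [4, 5, 6, 7]

/-- The group `G₂` acting on `ℝ⁷`. -/
def groupG2 : Set ((Fin 7 → ℝ) ≃ₗ[ℝ] (Fin 7 → ℝ)) := glStabiliser phi0

/-- The group `Spin(7)` acting on `ℝ⁸`. -/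
def groupSpin7 : Set ((Fin 8 → ℝ) ≃ₗ[ℝ] (Fin 8 → ℝ)) := glStabiliser omega0

/-- `ρ` is a form on a 7-dimensional space whose stabiliser in the spin group of `V ⊕ V*` is
conjugate to `G₂ × G₂`. -/
def IsG2Form (ρ : Forms V) : Prop := ∃ wp wm, HasStabiliser groupG2 ρ wp wm

/-- `ρ` is a form on an 8-dimensional space whose stabiliser in the spin group of `V ⊕ V*` is
conjugate to `Spin(7) × Spin(7)`. -/
def IsSpin7Form (ρ : Forms V) : Prop := ∃ wp wm, HasStabiliser groupSpin7 ρ wp wm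

/-! ## The companion `ρ̂ = □_ρ ρ` -/

/-- `e₁* ∧ … ∧ eₙ*` for a basis `e₁, …, eₙ`. -/
def volumeElement {n : ℕ} (e : Module.Basis (Fin n) ℝ V) : Forms V :=
  (List.ofFn fun i => ExteriorAlgebra.ι ℝ (e.coord i)).prod

/-- The vector `ξ♯` metrically dual to `ξ`, for the metric with orthonormal basis `e`. -/
def sharp {n : ℕ} (e : Module.Basis (Fin n) ℝ V) : Module.Dual ℝ V →ₗ[ℝ] V :=
  ∑ i, (LinearMap.toSpanSingleton ℝ V (e i)).comp (Module.Dual.eval ℝ V (e i))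

/-- The algebra map `ξ₁ ∧ … ∧ ξₚ ↦ (ξ₁♯ ⌟ ·) ∘ … ∘ (ξₚ♯ ⌟ ·)`. -/
def contractForm {n : ℕ} (e : Module.Basis (Fin n) ℝ V) :
    Forms V →ₐ[ℝ] Module.End ℝ (Forms V) :=
  ExteriorAlgebra.lift ℝ ⟨CliffordAlgebra.contractLeft.comp ((Module.Dual.eval ℝ V).comp (sharp e)),
    fun _ => LinearMap.ext fun _ => CliffordAlgebra.contractLeft_contractLeft _ _⟩

/-- The Hodge star operator of the metric and the orientation for which `e` is an oriented
orthonormal basis: `⋆(ξ₁ ∧ … ∧ ξₚ) = ξₚ♯ ⌟ (… (ξ₁♯ ⌟ vol))`. -/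
def hodgeStar {n : ℕ} (e : Module.Basis (Fin n) ℝ V) (α : Forms V) : Forms V :=
  contractForm e (CliffordAlgebra.reverse α) (volumeElement e)

/-- The anti-automorphism `σ`, which is `1` in the degrees `0, 3` and `-1` in the degrees `1, 2`
modulo `4`. -/
def sigma (α : Forms V) : Forms V := CliffordAlgebra.reverse (CliffordAlgebra.involute α)

/-- The exponential of a form of positive degree on an `n`-dimensional space. -/
def expForm (n : ℕ) (β : Forms V) : Forms V :=
  ∑ k ∈ Finset.range (n + 1), ((Nat.factorial k : ℝ)⁻¹) • β ^ k

/-- The generalised Hodge operator `□ α = e^β ∧ ⋆σ(e^{-β} ∧ α)`, with `β = b/2` for the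
B-field `b`. -/
def box {n : ℕ} (e : Module.Basis (Fin n) ℝ V) (β α : Forms V) : Forms V :=
  expForm n β * hodgeStar e (sigma (expForm n (-β) * α))

/-- `(g, β)` is the metric and the 2-form of the positive subspace `V₊ = range w₊`, where `g` is
given by an orthonormal basis `e`: `V₊` is the image of the metric diagonal `{-x ⊕ g(x,·)}` under
conjugation with the spin group element `e^β ∧ ·`, so it is spanned by the
`-eᵢ ⊕ (eᵢ* + eᵢ ⌟ β)`. -/
def InducesMetric {n : ℕ} (wp : (Fin n → ℝ) →ₗ[ℝ] (Module.Dual ℝ V × V))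
    (e : Module.Basis (Fin n) ℝ V) (β : Forms V) : Prop :=
  β ∈ ⋀[ℝ]^2 (Module.Dual ℝ V) ∧
    ∀ i, ∃ ξ : Module.Dual ℝ V,
      ExteriorAlgebra.ι ℝ ξ = ExteriorAlgebra.ι ℝ (e.coord i) + contract (e i) β ∧
        (ξ, -e i) ∈ LinearMap.range wp

/-- `ρ'` is the companion `ρ̂ = □_ρ ρ` of the generalised `G₂`-form `ρ`, where the metric and the
B-field are the ones induced by `ρ` and the orientation is given by the top degree form `μ`. -/
def IsCompanion (μ ρ ρ' : Forms V) : Prop :=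
  ∃ wp wm, HasStabiliser groupG2 ρ wp wm ∧
    ∃ (e : Module.Basis (Fin 7) ℝ V) (β : Forms V), InducesMetric wp e β ∧
      (∃ c : ℝ, 0 < c ∧ volumeElement e = c • μ) ∧ ρ' = box e β ρ

end LinearAlgebra

/-! ## Differential forms on manifolds -/

section Manifold

/-- A (not necessarily homogeneous, not necessarily smooth) differential form on an
`n`-manifold. -/
abbrev MixedForm (n : ℕ) (N : Type*) [TopologicalSpace N]
    [ChartedSpace (EuclideanSpace ℝ (Fin n)) N] : Type _ :=
  ∀ x : N, Forms (TangentSpace (𝓡 n) x)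

variable {n n' : ℕ} {N N' : Type*} [TopologicalSpace N] [TopologicalSpace N']
  [ChartedSpace (EuclideanSpace ℝ (Fin n)) N] [ChartedSpace (EuclideanSpace ℝ (Fin n')) N']

/-- The pullback `f^* α`. -/
def pullback (f : N → N') (α : MixedForm n' N') : MixedForm n N :=
  fun x => linPullback (mfderiv (𝓡 n) (𝓡 n') f x).toLinearMap (α (f x))

/-- The basis `dx_S` of the constant forms on `ℝⁿ`. -/
def formBasis (n : ℕ) :
    Module.Basis (Finset (Fin n)) ℝ (Forms (EuclideanSpace ℝ (Fin n))) :=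
  (EuclideanSpace.basisFun (Fin n) ℝ).toBasis.dualBasis.ExteriorAlgebra

/-- The exterior derivative `d (∑ f_S dx_S) = ∑ df_S ∧ dx_S` on `ℝⁿ`. -/
def extDFlat (f : EuclideanSpace ℝ (Fin n) → Forms (EuclideanSpace ℝ (Fin n)))
    (y : EuclideanSpace ℝ (Fin n)) : Forms (EuclideanSpace ℝ (Fin n)) :=
  ∑ S, ExteriorAlgebra.ι ℝ
    (fderiv ℝ (fun z => (formBasis n).repr (f z) S) y).toLinearMap * formBasis n S

/-- The expression of a form in the chart around `x₀`. -/
def chartRep (α : MixedForm n N) (x₀ : N) (y : EuclideanSpace ℝ (Fin n)) :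
    Forms (EuclideanSpace ℝ (Fin n)) :=
  pullback (n := n) (n' := n) (extChartAt (𝓡 n) x₀).symm α y

/-- The exterior derivative of a form, computed at `x` in the chart around `x`. -/
def extD (α : MixedForm n N) : MixedForm n N :=
  fun x => linPullback (mfderiv (𝓡 n) (𝓡 n) (extChartAt (𝓡 n) x) x).toLinearMap
    (extDFlat (chartRep α x) (extChartAt (𝓡 n) x x))

/-- Smooth forms: the coefficients in all charts are smooth. -/
def IsSmoothForm (α : MixedForm n N) : Prop :=
  ∀ (x₀ : N) (S : Finset (Fin n)),
    ContDiffOn ℝ ∞ (fun y => (formBasis n).repr (chartRep α x₀ y) S) (extChartAt (𝓡 n) x₀).target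

/-- `α ∈ Ωᵏ(N)`. -/
def IsForm (k : ℕ) (α : MixedForm n N) : Prop :=
  IsSmoothForm α ∧ ∀ x, α x ∈ ⋀[ℝ]^k (Module.Dual ℝ (TangentSpace (𝓡 n) x))

/-- A closed 3-form. -/
def IsClosedThreeForm (T : MixedForm n N) : Prop := IsForm 3 T ∧ extD T = 0

/-- A nowhere vanishing top degree form, which defines an orientation. -/
def IsOrientationForm (μ : MixedForm n N) : Prop := IsForm n μ ∧ ∀ x, μ x ≠ 0

/-- The twisted differential `d_T ρ = dρ + T ∧ ρ`. -/
def twistedD (T ρ : MixedForm n N) : MixedForm n N := extD ρ + T * ρ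

/-! ## Generalised exceptional structures -/

/-- A topological generalised `G₂`-structure of even (`ε = 0`) or odd (`ε = 1`) type. -/
def IsGenG2Structure (ε : ZMod 2) (ρ : MixedForm n N) : Prop :=
  IsSmoothForm ρ ∧ ∀ x, ρ x ∈ parityForms (TangentSpace (𝓡 n) x) ε ∧ IsG2Form (ρ x)

/-- A topological generalised `Spin(7)`-structure of even (`ε = 0`) or odd (`ε = 1`) type. -/
def IsGenSpin7Structure (ε : ZMod 2) (ρ : MixedForm n N) : Prop :=
  IsSmoothForm ρ ∧ ∀ x, ρ x ∈ parityForms (TangentSpace (𝓡 n) x) ε ∧ IsSpin7Form (ρ x)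

/-- `ρ` is a closed strongly integrable generalised `G₂`-structure with torsion `T`, i.e.
`d_T ρ = 0` and `d_T ρ̂ = 0` with `T` closed, on the manifold oriented by `μ`. -/
def IsClosedStronglyIntegrableG2 (μ T ρ : MixedForm n N) : Prop :=
  (∃ ε, IsGenG2Structure ε ρ) ∧ IsClosedThreeForm T ∧ twistedD T ρ = 0 ∧
    ∃ ρ' : MixedForm n N, IsSmoothForm ρ' ∧ (∀ x, IsCompanion (μ x) (ρ x) (ρ' x)) ∧
      twistedD T ρ' = 0

/-- `ρ` is a closed weakly integrable generalised `G₂`-structure of type `ε` with torsion `T` and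
Killing number `l ≠ 0`, i.e. `d_T ρ = l ρ̂` with `T` closed, on the manifold oriented by `μ`. -/
def IsClosedWeaklyIntegrableG2 (ε : ZMod 2) (l : ℝ) (μ T ρ : MixedForm n N) : Prop :=
  l ≠ 0 ∧ IsGenG2Structure ε ρ ∧ IsClosedThreeForm T ∧
    ∃ ρ' : MixedForm n N, IsSmoothForm ρ' ∧ (∀ x, IsCompanion (μ x) (ρ x) (ρ' x)) ∧
      twistedD T ρ = l • ρ'

/-- `ρ` is a closed integrable generalised `Spin(7)`-structure of type `ε` with torsion `T`, i.e.
`d_T ρ = 0` with `T` closed. -/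
def IsClosedIntegrableSpin7 (ε : ZMod 2) (T ρ : MixedForm n N) : Prop :=
  IsGenSpin7Structure ε ρ ∧ IsClosedThreeForm T ∧ twistedD T ρ = 0

/-! ## T-duality -/

/-- `p : N → N'` is a smooth principal `S¹`-bundle: the action of the circle is smooth and
preserves `p`, and `p` is locally trivial through an equivariant diffeomorphism
`p⁻¹ U ≃ U × S¹`, `x ↦ (p x, c x)` with inverse `(b, z) ↦ z • s b`. -/
structure IsPrincipalCircleBundle [MulAction Circle N] (p : N → N') : Prop where
  smooth : ContMDiff (𝓡 n) (𝓡 n') ∞ p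
  smooth_action : ContMDiff ((𝓡 1).prod (𝓡 n)) (𝓡 n) ∞ fun q : Circle × N => q.1 • q.2
  invariant : ∀ (z : Circle) (x : N), p (z • x) = p x
  locally_trivial : ∀ b₀ : N', ∃ U : Set N', IsOpen U ∧ b₀ ∈ U ∧
    ∃ (s : N' → N) (c : N → Circle),
      ContMDiffOn (𝓡 n') (𝓡 n) ∞ s U ∧ ContMDiffOn (𝓡 n) (𝓡 1) ∞ c (p ⁻¹' U) ∧
      (∀ b ∈ U, p (s b) = b) ∧ (∀ b ∈ U, ∀ z : Circle, c (z • s b) = z) ∧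
      ∀ x ∈ p ⁻¹' U, c x • s (p x) = x

/-- The vertical vector field generating the action of `S¹ = ℝ/ℤ`, normalised to period `1`. -/
def generator [MulAction Circle N] (x : N) : TangentSpace (𝓡 n) x :=
  mfderiv 𝓘(ℝ, ℝ) (𝓡 n) (fun t : ℝ => Circle.exp (2 * Real.pi * t) • x) 0 (1 : ℝ)

/-- A connection form: an `S¹`-invariant 1-form `θ` with `θ(X) = 1`. -/
structure IsConnectionForm [MulAction Circle N] (θ : MixedForm n N) : Prop where
  isForm : IsForm 1 θ
  invariant : ∀ z : Circle, pullback (n := n) (n' := n) (fun x : N => z • x) θ = θ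
  vertical : ∀ x, contract (generator x) (θ x) = 1

end Manifold

section TDuality

variable {m : ℕ} {M P Pt : Type*} [TopologicalSpace M] [TopologicalSpace P] [TopologicalSpace Pt]
  [ChartedSpace (EuclideanSpace ℝ (Fin m)) M]
  [ChartedSpace (EuclideanSpace ℝ (Fin (m + 1))) P]
  [ChartedSpace (EuclideanSpace ℝ (Fin (m + 1))) Pt]

/-- `p : P → M` and `pᵗ : Pᵗ → M` are principal `S¹`-bundles with connection forms `θ`, `θᵗ` and
curvature forms `F`, `Fᵗ` on `M`. -/
structure IsBundlePair [MulAction Circle P] [MulAction Circle Pt] (p : P → M) (pt : Pt → M)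
    (θ : MixedForm (m + 1) P) (θt : MixedForm (m + 1) Pt) (F Ft : MixedForm m M) : Prop where
  bundle : IsPrincipalCircleBundle (n := m + 1) (n' := m) p
  bundle_t : IsPrincipalCircleBundle (n := m + 1) (n' := m) pt
  connection : IsConnectionForm θ
  connection_t : IsConnectionForm θt
  isForm : IsForm 2 F
  isForm_t : IsForm 2 Ft
  curvature : extD θ = pullback p F
  curvature_t : extD θt = pullback pt Ft

/-- `T = -θ ∧ Fᵗ + 𝒯` and `Tᵗ = -θᵗ ∧ F + 𝒯` for a 3-form `𝒯` on `M`.  In particular `T` is an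
`S¹`-invariant 3-form with `X ⌟ T = -Fᵗ`; conversely, every such `T` is of this form. -/
def IsTDualTorsion (p : P → M) (pt : Pt → M) (θ : MixedForm (m + 1) P)
    (θt : MixedForm (m + 1) Pt) (F Ft : MixedForm m M)
    (T : MixedForm (m + 1) P) (Tt : MixedForm (m + 1) Pt) : Prop :=
  ∃ T₀ : MixedForm m M, IsForm 3 T₀ ∧
    T = -(θ * pullback p Ft) + pullback p T₀ ∧ Tt = -(θt * pullback pt F) + pullback pt T₀

/-- `ρ = θ ∧ ρ₀ + ρ₁` and `ρᵗ = θᵗ ∧ ρ₁ + ρ₀` for forms `ρ₀`, `ρ₁` on `M`, i.e. `ρ` is a smooth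
`S¹`-invariant form (conversely, every such form can be written so, in a unique way) and `ρᵗ` is
its T-dual. -/
def IsTDual (p : P → M) (pt : Pt → M) (θ : MixedForm (m + 1) P) (θt : MixedForm (m + 1) Pt)
    (ρ : MixedForm (m + 1) P) (ρt : MixedForm (m + 1) Pt) : Prop :=
  ∃ ρ₀ ρ₁ : MixedForm m M, IsSmoothForm ρ₀ ∧ IsSmoothForm ρ₁ ∧
    ρ = θ * pullback p ρ₀ + pullback p ρ₁ ∧ ρt = θt * pullback pt ρ₁ + pullback pt ρ₀

end TDuality

end GenGeom

end

set_option linter.unusedSectionVars false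

noncomputable section

namespace GenGeom

/-! ## Forms on a vector space -/

section FormsBasic

variable {V W U : Type*} [AddCommGroup V] [Module ℝ V] [AddCommGroup W] [Module ℝ W]
  [AddCommGroup U] [Module ℝ U]

/-! Over a point of the base, T-duality is a single Clifford multiplication. The vector `(θ, X)` has
square `θ(X) = 1` and sends `θ ∧ ρ₀ + ρ₁` to `θ ∧ ρ₁ + ρ₀`; a linear isomorphism of the tangent
spaces of `Pᵗ` and `P` that matches connection forms and projections then turns `θ` into `θᵗ`. Both
steps are spin isomorphisms (`SpinIso`): they intertwine Clifford multiplication along an isometry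
of `V* ⊕ V`, hence conjugate stabilisers and carry `G × G` to `G × G`, for `G₂` and `Spin(7)` alike.
Clifford multiplication with a vector is odd, which exchanges the parities.

For `G₂` the companion has to be followed as well. The operator `□` is Clifford multiplication with
an oriented orthonormal frame of `V₊` (`box_eq_frameProd`), a description that every spin
isomorphism respects. Only the orientation needs care: the vector parts of the frame moved by `(θ,
X)` arise from the old ones by a map of determinant `-|X|²`, so the orientation is reversed
(`IsCompanion.vectorAction`). This is the sign in the orientation of `Pᵗ`.

Integrability is a computation on the base: `d_T(θ ∧ a + b) = -θ ∧ (da + Fᵗ ∧ b + T₀ ∧ a) + (db + F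
∧ a + T₀ ∧ b)`. Exchanging `(a, F)` with `(b, Fᵗ)` exchanges the brackets, so the T-dual of `d_T ρ`
is `-d_{Tᵗ} ρᵗ` (`IsBundlePair.isTDual_twistedD`); the minus sign reverses the Killing number.
Closedness of either torsion is the symmetric equation `dT₀ = F ∧ Fᵗ`.

In the strong case the companion must be shown to have a T-dual at all. The stabiliser determines
`V₊`, so the companion is unique (`IsCompanion.unique`) and inherits the circle invariance of `ρ`
and of the orientation. It therefore has components on the base, which are smooth by contraction
with the generator and pullback along local sections. Converses follow from the symmetry of the
situation, with `ν` replaced by `-ν`. -/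

theorem Forms.left_induction {C : Forms V → Prop} (algebraMap : ∀ r : ℝ, C (algebraMap ℝ _ r))
    (add : ∀ α β, C α → C β → C (α + β))
    (ι_mul : ∀ α ξ, C α → C (ExteriorAlgebra.ι ℝ ξ * α)) (α : Forms V) : C α :=
  CliffordAlgebra.left_induction (Q := (0 : QuadraticForm ℝ (Module.Dual ℝ V)))
    algebraMap add ι_mul α

theorem contract_ι_mul (v : V) (ξ : Module.Dual ℝ V) (α : Forms V) :
    contract v (ExteriorAlgebra.ι ℝ ξ * α) =
      ξ v • α - ExteriorAlgebra.ι ℝ ξ * contract v α :=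
  CliffordAlgebra.contractLeft_ι_mul _ _ _

@[simp] theorem contract_algebraMap (v : V) (r : ℝ) :
    contract v (algebraMap ℝ (Forms V) r) = 0 :=
  CliffordAlgebra.contractLeft_algebraMap _ _ _

@[simp] theorem contract_one (v : V) : contract v (1 : Forms V) = 0 :=
  CliffordAlgebra.contractLeft_one _ _

theorem contract_ι (v : V) (ξ : Module.Dual ℝ V) :
    contract v (ExteriorAlgebra.ι ℝ ξ) = algebraMap ℝ (Forms V) (ξ v) :=
  CliffordAlgebra.contractLeft_ι _ _ _

theorem contract_comm (v w : V) (α : Forms V) :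
    contract v (contract w α) = -contract w (contract v α) :=
  CliffordAlgebra.contractLeft_comm _ _ _

theorem contract_smul_left (c : ℝ) (v : V) (α : Forms V) :
    contract (c • v) α = c • contract v α := by
  simp [contract]

theorem contract_neg_left (v : V) (α : Forms V) : contract (-v) α = -contract v α := by
  simp [contract]

@[simp] theorem contract_zero_left (α : Forms V) : contract (0 : V) α = 0 := by
  simp [contract]

theorem contract_sum_left {ι : Type*} (s : Finset ι) (v : ι → V) (α : Forms V) :
    contract (∑ i ∈ s, v i) α = ∑ i ∈ s, contract (v i) α := by
  simp [contract]

@[simp] theorem linPullback_ι (f : V →ₗ[ℝ] W) (ξ : Module.Dual ℝ W) :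
    linPullback f (ExteriorAlgebra.ι ℝ ξ) = ExteriorAlgebra.ι ℝ (ξ.comp f) :=
  ExteriorAlgebra.map_apply_ι _ _

theorem linPullback_comp (f : V →ₗ[ℝ] W) (g : W →ₗ[ℝ] U) (α : Forms U) :
    linPullback f (linPullback g α) = linPullback (g.comp f) α := by
  have : (linPullback f).comp (linPullback g) = linPullback (g.comp f) := by
    ext ξ; simp [LinearMap.comp_assoc]
  exact DFunLike.congr_fun this α

@[simp] theorem linPullback_id (α : Forms V) : linPullback (LinearMap.id : V →ₗ[ℝ] V) α = α := by
  have : linPullback (LinearMap.id : V →ₗ[ℝ] V) = AlgHom.id ℝ _ := by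
    ext ξ; simp
  exact DFunLike.congr_fun this α

theorem contract_linPullback (f : V →ₗ[ℝ] W) (v : V) (α : Forms W) :
    contract v (linPullback f α) = linPullback f (contract (f v) α) := by
  induction α using Forms.left_induction with
  | algebraMap r => simp
  | add α β h1 h2 => simp [h1, h2]
  | ι_mul α ξ h => simp [contract_ι_mul, h]

theorem involute_ι_form (ξ : Module.Dual ℝ V) :
    CliffordAlgebra.involute (ExteriorAlgebra.ι ℝ ξ : Forms V) = -ExteriorAlgebra.ι ℝ ξ :=
  CliffordAlgebra.involute_ι _

/-- The grading involution records the sign `(-1)^k` that a 1-form picks up on passing a `k`-form,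
so forms of mixed degree need not be split into their components. -/
theorem involute_mul_ι (ξ : Module.Dual ℝ V) (α : Forms V) :
    ExteriorAlgebra.ι ℝ ξ * α = CliffordAlgebra.involute α * ExteriorAlgebra.ι ℝ ξ := by
  induction α using Forms.left_induction with
  | algebraMap r => simp [Algebra.commutes]
  | add α β h1 h2 => simp [mul_add, add_mul, h1, h2]
  | ι_mul α η h =>
    have h1 := ExteriorAlgebra.ι_add_mul_swap (R := ℝ) ξ η
    rw [map_mul, involute_ι_form, mul_assoc, ← h, ← mul_assoc, eq_neg_of_add_eq_zero_left h1]
    simp [mul_assoc]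

theorem involute_linPullback (f : V →ₗ[ℝ] W) (α : Forms W) :
    CliffordAlgebra.involute (linPullback f α) = linPullback f (CliffordAlgebra.involute α) := by
  induction α using Forms.left_induction with
  | algebraMap r => simp
  | add α β h1 h2 => simp only [map_add, h1, h2]
  | ι_mul α ξ h =>
    rw [map_mul, map_mul, map_mul, map_mul, h, involute_ι_form, linPullback_ι,
      involute_ι_form, map_neg, linPullback_ι]

theorem mem_exteriorPower_one {α : Forms V} (h : α ∈ ⋀[ℝ]^1 (Module.Dual ℝ V)) :
    ∃ ξ, α = ExteriorAlgebra.ι ℝ ξ := by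
  rw [ExteriorAlgebra.exteriorPower, pow_one] at h
  obtain ⟨ξ, rfl⟩ := h
  exact ⟨ξ, rfl⟩

/-- To prove a linear property of 2-forms it suffices to consider `ξ ∧ η`. -/
theorem exteriorPower_two_induction {C : Forms V → Prop}
    (add : ∀ α β, C α → C β → C (α + β))
    (mul : ∀ ξ η, C (ExteriorAlgebra.ι ℝ ξ * ExteriorAlgebra.ι ℝ η))
    {α : Forms V} (h : α ∈ ⋀[ℝ]^2 (Module.Dual ℝ V)) : C α := by
  rw [ExteriorAlgebra.exteriorPower, pow_two] at h
  induction h using Submodule.mul_induction_on' with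
  | mem_mul_mem m hm n hn =>
    obtain ⟨ξ, rfl⟩ := hm
    obtain ⟨η, rfl⟩ := hn
    exact mul ξ η
  | add x _ y _ hx hy => exact add x y hx hy

theorem ι_mul_ι_mem (ξ η : Module.Dual ℝ V) :
    (ExteriorAlgebra.ι ℝ ξ * ExteriorAlgebra.ι ℝ η : Forms V) ∈ ⋀[ℝ]^2 (Module.Dual ℝ V) := by
  rw [ExteriorAlgebra.exteriorPower, pow_two]
  exact Submodule.mul_mem_mul ⟨ξ, rfl⟩ ⟨η, rfl⟩

theorem exteriorPower_two_commute {β : Forms V} (h : β ∈ ⋀[ℝ]^2 (Module.Dual ℝ V)) (α : Forms V) :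
    Commute β α := by
  refine exteriorPower_two_induction (C := fun β => Commute β α) (fun x y hx hy => hx.add_left hy)
    (fun ξ η => ?_) h
  change ExteriorAlgebra.ι ℝ ξ * ExteriorAlgebra.ι ℝ η * α = α * _
  rw [mul_assoc, involute_mul_ι η, ← mul_assoc, involute_mul_ι ξ, mul_assoc,
      CliffordAlgebra.involute_involute]

/-- Contraction is an antiderivation; no sign appears because a 2-form is even. -/
theorem contract_mul_of_two {β : Forms V} (h : β ∈ ⋀[ℝ]^2 (Module.Dual ℝ V)) (v : V)
    (α : Forms V) : contract v (β * α) = contract v β * α + β * contract v α := by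
  refine exteriorPower_two_induction (C := fun β => contract v (β * α) = contract v β * α +
    β * contract v α) (fun x y hx hy => ?_) (fun ξ η => ?_) h
  · simp only [add_mul, map_add, hx, hy]; abel
  · simp only [mul_assoc, contract_ι_mul, mul_sub, sub_mul, contract_ι, smul_mul_assoc,
      mul_smul_comm]
    rw [← Algebra.smul_def, mul_smul_comm]
    abel

theorem linPullback_mem_exteriorPower (f : V →ₗ[ℝ] W) {k : ℕ} {α : Forms W}
    (h : α ∈ ⋀[ℝ]^k (Module.Dual ℝ W)) : linPullback f α ∈ ⋀[ℝ]^k (Module.Dual ℝ V) := by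
  have hle : Submodule.map (linPullback f).toLinearMap
      (LinearMap.range (ExteriorAlgebra.ι ℝ : Module.Dual ℝ W →ₗ[ℝ] Forms W)) ≤
      LinearMap.range (ExteriorAlgebra.ι ℝ : Module.Dual ℝ V →ₗ[ℝ] Forms V) := by
    rintro _ ⟨_, ⟨ξ, rfl⟩, rfl⟩
    exact ⟨ξ.comp f, (linPullback_ι f ξ).symm⟩
  have h1 : linPullback f α ∈ Submodule.map (linPullback f).toLinearMap
    (⋀[ℝ]^k (Module.Dual ℝ W)) := ⟨α, h, rfl⟩
  rw [ExteriorAlgebra.exteriorPower, Submodule.map_pow] at h1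
  exact pow_le_pow_left' hle k h1

theorem mul_mem_exteriorPower {k l : ℕ} {α β : Forms V}
    (hα : α ∈ ⋀[ℝ]^k (Module.Dual ℝ V)) (hβ : β ∈ ⋀[ℝ]^l (Module.Dual ℝ V)) :
    α * β ∈ ⋀[ℝ]^(k + l) (Module.Dual ℝ V) := by
  rw [ExteriorAlgebra.exteriorPower, pow_add]
  exact Submodule.mul_mem_mul hα hβ

/-- Parity becomes an eigenvalue equation for the involution, which is easy to follow through
pullbacks and Clifford multiplication. -/
theorem mem_parityForms_zero_iff {α : Forms V} :
    α ∈ parityForms V 0 ↔ CliffordAlgebra.involute α = α := by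
  refine ⟨CliffordAlgebra.involute_eq_of_mem_even, fun h => ?_⟩
  obtain ⟨a, ha, b, hb, rfl⟩ := Submodule.mem_sup.1
    ((CliffordAlgebra.evenOdd_isCompl (0 : QuadraticForm ℝ (Module.Dual ℝ V))).codisjoint.eq_top ▸
      Submodule.mem_top (x := α))
  rw [map_add, CliffordAlgebra.involute_eq_of_mem_even ha,
    CliffordAlgebra.involute_eq_of_mem_odd hb, add_right_inj] at h
  have h2 : (2 : ℝ) • b = 0 := by rw [two_smul]; nth_rewrite 1 [← h]; simp
  rw [(smul_eq_zero_iff_right two_ne_zero).1 h2, add_zero]; exact ha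

theorem mem_parityForms_one_iff {α : Forms V} :
    α ∈ parityForms V 1 ↔ CliffordAlgebra.involute α = -α := by
  refine ⟨CliffordAlgebra.involute_eq_of_mem_odd, fun h => ?_⟩
  obtain ⟨a, ha, b, hb, rfl⟩ := Submodule.mem_sup.1
    ((CliffordAlgebra.evenOdd_isCompl (0 : QuadraticForm ℝ (Module.Dual ℝ V))).codisjoint.eq_top ▸
      Submodule.mem_top (x := α))
  rw [map_add, CliffordAlgebra.involute_eq_of_mem_even ha,
    CliffordAlgebra.involute_eq_of_mem_odd hb, neg_add, add_left_inj] at h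
  have h2 : (2 : ℝ) • a = 0 := by rw [two_smul]; nth_rewrite 1 [h]; simp
  rw [(smul_eq_zero_iff_right two_ne_zero).1 h2, zero_add]; exact hb

theorem linPullback_mem_parityForms (f : V →ₗ[ℝ] W) {ε : ZMod 2} {α : Forms W}
    (h : α ∈ parityForms W ε) : linPullback f α ∈ parityForms V ε := by
  have hε : ε = 0 ∨ ε = 1 := (by decide : ∀ ε : ZMod 2, ε = 0 ∨ ε = 1) ε
  rcases hε with rfl | rfl
  · rw [mem_parityForms_zero_iff] at h ⊢
    rw [involute_linPullback, h]
  · rw [mem_parityForms_one_iff] at h ⊢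
    rw [involute_linPullback, h, map_neg]

theorem involute_contract (v : V) (α : Forms V) :
    CliffordAlgebra.involute (contract v α) = -contract v (CliffordAlgebra.involute α) := by
  induction α using Forms.left_induction with
  | algebraMap r => simp
  | add α β h1 h2 => simp only [map_add, h1, h2]; abel
  | ι_mul α ξ h =>
    simp only [map_mul, map_sub, map_neg, map_smul, involute_ι_form, contract_ι_mul, h, neg_mul]
    simp

/-- Wedging with a 1-form and contracting both change the degree by one. This is the source of the
exchange of even and odd types. -/
theorem vectorAction_mem_parityForms (a : Module.Dual ℝ V × V) {ε : ZMod 2} {α : Forms V}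
    (h : α ∈ parityForms V ε) : vectorAction V a α ∈ parityForms V (ε + 1) := by
  have key : CliffordAlgebra.involute (vectorAction V a α) =
      -vectorAction V a (CliffordAlgebra.involute α) := by
    rw [vectorAction_apply, vectorAction_apply, map_add, map_mul, involute_contract,
      involute_ι_form, neg_mul, neg_add]
  have hε : ε = 0 ∨ ε = 1 := (by decide : ∀ ε : ZMod 2, ε = 0 ∨ ε = 1) ε
  rcases hε with rfl | rfl
  · rw [zero_add, mem_parityForms_one_iff, key, mem_parityForms_zero_iff.1 h]
  · rw [show (1 + 1 : ZMod 2) = 0 by decide, mem_parityForms_zero_iff, key,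
      mem_parityForms_one_iff.1 h, map_neg, neg_neg]

end FormsBasic

/-! ## Isomorphisms of spin representations -/

section Spin

variable {V W U : Type*} [AddCommGroup V] [Module ℝ V] [AddCommGroup W] [Module ℝ W]
  [AddCommGroup U] [Module ℝ U]

/-- An isometry `V* ⊕ V ≃ W* ⊕ W` together with a compatible isomorphism of the spin
representations. -/
structure SpinIso (V W : Type*) [AddCommGroup V] [Module ℝ V] [AddCommGroup W] [Module ℝ W] where
  /-- the isometry -/
  vec : (Module.Dual ℝ V × V) ≃ₗ[ℝ] (Module.Dual ℝ W × W)
  /-- the map of spinors -/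
  spin : Forms V ≃ₗ[ℝ] Forms W
  isometry : ∀ a, QuadraticForm.dualProd ℝ W (vec a) = QuadraticForm.dualProd ℝ V a
  intertwines : ∀ a α, spin (vectorAction V a α) = vectorAction W (vec a) (spin α)

/-- The inverse isomorphism. -/
def SpinIso.symm (s : SpinIso V W) : SpinIso W V where
  vec := s.vec.symm
  spin := s.spin.symm
  isometry a := by rw [← s.isometry, LinearEquiv.apply_symm_apply]
  intertwines a α := by
    rw [LinearEquiv.symm_apply_eq, s.intertwines, LinearEquiv.apply_symm_apply,
      LinearEquiv.apply_symm_apply]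

/-- The isometry as a morphism of quadratic spaces. -/
def SpinIso.quad (s : SpinIso V W) :
    QuadraticForm.dualProd ℝ V →qᵢ QuadraticForm.dualProd ℝ W where
  toLinearMap := s.vec.toLinearMap
  map_app' := s.isometry

/-! ### Functoriality of the spin group and of stabilisers -/

theorem star_map_cliffordAlgebra {M N : Type*} [AddCommGroup M] [Module ℝ M] [AddCommGroup N]
    [Module ℝ N] {Q : QuadraticForm ℝ M} {Q' : QuadraticForm ℝ N} (f : Q →qᵢ Q')
    (x : CliffordAlgebra Q) : star (CliffordAlgebra.map f x) = CliffordAlgebra.map f (star x) := by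
  induction x using CliffordAlgebra.induction with
  | algebraMap r => simp
  | ι m => simp
  | mul a b ha hb => simp [ha, hb]
  | add a b ha hb => simp [ha, hb]

/-- Each defining condition passes through a morphism of quadratic spaces: generators of the
Lipschitz group go to generators, unitarity is compatible with `star`, and even products of vectors
go to even products. -/
theorem map_mem_spinGroup {M N : Type*} [AddCommGroup M] [Module ℝ M] [AddCommGroup N]
    [Module ℝ N] {Q : QuadraticForm ℝ M} {Q' : QuadraticForm ℝ N} (f : Q →qᵢ Q')
    {x : CliffordAlgebra Q} (hx : x ∈ spinGroup Q) : CliffordAlgebra.map f x ∈ spinGroup Q' := by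
  obtain ⟨⟨⟨u, hu, rfl⟩, hstar⟩, heven⟩ := hx
  refine ⟨⟨⟨Units.map (CliffordAlgebra.map f).toMonoidHom u, ?_, rfl⟩, ?_⟩, ?_⟩
  · have hle : (lipschitzGroup Q).map (Units.map (CliffordAlgebra.map f).toMonoidHom) ≤
        lipschitzGroup Q' := by
      rw [lipschitzGroup, MonoidHom.map_closure, Subgroup.closure_le]
      rintro _ ⟨v, ⟨m, hm⟩, rfl⟩
      refine Subgroup.subset_closure ⟨f m, ?_⟩
      rw [← CliffordAlgebra.map_apply_ι]
      exact congrArg _ hm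
    exact hle ⟨u, hu, rfl⟩
  · rw [SetLike.mem_coe, Unitary.mem_iff] at hstar ⊢
    change star (CliffordAlgebra.map f u) * CliffordAlgebra.map f u = 1 ∧
      CliffordAlgebra.map f u * star (CliffordAlgebra.map f u) = 1
    rw [star_map_cliffordAlgebra, ← map_mul, ← map_mul]
    exact ⟨by erw [hstar.1, map_one], by erw [hstar.2, map_one]⟩
  · change CliffordAlgebra.map f u ∈ CliffordAlgebra.evenOdd Q' 0
    have hle : ∀ y ∈ CliffordAlgebra.evenOdd Q 0,
        CliffordAlgebra.map f y ∈ CliffordAlgebra.evenOdd Q' 0 := by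
      intro y hy
      induction y, hy using CliffordAlgebra.even_induction with
      | algebraMap r => 
        rw [AlgHom.commutes]
        exact SetLike.algebraMap_mem_graded (CliffordAlgebra.evenOdd Q') r
      | add x y hx hy h1 h2 => rw [map_add]; exact add_mem h1 h2
      | ι_mul_ι_mul m₁ m₂ x hx h =>
        rw [map_mul, map_mul, CliffordAlgebra.map_apply_ι, CliffordAlgebra.map_apply_ι]
        have := CliffordAlgebra.evenOdd_mul_le Q' 0 0 (Submodule.mul_mem_mul
          (CliffordAlgebra.ι_mul_ι_mem_evenOdd_zero Q' (f m₁) (f m₂)) h)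
        rwa [add_zero] at this
    exact hle _ heven

theorem cliffordAction_ι (a : Module.Dual ℝ V × V) :
    cliffordAction V (CliffordAlgebra.ι _ a) = vectorAction V a :=
  CliffordAlgebra.lift_ι_apply _ _ _

theorem SpinIso.cliffordAction_map (s : SpinIso V W)
    (x : CliffordAlgebra (QuadraticForm.dualProd ℝ V)) (α : Forms V) :
    cliffordAction W (CliffordAlgebra.map s.quad x) (s.spin α) = s.spin (cliffordAction V x α) := by
  induction x using CliffordAlgebra.induction generalizing α with
  | algebraMap r => simp [Module.algebraMap_end_apply]
  | ι a =>
    rw [CliffordAlgebra.map_apply_ι, cliffordAction_ι, cliffordAction_ι, s.intertwines]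
    rfl
  | mul a b ha hb => simp [ha, hb]
  | add a b ha hb => simp [ha, hb]

/-- If `x` fixes `ρ` and covers `A`, its image in the other Clifford algebra fixes the image of `ρ`
and covers the conjugate of `A`. -/
theorem SpinIso.conj_mem_stabiliser (s : SpinIso V W) {ρ : Forms V}
    {A : Module.End ℝ (Module.Dual ℝ V × V)} (hA : A ∈ stabiliser ρ) :
    s.vec.conj A ∈ stabiliser (s.spin ρ) := by
  obtain ⟨x, hx, h1, h2⟩ := hA
  refine ⟨CliffordAlgebra.map s.quad x, map_mem_spinGroup _ hx, ?_, fun a => ?_⟩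
  · rw [s.cliffordAction_map, h1]
  · have h3 := congrArg (CliffordAlgebra.map s.quad) (h2 (s.vec.symm a))
    rw [map_mul, map_mul, CliffordAlgebra.map_apply_ι, CliffordAlgebra.map_apply_ι] at h3
    have h4 : s.quad (s.vec.symm a) = a := s.vec.apply_symm_apply a
    rwa [h4] at h3

theorem SpinIso.mem_stabiliser_iff (s : SpinIso V W) {ρ : Forms V}
    {A : Module.End ℝ (Module.Dual ℝ W × W)} :
    A ∈ stabiliser (s.spin ρ) ↔ s.vec.symm.conj A ∈ stabiliser ρ := by
  constructor
  · intro h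
    have := s.symm.conj_mem_stabiliser h
    rwa [show s.symm.spin (s.spin ρ) = ρ from s.spin.symm_apply_apply ρ] at this
  · intro h
    have := s.conj_mem_stabiliser h
    rwa [show s.vec.conj (s.vec.symm.conj A) = A from s.vec.conj.apply_symm_apply A] at this

theorem polar_dualProd (a b : Module.Dual ℝ V × V) :
    QuadraticMap.polar (QuadraticForm.dualProd ℝ V) a b = LinearMap.dualProd ℝ V a b := by
  simp [QuadraticMap.polar, QuadraticForm.dualProd, LinearMap.dualProd_apply_apply]
  ring

theorem SpinIso.dualProd_vec (s : SpinIso V W) (a b : Module.Dual ℝ V × V) :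
    LinearMap.dualProd ℝ W (s.vec a) (s.vec b) = LinearMap.dualProd ℝ V a b := by
  simp only [← polar_dualProd, QuadraticMap.polar, ← map_add, s.isometry]

/-- The group `G` lives on `ℝⁿ`, so moving the frames by the isometry conjugates `G × G` to `G × G`
without touching `G`. One argument thus serves `G₂` and `Spin(7)`. -/
theorem SpinIso.hasStabiliser (s : SpinIso V W) {n : ℕ}
    {G : Set ((Fin n → ℝ) ≃ₗ[ℝ] (Fin n → ℝ))} {ρ : Forms V}
    {wp wm : (Fin n → ℝ) →ₗ[ℝ] (Module.Dual ℝ V × V)} (h : HasStabiliser G ρ wp wm) :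
    HasStabiliser G (s.spin ρ) (s.vec.toLinearMap.comp wp) (s.vec.toLinearMap.comp wm) := by
  refine ⟨⟨fun u => ?_, fun u => ?_, fun u u' => ?_⟩, ?_⟩
  · exact (s.isometry _).trans (h.1.pos u)
  · exact (s.isometry _).trans (h.1.neg u)
  · exact (s.dualProd_vec _ _).trans (h.1.orthogonal u u')
  · ext A
    rw [s.mem_stabiliser_iff, h.2]
    simp only [productGroup, Set.mem_ofPred_eq, LinearMap.comp_apply, LinearEquiv.coe_coe,
      LinearEquiv.conj_apply, LinearEquiv.symm_symm, LinearEquiv.symm_apply_eq]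

/-- The isomorphism induced by a linear isomorphism of the underlying vector spaces. -/
def SpinIso.ofEquiv (f : W ≃ₗ[ℝ] V) : SpinIso V W where
  vec := f.dualMap.prodCongr f.symm
  spin := LinearEquiv.ofLinearMap (linPullback f.toLinearMap).toLinearMap
    (linPullback f.symm.toLinearMap).toLinearMap
    (by ext α; simp [linPullback_comp]) (by ext α; simp [linPullback_comp])
  isometry a := by simp [QuadraticForm.dualProd_apply]
  intertwines a α := by
    simp [vectorAction_apply, contract_linPullback]
    rfl

theorem vectorAction_mul_add (a b : Module.Dual ℝ V × V) :
    vectorAction V a * vectorAction V b + vectorAction V b * vectorAction V a =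
      algebraMap ℝ _ (LinearMap.dualProd ℝ V a b) := by
  have h := vectorAction_sq (a + b)
  rw [map_add, mul_add, add_mul, add_mul, vectorAction_sq, vectorAction_sq] at h
  rw [← polar_dualProd, QuadraticMap.polar, map_sub, map_sub, ← h]
  abel

/-- The isomorphism given by Clifford multiplication with a vector `r` with `r² = 1`, which covers
the negative of the reflection along `r`. -/
def SpinIso.reflection (r : Module.Dual ℝ V × V) (hr : QuadraticForm.dualProd ℝ V r = 1) :
    SpinIso V V :=
  -- The bilinear form is the full polarisation, without a factor `1/2`, so its diagonal is twice
  -- the quadratic form.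
  have hr2 : LinearMap.dualProd ℝ V r r = 2 := by
    rw [← polar_dualProd, QuadraticMap.polar_self, hr]; norm_num
  have hs : Function.Involutive (vectorAction V r) := fun α => by
    rw [← Module.End.mul_apply, vectorAction_sq, hr, map_one, Module.End.one_apply]
  -- Since `r⁻¹ = r` and `r a + a r = ⟨r, a⟩`, the covered map is `a ↦ r a r = ⟨r, a⟩ r - a`.
  let t : (Module.Dual ℝ V × V) →ₗ[ℝ] (Module.Dual ℝ V × V) :=
    (LinearMap.dualProd ℝ V r).smulRight r - LinearMap.id
  have ht : Function.Involutive t := fun a => by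
    simp only [t, LinearMap.sub_apply, LinearMap.smulRight_apply, LinearMap.id_apply, map_sub,
      map_smul, hr2]
    module
  { vec := LinearEquiv.ofInvolutive t ht
    spin := LinearEquiv.ofInvolutive (vectorAction V r) hs
    isometry := fun a => by
      have h := QuadraticMap.map_add (QuadraticForm.dualProd ℝ V)
        (LinearMap.dualProd ℝ V r a • r) (-a)
      rw [QuadraticMap.map_neg, QuadraticMap.map_smul, QuadraticMap.polar_smul_left,
        QuadraticMap.polar_neg_right, polar_dualProd, hr] at h
      simp only [LinearEquiv.coe_ofInvolutive, t, LinearMap.sub_apply, LinearMap.smulRight_apply,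
        LinearMap.id_apply]
      rw [sub_eq_add_neg, h]
      simp only [smul_eq_mul]
      ring
    intertwines := fun a α => by
      have h := LinearMap.congr_fun (vectorAction_mul_add r a) α
      simp only [LinearMap.add_apply, Module.End.mul_apply, Module.algebraMap_end_apply] at h
      simp only [LinearEquiv.coe_ofInvolutive, t, LinearMap.sub_apply, LinearMap.smulRight_apply,
        LinearMap.id_apply, map_sub, map_smul, LinearMap.smul_apply]
      rw [hs, ← h]
      abel }

theorem SpinIso.isG2Form (s : SpinIso V W) {ρ : Forms V} (h : IsG2Form ρ) :
    IsG2Form (s.spin ρ) := by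
  obtain ⟨wp, wm, h⟩ := h
  exact ⟨_, _, s.hasStabiliser h⟩

theorem SpinIso.isSpin7Form (s : SpinIso V W) {ρ : Forms V} (h : IsSpin7Form ρ) :
    IsSpin7Form (s.spin ρ) := by
  obtain ⟨wp, wm, h⟩ := h
  exact ⟨_, _, s.hasStabiliser h⟩

end Spin

/-! ## The generalised Hodge operator as Clifford multiplication -/

section Box

variable {V : Type*} [AddCommGroup V] [Module ℝ V]

theorem mul_list_prod_of_anticommute {A : Type*} [Ring A] (q : A) (l : List A)
    (h : ∀ a ∈ l, q * a = -(a * q)) : q * l.prod = (-1) ^ l.length * (l.prod * q) := by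
  induction l with
  | nil => simp
  | cons a l ih =>
    have ih' := ih fun b hb => h b (List.mem_cons_of_mem _ hb)
    rw [List.prod_cons, ← mul_assoc, h a List.mem_cons_self, neg_mul, mul_assoc, ih',
      List.length_cons, pow_succ, mul_neg_one, neg_mul, neg_inj, ← mul_assoc, ← mul_assoc,
      ← mul_assoc, ← ((Commute.neg_one_left a).pow_left _).eq]
    simp only [mul_assoc]

/-- The factor `f j` passes itself without a sign, so one sign fewer occurs than for an element that
anticommutes with every factor; the exponent `length - 1` is written as `length + 1`. -/
theorem mul_list_prod_of_mem {A ι : Type*} [Ring A] [DecidableEq ι] (f : ι → A)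
    (h : ∀ i j, i ≠ j → f i * f j = -(f j * f i)) (l : List ι) (hl : l.Nodup) (j : ι)
    (hj : j ∈ l) : f j * (l.map f).prod = (-1) ^ (l.length + 1) * ((l.map f).prod * f j) := by
  induction l with
  | nil => simp at hj
  | cons a l ih =>
    rw [List.nodup_cons] at hl
    rw [List.map_cons, List.prod_cons]
    by_cases hja : j = a
    · subst hja
      have := mul_list_prod_of_anticommute (f j) (l.map f) (by
        intro b hb
        obtain ⟨i, hi, rfl⟩ := List.mem_map.1 hb
        exact h _ _ (fun hij => hl.1 (hij ▸ hi)))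
      rw [mul_assoc (f j) _ (f j), this, List.length_cons, List.length_map, pow_add, pow_add]
      simp only [pow_one, mul_neg_one, neg_neg, ← mul_assoc]
      rw [((Commute.neg_one_left (f j)).pow_left _).eq]
    · have hj' : j ∈ l := by simpa [hja] using hj
      rw [← mul_assoc, h _ _ hja, neg_mul, mul_assoc, ih hl.2 hj', List.length_cons,
        pow_succ _ (l.length + 1), mul_neg_one, neg_mul, neg_inj, ← mul_assoc, ← mul_assoc,
        ← mul_assoc, ← ((Commute.neg_one_left (f a)).pow_left _).eq]
      simp only [mul_assoc]

theorem mul_list_prod_of_anticommute_of_odd {A : Type*} [Ring A] (q : A) (l : List A)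
    (h : ∀ a ∈ l, q * a = -(a * q)) (hl : Odd l.length) : q * l.prod = -(l.prod * q) := by
  rw [mul_list_prod_of_anticommute q l h, hl.neg_one_pow, neg_one_mul]

theorem mul_list_prod_of_mem_of_odd {A ι : Type*} [Ring A] [DecidableEq ι] (f : ι → A)
    (h : ∀ i j, i ≠ j → f i * f j = -(f j * f i)) (l : List ι) (hl : l.Nodup) (j : ι)
    (hj : j ∈ l) (hodd : Odd l.length) : f j * (l.map f).prod = (l.map f).prod * f j := by
  rw [mul_list_prod_of_mem f h l hl j hj, hodd.add_one.neg_one_pow, one_mul]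

/-! ### The exponential of a 2-form in dimension seven -/

theorem eq_zero_of_mem_exteriorPower {k : ℕ} [FiniteDimensional ℝ V]
    (hk : Module.finrank ℝ V < k) {α : Forms V} (h : α ∈ ⋀[ℝ]^k (Module.Dual ℝ V)) : α = 0 := by
  have h1 : Module.finrank ℝ (⋀[ℝ]^k (Module.Dual ℝ V)) = 0 := by
    rw [exteriorPower.finrank_eq, Subspace.dual_finrank_eq, Nat.choose_eq_zero_of_lt hk]
  have h2 := Module.finrank_zero_iff.1 h1
  exact congrArg Subtype.val (Subsingleton.elim (⟨α, h⟩ : ⋀[ℝ]^k (Module.Dual ℝ V)) 0)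

theorem finrank_of_basis {n : ℕ} (e : Module.Basis (Fin n) ℝ V) : Module.finrank ℝ V = n := by
  simpa using Module.finrank_eq_card_basis e

/-- `β ^ 4` has degree 8 in dimension 7. The exponential is therefore a cubic polynomial in `β`. -/
theorem two_form_pow_four (e : Module.Basis (Fin 7) ℝ V) {β : Forms V}
    (hβ : β ∈ ⋀[ℝ]^2 (Module.Dual ℝ V)) : β ^ 4 = 0 := by
  have := e.finiteDimensional_of_finite
  refine eq_zero_of_mem_exteriorPower (k := 2 + 2 + (2 + 2)) (by rw [finrank_of_basis e]; norm_num)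
    ?_
  rw [show β ^ 4 = β * β * (β * β) by noncomm_ring]
  exact mul_mem_exteriorPower (mul_mem_exteriorPower hβ hβ) (mul_mem_exteriorPower hβ hβ)

theorem expForm_seven {β : Forms V} (h : β ^ 4 = 0) :
    expForm 7 β = 1 + β + (2⁻¹ : ℝ) • β ^ 2 + (6⁻¹ : ℝ) • β ^ 3 := by
  have h4 : ∀ k, β ^ (k + 4) = 0 := fun k => by rw [pow_add, h, mul_zero]
  simp only [expForm, Finset.sum_range_succ, Finset.sum_range_zero, h4 0, h4 1, h4 2, h4 3,
    Nat.factorial]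
  norm_num

theorem expForm_seven_mul_neg {β : Forms V} (h : β ^ 4 = 0) :
    expForm 7 β * expForm 7 (-β) = 1 := by
  have h' : (-β) ^ 4 = 0 := by rw [neg_pow, h, mul_zero]
  have h4 : ∀ k, β ^ (k + 4) = 0 := fun k => by rw [pow_add, h, mul_zero]
  rw [expForm_seven h, expForm_seven h', neg_sq, show (-β) ^ 3 = -β ^ 3 from by rw [Odd.neg_pow (by decide)]]
  have e1 : β * β = β ^ 2 := (pow_two β).symm
  have e2 : β * β ^ 2 = β ^ 3 := (pow_succ' β 2).symm
  have e3 : β ^ 2 * β = β ^ 3 := (pow_succ β 2).symm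
  have e4 : β * β ^ 3 = 0 := (pow_succ' β 3).symm.trans h
  have e5 : β ^ 3 * β = 0 := (pow_succ β 3).symm.trans h
  have e6 : β ^ 2 * β ^ 2 = 0 := (pow_add β 2 2).symm.trans h
  have e7 : β ^ 2 * β ^ 3 = 0 := (pow_add β 2 3).symm.trans (h4 1)
  have e8 : β ^ 3 * β ^ 2 = 0 := (pow_add β 3 2).symm.trans (h4 1)
  have e9 : β ^ 3 * β ^ 3 = 0 := (pow_add β 3 3).symm.trans (h4 2)
  simp only [mul_add, add_mul, smul_mul_assoc, mul_smul_comm, mul_one, one_mul, mul_neg,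
    smul_neg, e1, e2, e3, e4, e5, e6, e7, e8, e9, smul_zero]
  module

/-- Wedging with `β` commutes with wedging by `ξ`, while its commutator with `v ⌟` is wedging by
`-(v ⌟ β)`. Exponentiated, conjugation with `e^β` shifts the covector by `-(v ⌟ β)`. -/
theorem expForm_mul_vectorAction {β : Forms V} (hβ : β ∈ ⋀[ℝ]^2 (Module.Dual ℝ V))
    (h : β ^ 4 = 0) {ξ ξ' : Module.Dual ℝ V} {v : V}
    (hξ : ExteriorAlgebra.ι ℝ ξ' = ExteriorAlgebra.ι ℝ ξ - contract v β) (α : Forms V) :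
    expForm 7 β * vectorAction V (ξ, v) α = vectorAction V (ξ', v) (expForm 7 β * α) := by
  have hc := fun γ => (exteriorPower_two_commute hβ γ)
  have hE : ∀ γ, expForm 7 β * γ = γ + β * γ + (2⁻¹ : ℝ) • (β * (β * γ)) +
      (6⁻¹ : ℝ) • (β * (β * (β * γ))) := fun γ => by
    rw [expForm_seven h]
    simp only [add_mul, smul_mul_assoc, pow_succ, pow_zero, one_mul, mul_assoc]
  have hk := contract_mul_of_two hβ v
  -- Contracting `β ^ 4 = 0` gives `4 β ^ 3 ∧ (v ⌟ β) = 0`. This disposes of the last term of `(v ⌟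
  -- β) ∧ e^β`, which has no counterpart in the derivative of the cubic polynomial.
  have h3 : β * (β * (β * contract v β)) = 0 := by
    have := congrArg (contract v) h
    rw [show β ^ 4 = β * (β * (β * β)) by noncomm_ring] at this
    simp only [hk, ← (hc (contract v β)).eq, mul_add, map_zero] at this
    have h4 : (4 : ℝ) • (β * (β * (β * contract v β))) = 0 := by
      rw [← this]
      simp only [← mul_assoc, ← (hc (contract v β)).eq]
      simp only [mul_assoc, ← (hc (contract v β)).eq]
      module
    exact (smul_eq_zero_iff_right (by norm_num)).1 h4
  have hc' : ∀ γ, contract v β * (β * γ) = β * (contract v β * γ) := fun γ => by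
    rw [← mul_assoc, ← (hc _).eq, mul_assoc]
  have hc'' : ∀ γ, ExteriorAlgebra.ι ℝ ξ * (β * γ) = β * (ExteriorAlgebra.ι ℝ ξ * γ) := fun γ => by
    rw [← mul_assoc, ← (hc _).eq, mul_assoc]
  have h3' : β * (β * (β * (contract v β * α))) = 0 := by
    have := congrArg (· * α) h3
    simpa only [mul_assoc, zero_mul] using this
  rw [vectorAction_apply, vectorAction_apply, hE, hE]
  simp only [hξ, map_add, map_smul, hk, mul_add, sub_mul, smul_add, hc', hc'', mul_smul_comm, h3']
  module

/-- The vectors `eᵢ* ⊕ -eᵢ` of the metric diagonal. -/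
theorem vectorAction_diagonal_anticommute {n : ℕ} (e : Module.Basis (Fin n) ℝ V) (i j : Fin n)
    (h : i ≠ j) :
    vectorAction V (e.coord i, -e i) * vectorAction V (e.coord j, -e j) =
      -(vectorAction V (e.coord j, -e j) * vectorAction V (e.coord i, -e i)) := by
  rw [← add_eq_zero_iff_eq_neg, vectorAction_mul_add]
  simp [h, h.symm]

theorem vectorAction_antidiagonal_anticommute {n : ℕ} (e : Module.Basis (Fin n) ℝ V) (i j : Fin n) :
    vectorAction V (e.coord i, e i) * vectorAction V (e.coord j, -e j) =
      -(vectorAction V (e.coord j, -e j) * vectorAction V (e.coord i, e i)) := by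
  rw [← add_eq_zero_iff_eq_neg, vectorAction_mul_add]
  by_cases h : i = j
  · subst h; simp
  · simp [h, Ne.symm h]

/-- The product of the Clifford actions of `(ξᵢ, -eᵢ)`. -/
def frameProd {n : ℕ} (ξ : Fin n → Module.Dual ℝ V) (e : Fin n → V) : Module.End ℝ (Forms V) :=
  (List.ofFn fun i => vectorAction V (ξ i, -e i)).prod

/-- Applied to `1`, each factor meets a wedge of coordinate forms with other indices, which its
contraction annihilates; only the wedge parts survive. -/
theorem frameProd_coord_one {n : ℕ} (e : Module.Basis (Fin n) ℝ V) :
    frameProd e.coord e 1 = volumeElement e := by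
  have key : ∀ l : List (Fin n), l.Nodup →
      (l.map fun i => vectorAction V (e.coord i, -e i)).prod 1 =
        (l.map fun i => ExteriorAlgebra.ι ℝ (e.coord i)).prod ∧
      ∀ j, j ∉ l → contract (e j) (l.map fun i => (ExteriorAlgebra.ι ℝ (e.coord i) : Forms V)).prod
        = 0 := by
    intro l hl
    induction l with
    | nil => simp
    | cons a l ih =>
      rw [List.nodup_cons] at hl
      obtain ⟨h1, h2⟩ := ih hl.2
      refine ⟨?_, fun j hj => ?_⟩
      · rw [List.map_cons, List.prod_cons, List.map_cons, List.prod_cons, Module.End.mul_apply, h1,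
          vectorAction_apply, contract_neg_left, h2 a hl.1, neg_zero, add_zero]
      · rw [List.mem_cons, not_or] at hj
        rw [List.map_cons, List.prod_cons, contract_ι_mul, h2 j hj.2]
        simp [hj.1]
  rw [frameProd, volumeElement, List.ofFn_eq_map, List.ofFn_eq_map]
  exact (key _ (List.nodup_finRange n)).1

theorem sharp_apply {n : ℕ} (e : Module.Basis (Fin n) ℝ V) (ξ : Module.Dual ℝ V) :
    sharp e ξ = ∑ i, ξ (e i) • e i := by
  simp [sharp]

theorem sharp_coord {n : ℕ} (e : Module.Basis (Fin n) ℝ V) (i : Fin n) :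
    sharp e (e.coord i) = e i := by
  simp [sharp_apply, Finsupp.single_apply]

theorem contractForm_ι {n : ℕ} (e : Module.Basis (Fin n) ℝ V) (ξ : Module.Dual ℝ V)
    (α : Forms V) : contractForm e (ExteriorAlgebra.ι ℝ ξ) α = contract (sharp e ξ) α := by
  rw [contractForm, ExteriorAlgebra.lift_ι_apply]
  rfl

/-- As 7 is odd, the product of all `eᵢ* ⊕ -eᵢ` commutes with each of its factors, and it
anticommutes with each `eⱼ* ⊕ eⱼ`, which is orthogonal to all factors. Half the sum of `eⱼ* ⊕ -eⱼ`
and `eⱼ* ⊕ eⱼ` is wedging by `eⱼ*`, and their images combine to `-eⱼ ⌟`. -/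
theorem frameProd_coord_ι_mul (e : Module.Basis (Fin 7) ℝ V) (ξ : Module.Dual ℝ V)
    (α : Forms V) : frameProd e.coord e (ExteriorAlgebra.ι ℝ ξ * α) =
      -contract (sharp e ξ) (frameProd e.coord e α) := by
  have key : ∀ j, frameProd e.coord e (ExteriorAlgebra.ι ℝ (e.coord j) * α) =
      -contract (sharp e (e.coord j)) (frameProd e.coord e α) := by
    intro j
    have h1 := LinearMap.congr_fun (mul_list_prod_of_mem_of_odd
      (fun i => vectorAction V (e.coord i, -e i)) (vectorAction_diagonal_anticommute e)
      (List.finRange 7) (List.nodup_finRange 7) j (List.mem_finRange j)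
      (by rw [List.length_finRange]; decide)) α
    have h2 := LinearMap.congr_fun (mul_list_prod_of_anticommute_of_odd
      (vectorAction V (e.coord j, e j))
      (List.ofFn fun i => vectorAction V (e.coord i, -e i)) (by
        intro a ha
        obtain ⟨i, rfl⟩ := (List.mem_ofFn' _ _).1 ha
        exact vectorAction_antidiagonal_anticommute e j i) (by rw [List.length_ofFn]; decide)) α
    rw [← List.ofFn_eq_map] at h1
    change vectorAction V (e.coord j, -e j) (frameProd e.coord e α) =
      frameProd e.coord e (vectorAction V (e.coord j, -e j) α) at h1
    change vectorAction V (e.coord j, e j) (frameProd e.coord e α) =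
      -frameProd e.coord e (vectorAction V (e.coord j, e j) α) at h2
    have h3 : (2 : ℝ) • frameProd e.coord e (ExteriorAlgebra.ι ℝ (e.coord j) * α) =
        frameProd e.coord e (vectorAction V (e.coord j, -e j) α) +
        frameProd e.coord e (vectorAction V (e.coord j, e j) α) := by
      rw [← map_add, vectorAction_apply, vectorAction_apply, contract_neg_left, ← map_smul]
      congr 1
      module
    rw [← h1, ← neg_eq_iff_eq_neg.2 h2, vectorAction_apply, vectorAction_apply,
      contract_neg_left] at h3
    rw [sharp_coord]
    refine smul_right_injective _ (two_ne_zero (α := ℝ)) ?_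
    beta_reduce
    rw [h3]
    module
  rw [← e.sum_dual_apply_smul_coord ξ]
  simp only [map_sum, map_smul, Finset.sum_mul, smul_mul_assoc, key, contract_sum_left,
    contract_smul_left, Finset.sum_neg_distrib, smul_neg]

/-- The reversals in `σ` and in `⋆` cancel and leave the involution. Both sides then send `1` to the
volume element and convert a wedge by `ξ` into `-ξ♯ ⌟`, so they agree by induction. -/
theorem hodgeStar_sigma (e : Module.Basis (Fin 7) ℝ V) (α : Forms V) :
    hodgeStar e (sigma α) = frameProd e.coord e α := by
  have h1 : hodgeStar e (sigma α) =
      contractForm e (CliffordAlgebra.involute α) (volumeElement e) := by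
    rw [hodgeStar, sigma, CliffordAlgebra.reverse_reverse]
  rw [h1]
  clear h1
  induction α using Forms.left_induction with
  | algebraMap r =>
    rw [AlgHom.commutes, AlgHom.commutes, Module.algebraMap_end_apply, Algebra.algebraMap_eq_smul_one,
      map_smul, frameProd_coord_one]
  | add α β h1 h2 => rw [map_add, map_add, map_add, LinearMap.add_apply, h1, h2]
  | ι_mul α ξ h =>
    rw [map_mul, involute_ι_form, neg_mul, map_neg, map_mul, LinearMap.neg_apply,
      Module.End.mul_apply, h, contractForm_ι, frameProd_coord_ι_mul]

/-- Conjugation with `e^β` turns the metric diagonal into `V₊`, so star, `σ` and B-field merge into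
one Clifford product over a frame of `V₊`. In this form the operator can be transported by spin
isomorphisms. -/
theorem box_eq_frameProd (e : Module.Basis (Fin 7) ℝ V) {β : Forms V}
    (hβ : β ∈ ⋀[ℝ]^2 (Module.Dual ℝ V)) (ξ : Fin 7 → Module.Dual ℝ V)
    (hξ : ∀ i, ExteriorAlgebra.ι ℝ (ξ i) = ExteriorAlgebra.ι ℝ (e.coord i) + contract (e i) β)
    (α : Forms V) : box e β α = frameProd ξ e α := by
  have h4 := two_form_pow_four e hβ
  have key : ∀ (l : List (Fin 7)) (γ : Forms V),
      expForm 7 β * (l.map fun i => vectorAction V (e.coord i, -e i)).prod γ =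
        (l.map fun i => vectorAction V (ξ i, -e i)).prod (expForm 7 β * γ) := by
    intro l γ
    induction l with
    | nil => simp
    | cons a l ih =>
      rw [List.map_cons, List.prod_cons, List.map_cons, List.prod_cons, Module.End.mul_apply,
        Module.End.mul_apply, ← ih]
      refine expForm_mul_vectorAction hβ h4 ?_ _
      rw [hξ, contract_neg_left, sub_neg_eq_add]
  rw [box, hodgeStar_sigma, frameProd, List.ofFn_eq_map, key, ← mul_assoc,
    expForm_seven_mul_neg h4, one_mul, frameProd, List.ofFn_eq_map]

end Box

/-! ## Companions in terms of frames -/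

section FrameCompanion

variable {V W : Type*} [AddCommGroup V] [Module ℝ V] [AddCommGroup W] [Module ℝ W]

/-- `ρ'` is obtained from `ρ` by Clifford multiplication with an oriented orthogonal frame of the
positive subspace `V₊`. -/
def IsFrameCompanion (μ ρ ρ' : Forms V) : Prop :=
  ∃ wp wm, HasStabiliser groupG2 ρ wp wm ∧
    ∃ (e : Module.Basis (Fin 7) ℝ V) (ξ : Fin 7 → Module.Dual ℝ V),
      (∀ i, (ξ i, -e i) ∈ LinearMap.range wp) ∧
      (∀ i j, ξ i (e j) + ξ j (e i) = if i = j then 2 else 0) ∧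
      (∃ c : ℝ, 0 < c ∧ volumeElement e = c • μ) ∧ ρ' = frameProd ξ e ρ

/-- The double contraction of `β` is antisymmetric, so only the metric contributes to the symmetric
part. The conclusion is orthonormality of the frame of `V₊`, up to the sign of the form. -/
theorem apply_add_apply_of_ι_eq {n : ℕ} {e : Module.Basis (Fin n) ℝ V} {β : Forms V}
    {ξ : Fin n → Module.Dual ℝ V}
    (h : ∀ i, ExteriorAlgebra.ι ℝ (ξ i) = ExteriorAlgebra.ι ℝ (e.coord i) + contract (e i) β)
    (i j : Fin n) : ξ i (e j) + ξ j (e i) = if i = j then 2 else 0 := by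
  have h1 : ∀ i j, algebraMap ℝ (Forms V) (ξ i (e j)) =
      algebraMap ℝ _ (e.coord i (e j)) + contract (e j) (contract (e i) β) := fun i j => by
    rw [← contract_ι, h, map_add, contract_ι]
  have h2 : algebraMap ℝ (Forms V) (ξ i (e j) + ξ j (e i)) =
      algebraMap ℝ _ (e.coord i (e j) + e.coord j (e i)) := by
    rw [map_add, h1, h1, contract_comm, map_add]; abel
  rw [(ExteriorAlgebra.algebraMap_inj _ _ _).1 h2]
  by_cases hij : i = j
  · subst hij; simp; norm_num
  · simp [hij, Ne.symm hij]

theorem IsCompanion.isFrameCompanion {μ ρ ρ' : Forms V} (h : IsCompanion μ ρ ρ') :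
    IsFrameCompanion μ ρ ρ' := by
  obtain ⟨wp, wm, hst, e, β, ⟨hβ, hw⟩, hvol, rfl⟩ := h
  choose ξ hξ hmem using hw
  exact ⟨wp, wm, hst, e, ξ, hmem, apply_add_apply_of_ι_eq hξ, hvol, box_eq_frameProd e hβ ξ hξ ρ⟩

theorem IsFrameCompanion.isCompanion {μ ρ ρ' : Forms V} (h : IsFrameCompanion μ ρ ρ') :
    IsCompanion μ ρ ρ' := by
  obtain ⟨wp, wm, hst, e, ξ, hmem, hsymm, hvol, rfl⟩ := h
  -- The 2-form must satisfy `eₖ ⌟ β = ξₖ - eₖ*`. The orthonormality relation makes the coefficients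
  -- antisymmetric, and the factor `1/2` compensates for counting each pair of indices twice.
  set β : Forms V := (2⁻¹ : ℝ) •
    ∑ i, ExteriorAlgebra.ι ℝ (e.coord i) * ExteriorAlgebra.ι ℝ (ξ i - e.coord i) with hβdef
  have hβ : β ∈ ⋀[ℝ]^2 (Module.Dual ℝ V) :=
    Submodule.smul_mem _ _ (Submodule.sum_mem _ fun i _ => ι_mul_ι_mem _ _)
  have hanti : ∀ i k, (ξ i - e.coord i) (e k) = -(ξ k - e.coord k) (e i) := by
    intro i k
    have := hsymm i k
    by_cases hik : i = k
    · subst hik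
      simp only [if_true] at this
      simp; linarith
    · simp only [hik, if_false] at this
      simp [hik, Ne.symm hik]; linarith
  have hξ : ∀ k, ExteriorAlgebra.ι ℝ (ξ k) = ExteriorAlgebra.ι ℝ (e.coord k) + contract (e k) β := by
    intro k
    have hk : ∑ i, (ξ i - e.coord i) (e k) • ExteriorAlgebra.ι ℝ (e.coord i) =
        (-ExteriorAlgebra.ι ℝ (ξ k - e.coord k) : Forms V) := by
      simp_rw [hanti _ k, neg_smul, Finset.sum_neg_distrib, ← map_smul, ← map_sum]
      rw [e.sum_dual_apply_smul_coord]
    have h1 : contract (e k) β = ExteriorAlgebra.ι ℝ (ξ k - e.coord k) := by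
      rw [hβdef, map_smul, map_sum]
      simp_rw [contract_ι_mul, contract_ι, ← Algebra.commutes, ← Algebra.smul_def]
      rw [Finset.sum_sub_distrib, hk]
      simp [Finsupp.single_apply, ite_smul]
      module
    rw [h1, map_sub]; abel
  exact ⟨wp, wm, hst, e, β, ⟨hβ, fun i => ⟨ξ i, hξ i, hmem i⟩⟩, hvol,
    (box_eq_frameProd e hβ ξ hξ ρ).symm⟩

theorem SpinIso.frameProd_apply (s : SpinIso V W) {n : ℕ} {ξ : Fin n → Module.Dual ℝ V}
    {e : Fin n → V} {ξ' : Fin n → Module.Dual ℝ W} {e' : Fin n → W}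
    (h : ∀ i, s.vec (ξ i, -e i) = (ξ' i, -e' i)) (α : Forms V) :
    s.spin (frameProd ξ e α) = frameProd ξ' e' (s.spin α) := by
  rw [frameProd, frameProd, List.ofFn_eq_map, List.ofFn_eq_map]
  induction List.finRange n with
  | nil => simp
  | cons a l ih =>
    rw [List.map_cons, List.map_cons, List.prod_cons, List.prod_cons, Module.End.mul_apply,
      Module.End.mul_apply, s.intertwines, ih, h]

theorem volumeElement_map {n : ℕ} (e : Module.Basis (Fin n) ℝ V) (f : W ≃ₗ[ℝ] V) :
    volumeElement (e.map f.symm) = linPullback f.toLinearMap (volumeElement e) := by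
  rw [volumeElement, volumeElement, map_list_prod, List.map_ofFn]
  congr 2
  ext i
  rw [Function.comp_apply, linPullback_ι]
  congr 1

/-- Both sides are values of alternating maps in `n` covectors, and such maps agree once they agree
on permutations of one basis. The lemma compares orientations. -/
theorem volumeElement_eq_det_smul {n : ℕ} (e e' : Module.Basis (Fin n) ℝ V) :
    volumeElement e = Matrix.det (Matrix.of fun i j => e.coord j (e' i)) • volumeElement e' := by
  have h : (ExteriorAlgebra.ιMulti ℝ n : (Module.Dual ℝ V) [⋀^Fin n]→ₗ[ℝ] Forms V) =
      (LinearMap.toSpanSingleton ℝ (Forms V)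
        (volumeElement e')).compAlternatingMap e'.dualBasis.det := by
    refine Module.Basis.ext_alternating e'.dualBasis fun v hv => ?_
    have hb : Function.Bijective v := Finite.injective_iff_bijective.1 hv
    set σ : Equiv.Perm (Fin n) := Equiv.ofBijective v hb
    have h1 : (ExteriorAlgebra.ιMulti ℝ n) ⇑e'.dualBasis = volumeElement e' := by
      rw [ExteriorAlgebra.ιMulti_apply, volumeElement]
      simp
    change (ExteriorAlgebra.ιMulti ℝ n) (e'.dualBasis ∘ σ) =
      (LinearMap.toSpanSingleton ℝ (Forms V) (volumeElement e')).compAlternatingMap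
        e'.dualBasis.det (e'.dualBasis ∘ σ)
    rw [AlternatingMap.map_perm, AlternatingMap.map_perm, h1]
    simp only [LinearMap.compAlternatingMap_apply, LinearMap.toSpanSingleton_apply]
    rw [Module.Basis.det_self, one_smul]
  have h2 := DFunLike.congr_fun h e.coord
  rw [ExteriorAlgebra.ιMulti_apply] at h2
  refine h2.trans ?_
  simp only [LinearMap.compAlternatingMap_apply, LinearMap.toSpanSingleton_apply]
  congr 2
  rw [Module.Basis.det_apply]
  congr 1
  ext i j
  simp [Module.Basis.toMatrix_apply]

/-- A spin isomorphism carries the frame product to the product over the moved frame, and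
orthonormality is an isometry invariant. What is not automatic is left as a hypothesis: the vector
parts of the moved frame must again be a basis of the prescribed orientation. -/
theorem SpinIso.isFrameCompanion (s : SpinIso V W) {ρ ρ' : Forms V} {μ' : Forms W}
    {wp wm : (Fin 7 → ℝ) →ₗ[ℝ] (Module.Dual ℝ V × V)} (hst : HasStabiliser groupG2 ρ wp wm)
    {e : Module.Basis (Fin 7) ℝ V} {ξ : Fin 7 → Module.Dual ℝ V}
    (hmem : ∀ i, (ξ i, -e i) ∈ LinearMap.range wp)
    (hsymm : ∀ i j, ξ i (e j) + ξ j (e i) = if i = j then 2 else 0)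
    (hρ' : ρ' = frameProd ξ e ρ) (e' : Module.Basis (Fin 7) ℝ W)
    (he' : ∀ i, (s.vec (ξ i, -e i)).2 = -e' i)
    (hvol : ∃ c : ℝ, 0 < c ∧ volumeElement e' = c • μ') :
    IsFrameCompanion μ' (s.spin ρ) (s.spin ρ') := by
  have hs : ∀ i, s.vec (ξ i, -e i) = ((s.vec (ξ i, -e i)).1, -e' i) := fun i =>
    Prod.ext rfl (he' i)
  refine ⟨_, _, s.hasStabiliser hst, e', fun i => (s.vec (ξ i, -e i)).1, fun i => ?_,
    fun i j => ?_, hvol, ?_⟩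
  · obtain ⟨u, hu⟩ := hmem i
    exact ⟨u, by rw [LinearMap.comp_apply, hu]; exact hs i⟩
  · have h1 := s.dualProd_vec (ξ i, -e i) (ξ j, -e j)
    rw [hs i, hs j] at h1
    simp only [LinearMap.dualProd_apply_apply, map_neg] at h1
    rw [← hsymm i j]
    linarith
  · rw [hρ', s.frameProd_apply hs]

theorem IsCompanion.linPullback {μ ρ ρ' : Forms V} (h : IsCompanion μ ρ ρ') (f : W ≃ₗ[ℝ] V) :
    IsCompanion (GenGeom.linPullback f.toLinearMap μ) (GenGeom.linPullback f.toLinearMap ρ)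
      (GenGeom.linPullback f.toLinearMap ρ') := by
  obtain ⟨wp, wm, hst, e, ξ, hmem, hsymm, ⟨c, hc, hvol⟩, hρ'⟩ := h.isFrameCompanion
  refine ((SpinIso.ofEquiv f).isFrameCompanion hst hmem hsymm hρ' (e.map f.symm) (fun i => ?_)
    ⟨c, hc, ?_⟩).isCompanion
  · simp [SpinIso.ofEquiv]
  · rw [volumeElement_map, hvol, map_smul]

/-- Clifford multiplication with `(θ, X)`, where `θ(X) = 1`, maps companions to companions for the
opposite orientation. -/
theorem IsCompanion.vectorAction {μ ρ ρ' : Forms V} (h : IsCompanion μ ρ ρ')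
    {θ : Module.Dual ℝ V} {X : V} (hX : θ X = 1) :
    IsCompanion (-μ) (GenGeom.vectorAction V (θ, X) ρ) (GenGeom.vectorAction V (θ, X) ρ') := by
  obtain ⟨wp, wm, hst, e, ξ, hmem, hsymm, ⟨c, hc, hvol⟩, hρ'⟩ := h.isFrameCompanion
  have := e.finiteDimensional_of_finite
  -- The isometry sends `(ξᵢ, -eᵢ)` to a vector whose `V`-part is `eᵢ + (ξᵢ X - θ eᵢ) X`. The
  -- covector `B` collects these coefficients, so the moved basis is `e'ᵢ = -(eᵢ + B(eᵢ) X)`, the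
  -- image of `e` under minus a transvection.
  set B : Module.Dual ℝ V := ∑ i, (ξ i X - θ (e i)) • e.coord i with hB
  have hBe : ∀ i, B (e i) = ξ i X - θ (e i) := fun i => by
    simp [hB, Finsupp.single_apply]
  set L : V →ₗ[ℝ] V := -LinearMap.transvection B X with hL
  have hX0 : X ≠ 0 := by rintro rfl; simp at hX
  have hXsum : ∑ i, e.coord i X • e i = X := e.sum_repr X
  have hexp : ∀ η : Module.Dual ℝ V, η X = ∑ j, e.coord j X * η (e j) := fun η => by
    conv_lhs => rw [← hXsum]
    simp only [map_sum, map_smul, smul_eq_mul]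
  -- Expanding `X` in the basis gives `B X = ∑ Xᵢ Xⱼ ξᵢ(eⱼ) - θ(X)`. Only the symmetric part of
  -- `ξᵢ(eⱼ)` contributes, so `1 + B X` is the squared length of `X`, positive as `X ≠ 0`.
  have hBX : 1 + B X = ∑ i, e.coord i X ^ 2 := by
    have h1 : B X = ∑ i, e.coord i X * ξ i X - 1 := by
      rw [← hX, hexp B, hexp θ, ← Finset.sum_sub_distrib]
      exact Finset.sum_congr rfl fun i _ => by rw [hBe]; ring
    have h3 : ∑ i, ∑ j, e.coord i X * (e.coord j X * ξ i (e j)) =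
        ∑ i, ∑ j, e.coord i X * (e.coord j X * ξ j (e i)) := by
      rw [Finset.sum_comm]
      refine Finset.sum_congr rfl fun i _ => Finset.sum_congr rfl fun j _ => by ring
    have h4 : ∑ i, ∑ j, e.coord i X * (e.coord j X * (ξ i (e j) + ξ j (e i))) =
        2 * ∑ i, e.coord i X ^ 2 := by
      simp_rw [hsymm]
      simp [Finset.mul_sum]
      exact Finset.sum_congr rfl fun i _ => by ring
    simp_rw [mul_add, Finset.sum_add_distrib] at h4
    rw [← h3] at h4
    rw [h1]
    simp_rw [fun i => hexp (ξ i), Finset.mul_sum]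
    linarith
  have hpos : 0 < 1 + B X := by
    rw [hBX]
    refine (Finset.sum_nonneg fun i _ => sq_nonneg _).lt_of_ne' fun h0 => hX0 ?_
    rw [Finset.sum_eq_zero_iff_of_nonneg fun i _ => sq_nonneg _] at h0
    rw [← hXsum]
    exact Finset.sum_eq_zero fun i hi => by rw [pow_eq_zero_iff two_ne_zero |>.1 (h0 i hi), zero_smul]
  -- The transvection has determinant `1 + B X`, and minus the identity contributes `(-1)^7`: this
  -- is the reversal of the orientation.
  have hdet : LinearMap.det L = -(1 + B X) := by
    rw [hL, ← neg_one_smul ℝ, LinearMap.det_smul, LinearMap.transvection.det, finrank_of_basis e]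
    norm_num
  have hdet0 : LinearMap.det L ≠ 0 := by rw [hdet]; linarith
  set e' := e.map (L.equivOfDetNeZero hdet0) with he'
  have he'i : ∀ i, e' i = -e i - (ξ i X - θ (e i)) • X := fun i => by
    rw [he', Module.Basis.map_apply]
    change L (e i) = _
    rw [hL, LinearMap.neg_apply, LinearMap.transvection.apply, hBe]
    abel
  have hr : QuadraticForm.dualProd ℝ V (θ, X) = 1 := by simpa using hX
  -- The volume elements satisfy `vol e = -(1 + B X) • vol e'`, which dictates the positive constant
  -- relative to `-μ`.
  refine ((SpinIso.reflection (θ, X) hr).isFrameCompanion hst hmem hsymm hρ' e' (fun i => ?_)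
    ⟨c / (1 + B X), by positivity, ?_⟩).isCompanion
  · rw [he'i]
    change LinearMap.dualProd ℝ V (θ, X) (ξ i, -e i) • X - -e i = _
    simp only [LinearMap.dualProd_apply_apply, map_neg]
    module
  · have h1 := volumeElement_eq_det_smul e e'
    have h2 : Matrix.det (Matrix.of fun i j => e.coord j (e' i)) = -(1 + B X) := by
      rw [← hdet, ← LinearMap.det_toMatrix e, ← Matrix.det_transpose]
      congr 1
      ext i j
      simp [LinearMap.toMatrix_apply, he']
    rw [h2, hvol] at h1
    rw [div_eq_inv_mul, mul_smul, smul_neg c, h1, neg_smul, neg_neg, smul_smul,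
      inv_mul_cancel₀ hpos.ne', one_smul]

end FrameCompanion

/-! ## Uniqueness of the companion -/

section Uniqueness

variable {V : Type*} [AddCommGroup V] [Module ℝ V]

/-- The diagonal linear map with the entries `c i = ±1`. -/
def diagSign {n : ℕ} (c : Fin n → ℝ) (hc : ∀ i, c i * c i = 1) :
    (Fin n → ℝ) ≃ₗ[ℝ] (Fin n → ℝ) :=
  LinearEquiv.ofInvolutive (LinearMap.pi fun i => c i • LinearMap.proj i) fun u => by
    ext i; simp [← mul_assoc, hc]

theorem diagSign_apply {n : ℕ} (c : Fin n → ℝ) (hc : ∀ i, c i * c i = 1) (u : Fin n → ℝ)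
    (i : Fin n) : diagSign c hc u i = c i * u i := rfl

theorem linPullback_diagSign_monomial {n : ℕ} (c : Fin n → ℝ) (hc : ∀ i, c i * c i = 1)
    (l : List (Fin n)) :
    linPullback (diagSign c hc).toLinearMap (monomial l) = (l.map c).prod • monomial l := by
  induction l with
  | nil => simp [monomial]
  | cons a l ih =>
    have h : ∀ l' : List (Fin n), monomial (a :: l') =
      ExteriorAlgebra.ι ℝ (LinearMap.proj (R := ℝ) (φ := fun _ => ℝ) a) * monomial l' := fun l' => by
      simp [monomial]
    have h2 : (LinearMap.proj (R := ℝ) (φ := fun _ => ℝ) a).comp (diagSign c hc).toLinearMap =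
        c a • LinearMap.proj (R := ℝ) (φ := fun _ => ℝ) a := by
      ext; simp [diagSign_apply]
    rw [h, map_mul, ih, linPullback_ι, h2, map_smul, List.map_cons, List.prod_cons, smul_mul_smul]

/-- A diagonal sign change multiplies each of the seven monomials of `phi0` by a product of three
signs. These elements are all of `G₂` that the uniqueness argument needs. -/
theorem diagSign_mem_groupG2 (c : Fin 7 → ℝ) (hc : ∀ i, c i * c i = 1)
    (h : c 0 * c 1 * c 2 = 1 ∧ c 0 * c 3 * c 4 = 1 ∧ c 0 * c 5 * c 6 = 1 ∧ c 1 * c 3 * c 5 = 1 ∧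
      c 1 * c 4 * c 6 = 1 ∧ c 2 * c 3 * c 6 = 1 ∧ c 2 * c 4 * c 5 = 1) :
    diagSign c hc ∈ groupG2 := by
  obtain ⟨h1, h2, h3, h4, h5, h6, h7⟩ := h
  change linPullback _ phi0 = phi0
  simp only [phi0, map_add, map_sub, linPullback_diagSign_monomial, List.map_cons, List.map_nil,
    List.prod_cons, List.prod_nil, mul_one, ← mul_assoc, h1, h2, h3, h4, h5, h6, h7, one_smul]

theorem refl_mem_groupG2 : LinearEquiv.refl ℝ (Fin 7 → ℝ) ∈ groupG2 := by
  change linPullback LinearMap.id phi0 = phi0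
  exact linPullback_id _

theorem IsMetricSplitting.pos_dualProd {n : ℕ} {wp wm : (Fin n → ℝ) →ₗ[ℝ] (Module.Dual ℝ V × V)}
    (h : IsMetricSplitting wp wm) {u : Fin n → ℝ}
    (hu : 0 ≤ QuadraticForm.dualProd ℝ V (wp u)) : u = 0 := by
  rw [h.pos] at hu
  have h0 : ∑ i, u i ^ 2 = 0 := le_antisymm (by linarith) (Finset.sum_nonneg fun i _ => sq_nonneg _)
  rw [Finset.sum_eq_zero_iff_of_nonneg fun i _ => sq_nonneg _] at h0
  ext i
  exact pow_eq_zero_iff two_ne_zero |>.1 (h0 i (Finset.mem_univ i))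

theorem IsMetricSplitting.neg_dualProd {n : ℕ} {wp wm : (Fin n → ℝ) →ₗ[ℝ] (Module.Dual ℝ V × V)}
    (h : IsMetricSplitting wp wm) {u : Fin n → ℝ}
    (hu : QuadraticForm.dualProd ℝ V (wm u) ≤ 0) : u = 0 := by
  rw [h.neg] at hu
  have h0 : ∑ i, u i ^ 2 = 0 := le_antisymm (by linarith) (Finset.sum_nonneg fun i _ => sq_nonneg _)
  rw [Finset.sum_eq_zero_iff_of_nonneg fun i _ => sq_nonneg _] at h0
  ext i
  exact pow_eq_zero_iff two_ne_zero |>.1 (h0 i (Finset.mem_univ i))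

/-- The two summands are orthogonal and definite of opposite signs, so their sum is direct; it fills
`V* ⊕ V` because both sides have dimension `2n`. -/
theorem IsMetricSplitting.bijective {n : ℕ} {wp wm : (Fin n → ℝ) →ₗ[ℝ] (Module.Dual ℝ V × V)}
    (h : IsMetricSplitting wp wm) [FiniteDimensional ℝ V] (hn : Module.finrank ℝ V = n) :
    Function.Bijective (wp.coprod wm) := by
  have hinj : Function.Injective (wp.coprod wm) := by
    rw [← LinearMap.ker_eq_bot, LinearMap.ker_eq_bot']
    rintro ⟨a, b⟩ hab
    rw [LinearMap.coprod_apply] at hab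
    have h1 : LinearMap.dualProd ℝ V (wp a) (wp a) = 0 := by
      have := congrArg (LinearMap.dualProd ℝ V (wp a)) hab
      simpa only [map_add, h.orthogonal, add_zero, map_zero] using this
    rw [← polar_dualProd, QuadraticMap.polar_self, two_nsmul, add_self_eq_zero] at h1
    have ha := h.pos_dualProd h1.ge
    rw [ha, map_zero, zero_add] at hab
    have hb := h.neg_dualProd (u := b) (by rw [hab, map_zero])
    rw [ha, hb]; rfl
  refine ⟨hinj, (LinearMap.injective_iff_surjective_of_finrank_eq_finrank ?_).1 hinj⟩
  simp [Module.finrank_prod, Subspace.dual_finrank_eq, hn]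

/-- The stabiliser preserves `V₊'`, and it contains the copy of `G₂` acting on `V₋` alone. Averaging
over sign changes in that copy splits a vector of `V₊'` into its `V₊`- and `V₋`-components within
`V₊'`, and the second vanishes by definiteness. -/
theorem HasStabiliser.range_le {ρ : Forms V} {wp wm wp' wm' : (Fin 7 → ℝ) →ₗ[ℝ] (Module.Dual ℝ V × V)}
    [FiniteDimensional ℝ V] (hn : Module.finrank ℝ V = 7) (h : HasStabiliser groupG2 ρ wp wm)
    (h' : HasStabiliser groupG2 ρ wp' wm') : LinearMap.range wp' ≤ LinearMap.range wp := by
  have hbij := h.1.bijective hn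
  set Φ := LinearEquiv.ofBijective _ hbij with hΦ
  have hΦ' : ∀ a b, Φ.symm (wp a + wm b) = (a, b) := fun a b => by
    rw [LinearEquiv.symm_apply_eq]; rfl
  have hinv : ∀ k ∈ groupG2, ∀ a b, wp a + wm b ∈ LinearMap.range wp' →
      wp a + wm (k b) ∈ LinearMap.range wp' := by
    rintro k hk a b ⟨u, hu⟩
    set A : Module.End ℝ (Module.Dual ℝ V × V) :=
      Φ.toLinearMap.comp ((LinearMap.prodMap LinearMap.id k.toLinearMap).comp Φ.symm.toLinearMap)
    have hA : ∀ a b, A (wp a + wm b) = wp a + wm (k b) := fun a b => by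
      simp only [A, LinearMap.comp_apply, LinearEquiv.coe_coe, hΦ']
      rfl
    have hmem : A ∈ productGroup groupG2 wp wm := by
      refine ⟨_, refl_mem_groupG2, k, hk, fun u => ⟨?_, ?_⟩⟩
      · simpa using hA u 0
      · simpa using hA 0 u
    rw [← h.2, h'.2] at hmem
    obtain ⟨h1, _, _, _, h2⟩ := hmem
    exact ⟨h1 u, by rw [← (h2 u).1, hu, hA]⟩
  -- The average of the identity and a sign change is the projection onto the coordinates that are
  -- not flipped.
  have hproj : ∀ (c : Fin 7 → ℝ) (hc : ∀ i, c i * c i = 1), diagSign c hc ∈ groupG2 → ∀ a b,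
      wp a + wm b ∈ LinearMap.range wp' →
      wp a + wm (fun i => 2⁻¹ * (1 + c i) * b i) ∈ LinearMap.range wp' := by
    intro c hc hk a b hab
    have h1 := Submodule.smul_mem _ (2⁻¹ : ℝ) (Submodule.add_mem _ hab (hinv _ hk a b hab))
    have h2 : (fun i => 2⁻¹ * (1 + c i) * b i) = (2⁻¹ : ℝ) • (b + diagSign c hc b) := by
      ext i; simp [diagSign_apply]; ring
    rw [h2, map_smul, map_add]
    convert h1 using 1
    module
  rintro _ ⟨u, rfl⟩
  obtain ⟨⟨a, b⟩, hab⟩ := hbij.2 (wp' u)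
  rw [LinearMap.coprod_apply] at hab
  have h0 : wp a + wm b ∈ LinearMap.range wp' := ⟨u, hab.symm⟩
  -- If coordinate `i` is labelled by the binary digits of `i + 1`, the three vectors flip the
  -- coordinates whose first, second or third lowest digit is `1`. Every label is non-zero, so each
  -- coordinate is flipped at least once and the three projections together annihilate `b`.
  have h1 := hproj ![-1, 1, -1, 1, -1, 1, -1] (by intro i; fin_cases i <;> norm_num)
    (diagSign_mem_groupG2 _ _ (by refine ⟨?_, ?_, ?_, ?_, ?_, ?_, ?_⟩ <;> simp)) a b h0
  have h2 := hproj ![1, -1, -1, 1, 1, -1, -1] (by intro i; fin_cases i <;> norm_num)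
    (diagSign_mem_groupG2 _ _ (by refine ⟨?_, ?_, ?_, ?_, ?_, ?_, ?_⟩ <;> simp)) a _ h1
  have h3 := hproj ![1, 1, 1, -1, -1, -1, -1] (by intro i; fin_cases i <;> norm_num)
    (diagSign_mem_groupG2 _ _ (by refine ⟨?_, ?_, ?_, ?_, ?_, ?_, ?_⟩ <;> simp)) a _ h2
  have hz : wp a ∈ LinearMap.range wp' := by
    convert h3 using 1
    rw [left_eq_add]
    convert map_zero wm using 2
    ext i
    fin_cases i <;> simp
  have hwb : wm b ∈ LinearMap.range wp' := by
    have := Submodule.sub_mem _ h0 hz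
    rwa [add_sub_cancel_left] at this
  obtain ⟨v, hv⟩ := hwb
  -- On `V₋` the quadratic form is non-negative and on `V₊'` non-positive, so a common vector is
  -- zero.
  have hb := h.1.neg_dualProd (u := b) (by
    rw [← hv, h'.1.pos]; exact neg_nonpos.2 (Finset.sum_nonneg fun i _ => sq_nonneg _))
  exact ⟨a, by rw [← hab, hb, map_zero, add_zero]⟩

/-- Euler's identity `∑ eᵢ* ∧ (eᵢ ⌟ β) = 2β` recovers a 2-form from its contractions. -/
theorem two_form_eq_zero {n : ℕ} (e : Module.Basis (Fin n) ℝ V) {β : Forms V}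
    (hβ : β ∈ ⋀[ℝ]^2 (Module.Dual ℝ V)) (h : ∀ i, contract (e i) β = 0) : β = 0 := by
  have key : ∑ i, ExteriorAlgebra.ι ℝ (e.coord i) * contract (e i) β = (2 : ℝ) • β := by
    refine exteriorPower_two_induction
      (C := fun β => ∑ i, ExteriorAlgebra.ι ℝ (e.coord i) * contract (e i) β = (2 : ℝ) • β)
      (fun x y hx hy => ?_) (fun ξ η => ?_) hβ
    · simp only [map_add, mul_add, Finset.sum_add_distrib, hx, hy, smul_add]
    · simp only [contract_ι_mul, contract_ι, mul_sub, ← Algebra.commutes, ← Algebra.smul_def,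
        Finset.sum_sub_distrib, mul_smul_comm]
      have h1 : ∀ ζ : Module.Dual ℝ V, ∑ i, ζ (e i) • ExteriorAlgebra.ι ℝ (e.coord i) =
          (ExteriorAlgebra.ι ℝ ζ : Forms V) := fun ζ => by
        conv_rhs => rw [← e.sum_dual_apply_smul_coord ζ]
        simp only [map_sum, map_smul]
      simp only [← smul_mul_assoc, ← Finset.sum_mul, h1]
      rw [eq_neg_of_add_eq_zero_left (ExteriorAlgebra.ι_add_mul_swap η ξ), sub_neg_eq_add, two_smul,
        add_mul]
  simp only [h, mul_zero, Finset.sum_const_zero] at key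
  exact (smul_eq_zero_iff_right two_ne_zero).1 key.symm

theorem sharp_eq_of_orthogonal {n : ℕ} (e e' : Module.Basis (Fin n) ℝ V) {a : Matrix (Fin n) (Fin n) ℝ}
    (ha : a.transpose * a = 1) (he : ∀ i, e' i = ∑ j, a i j • e j) : sharp e' = sharp e := by
  ext ξ
  have h : ∀ j k, ∑ i, a i j * a i k = if j = k then 1 else 0 := fun j k => by
    have := congrFun (congrFun ha j) k
    rwa [Matrix.mul_apply, Matrix.one_apply] at this
  rw [sharp_apply, sharp_apply]
  have h1 : ∀ i, ξ (e' i) • e' i = ∑ k, ∑ j, (a i j * a i k) • ξ (e j) • e k := fun i => by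
    rw [he]
    simp only [map_sum, map_smul, smul_eq_mul, Finset.smul_sum, smul_smul]
    refine Finset.sum_congr rfl fun k _ => ?_
    rw [Finset.sum_mul, Finset.sum_smul]
    exact Finset.sum_congr rfl fun j _ => by congr 1; ring
  rw [Finset.sum_congr rfl fun i _ => h1 i, Finset.sum_comm]
  refine Finset.sum_congr rfl fun k _ => ?_
  rw [Finset.sum_comm]
  simp only [← Finset.sum_smul, h]
  simp

theorem hodgeStar_congr {n : ℕ} {e e' : Module.Basis (Fin n) ℝ V} (hs : sharp e' = sharp e)
    (hv : volumeElement e' = volumeElement e) (α : Forms V) : hodgeStar e' α = hodgeStar e α := by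
  have : contractForm e' = contractForm e := by
    refine ExteriorAlgebra.hom_ext (LinearMap.ext fun ξ => LinearMap.ext fun α => ?_)
    simp only [LinearMap.comp_apply, AlgHom.toLinearMap_apply, contractForm_ι, hs]
  rw [hodgeStar, hodgeStar, this, hv]

/-- Both choices of data describe the same `V₊`. Two orthonormal frames of it differ by an
orthogonal matrix, and this changes neither the B-field nor the musical isomorphism, nor, with the
orientation fixed, the volume element. -/
theorem IsCompanion.unique {μ ρ ρ₁ ρ₂ : Forms V} (h₁ : IsCompanion μ ρ ρ₁)
    (h₂ : IsCompanion μ ρ ρ₂) : ρ₁ = ρ₂ := by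
  obtain ⟨wp, wm, hst, e, β, ⟨hβ, hw⟩, ⟨c, hc, hvol⟩, rfl⟩ := h₁
  obtain ⟨wp', wm', hst', e', β', ⟨hβ', hw'⟩, ⟨c', hc', hvol'⟩, rfl⟩ := h₂
  have := e.finiteDimensional_of_finite
  have hle := hst.range_le (finrank_of_basis e) hst'
  choose ξ hξ hmem using hw
  choose ξ' hξ' hmem' using hw'
  have hsymm := apply_add_apply_of_ι_eq hξ
  have hsymm' := apply_add_apply_of_ι_eq hξ'
  set a : Matrix (Fin 7) (Fin 7) ℝ := Matrix.of fun i j => e.coord j (e' i) with ha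
  have he : ∀ i, e' i = ∑ j, a i j • e j := fun i => (e.sum_repr (e' i)).symm
  have hξa : ∀ i, ξ' i = ∑ j, a i j • ξ j := by
    intro i
    have hd : (ξ' i - ∑ j, a i j • ξ j, (0 : V)) ∈ LinearMap.range wp := by
      have h1 := Submodule.sub_mem _ (hle (hmem' i))
        (Submodule.sum_mem (LinearMap.range wp) fun j (_ : j ∈ Finset.univ) =>
          Submodule.smul_mem _ (a i j) (hmem j))
      convert h1 using 1
      refine Prod.ext ?_ ?_
      · simp [Prod.fst_sum]
      · simp [Prod.snd_sum, ← he]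
    obtain ⟨u, hu⟩ := hd
    -- A pure covector is null, and the definite space `V₊` contains no other null vector than zero.
    -- Hence the covector parts transform by the same matrix as the basis.
    have hu0 := hst.1.pos_dualProd (u := u) (by rw [hu]; simp)
    rw [hu0, map_zero] at hu
    exact sub_eq_zero.1 (congrArg Prod.fst hu).symm
  have hortho : a * a.transpose = 1 := by
    ext i k
    have h1 := hsymm' i k
    have h2 : ξ' i (e' k) + ξ' k (e' i) =
        ∑ j, ∑ l, a i j * a k l * (ξ j (e l) + ξ l (e j)) := by
      have h3 : ∀ i k, ξ' i (e' k) = ∑ j, ∑ l, a i j * a k l * ξ j (e l) := fun i k => by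
        rw [hξa, he k]
        simp only [map_sum, map_smul, LinearMap.sum_apply, LinearMap.smul_apply, smul_eq_mul,
          Finset.mul_sum]
        rw [Finset.sum_comm]
        exact Finset.sum_congr rfl fun j _ => Finset.sum_congr rfl fun l _ => by ring
      rw [h3 i k, h3 k i, Finset.sum_comm (f := fun j l => a k j * a i l * ξ j (e l)),
        ← Finset.sum_add_distrib]
      refine Finset.sum_congr rfl fun j _ => ?_
      rw [← Finset.sum_add_distrib]
      exact Finset.sum_congr rfl fun l _ => by ring
    rw [h2] at h1
    simp only [hsymm, mul_ite, mul_zero, Finset.sum_ite_eq, Finset.mem_univ, if_true,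
      ← Finset.sum_mul] at h1
    rw [Matrix.mul_apply, Matrix.one_apply]
    simp only [Matrix.transpose_apply]
    split_ifs at h1 ⊢ <;> linarith
  have hortho' : a.transpose * a = 1 := mul_eq_one_comm.1 hortho
  have hcoord : ∀ i, e'.coord i = ∑ j, a i j • e.coord j := by
    intro i
    refine e'.ext fun k => ?_
    have := congrFun (congrFun hortho k) i
    rw [Matrix.mul_apply, Matrix.one_apply] at this
    simp only [LinearMap.sum_apply, LinearMap.smul_apply, smul_eq_mul]
    rw [Module.Basis.coord_apply, Module.Basis.repr_self, Finsupp.single_apply, ← this]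
    exact Finset.sum_congr rfl fun j _ => mul_comm _ _
  have hββ : β' = β := by
    rw [← sub_eq_zero]
    refine two_form_eq_zero e' (Submodule.sub_mem _ hβ' hβ) fun i => ?_
    have h1 : contract (e' i) β' = ExteriorAlgebra.ι ℝ (ξ' i) - ExteriorAlgebra.ι ℝ (e'.coord i) := by
      rw [hξ']; abel
    have h2 : ∀ j, contract (e j) β = ExteriorAlgebra.ι ℝ (ξ j) - ExteriorAlgebra.ι ℝ (e.coord j) :=
      fun j => by rw [hξ]; abel
    rw [map_sub, h1, he, contract_sum_left, hξa, hcoord]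
    simp only [contract_smul_left, h2, map_sum, map_smul, smul_sub, Finset.sum_sub_distrib, sub_self]
  have hvv : volumeElement e' = volumeElement e := by
    have h1 := volumeElement_eq_det_smul e e'
    rw [← ha] at h1
    have h2 : a.det * a.det = 1 := by
      have := congrArg Matrix.det hortho
      rwa [Matrix.det_mul, Matrix.det_transpose, Matrix.det_one] at this
    rcases mul_self_eq_one_iff.1 h2 with h3 | h3
    · rw [h1, h3, one_smul]
    -- Determinant `-1` makes a sum of positive constants annihilate `μ`; then `μ = 0`, and both
    -- volume elements vanish.
    · rw [h3, hvol, hvol', smul_smul, ← sub_eq_zero, ← sub_smul] at h1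
      have h4 : μ = 0 := (smul_eq_zero.1 h1).resolve_left (by linarith)
      rw [hvol, hvol', h4, smul_zero, smul_zero]
  rw [box, box, hββ, hodgeStar_congr (sharp_eq_of_orthogonal e e' hortho' he) hvv]

end Uniqueness

/-! ## Calculus of forms on `ℝⁿ` -/

section Flat

open Filter Topology

/-- The model space `ℝⁿ`. -/
abbrev Euc (n : ℕ) : Type := EuclideanSpace ℝ (Fin n)

/-- The space of constant forms on `ℝⁿ` with the maximum norm of the coefficients. -/
instance formsNormedAddCommGroup (n : ℕ) : NormedAddCommGroup (Forms (Euc n)) :=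
  NormedAddCommGroup.induced (Forms (Euc n)) (Finset (Fin n) → ℝ)
    (formBasis n).equivFun.toLinearMap (formBasis n).equivFun.injective

instance formsNormedSpace (n : ℕ) : NormedSpace ℝ (Forms (Euc n)) :=
  NormedSpace.induced ℝ (Forms (Euc n)) (Finset (Fin n) → ℝ) (formBasis n).equivFun.toLinearMap

instance formsFiniteDimensional (n : ℕ) : FiniteDimensional ℝ (Forms (Euc n)) :=
  (formBasis n).finiteDimensional_of_finite

variable {n n' : ℕ}

/-- The coordinate 1-forms. -/
def dx (i : Fin n) : Module.Dual ℝ (Euc n) := (EuclideanSpace.basisFun (Fin n) ℝ).toBasis.coord i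

/-- The coordinate vectors. -/
def stdVec (i : Fin n) : Euc n := (EuclideanSpace.basisFun (Fin n) ℝ).toBasis i

theorem sum_apply_dx (ξ : Module.Dual ℝ (Euc n)) : ∑ i, ξ (stdVec i) • dx i = ξ :=
  (EuclideanSpace.basisFun (Fin n) ℝ).toBasis.sum_dual_apply_smul_coord ξ

/-- The antisymmetrisation `∑ dxᵢ ∧ A(eᵢ)` of a linear map with values in forms. -/
def wedgeTrace (A : Euc n →L[ℝ] Forms (Euc n)) : Forms (Euc n) :=
  ∑ i, ExteriorAlgebra.ι ℝ (dx i) * A (stdVec i)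

theorem contDiffAt_coeff_iff {F : Type*} [NormedAddCommGroup F] [NormedSpace ℝ F]
    {k : WithTop ℕ∞} {f : F → Forms (Euc n)} {y : F} :
    ContDiffAt ℝ k f y ↔ ∀ S, ContDiffAt ℝ k (fun z => (formBasis n).repr (f z) S) y := by
  rw [← contDiffAt_pi]
  exact ((formBasis n).equivFun.toContinuousLinearEquiv.comp_contDiffAt_iff (f := f)).symm

/-- The `S`-coefficient of a constant form as a continuous functional. -/
def coeffL (S : Finset (Fin n)) : Forms (Euc n) →L[ℝ] ℝ :=
  LinearMap.toContinuousLinearMap ((formBasis n).coord S)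

/-- Writing `d` as `∑ dxᵢ ∧ ∂ᵢ` in terms of the Fréchet derivative of a form-valued map makes the
product and chain rules available. -/
theorem extDFlat_eq_wedgeTrace {f : Euc n → Forms (Euc n)} {y : Euc n}
    (hf : DifferentiableAt ℝ f y) : extDFlat f y = wedgeTrace (fderiv ℝ f y) := by
  have h1 : ∀ S, fderiv ℝ (fun z => (formBasis n).repr (f z) S) y =
      (coeffL S).comp (fderiv ℝ f y) := fun S =>
    ((coeffL S).hasFDerivAt.comp y hf.hasFDerivAt).fderiv
  simp only [extDFlat, h1]
  have h2 : ∀ S, ExteriorAlgebra.ι ℝ ((coeffL S).comp (fderiv ℝ f y)).toLinearMap * formBasis n S =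
      ∑ i, ExteriorAlgebra.ι ℝ (dx i) *
        ((formBasis n).repr (fderiv ℝ f y (stdVec i)) S • formBasis n S) := by
    intro S
    rw [← sum_apply_dx ((coeffL S).comp (fderiv ℝ f y)).toLinearMap, map_sum, Finset.sum_mul]
    refine Finset.sum_congr rfl fun i _ => ?_
    rw [map_smul, smul_mul_assoc, mul_smul_comm]
    rfl
  rw [Finset.sum_congr rfl fun S _ => h2 S, Finset.sum_comm]
  refine Finset.sum_congr rfl fun i _ => ?_
  rw [← Finset.mul_sum, (formBasis n).sum_repr]

theorem extDFlat_congr {f g : Euc n → Forms (Euc n)} {y : Euc n} (h : f =ᶠ[𝓝 y] g) :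
    extDFlat f y = extDFlat g y := by
  simp only [extDFlat]
  refine Finset.sum_congr rfl fun S _ => ?_
  rw [Filter.EventuallyEq.fderiv_eq (show (fun z => (formBasis n).repr (f z) S) =ᶠ[𝓝 y] fun z => (formBasis n).repr (g z) S from
      h.mono fun z hz => by simp only [hz])]

/-- The wedge product as a continuous bilinear map. -/
def mulL (n : ℕ) : Forms (Euc n) →L[ℝ] Forms (Euc n) →L[ℝ] Forms (Euc n) :=
  (LinearMap.mul ℝ (Forms (Euc n))).toContinuousBilinearMap

theorem contDiffAt_mul_forms {F : Type*} [NormedAddCommGroup F] [NormedSpace ℝ F]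
    {k : WithTop ℕ∞} {f g : F → Forms (Euc n)} {y : F}
    (hf : ContDiffAt ℝ k f y) (hg : ContDiffAt ℝ k g y) :
    ContDiffAt ℝ k (fun z => f z * g z) y :=
  ((mulL n).contDiff.contDiffAt.comp y hf).clm_apply hg

theorem extDFlat_mul {f g : Euc n → Forms (Euc n)} {y : Euc n} (hf : DifferentiableAt ℝ f y)
    (hg : DifferentiableAt ℝ g y) : extDFlat (fun z => f z * g z) y =
      extDFlat f y * g y + CliffordAlgebra.involute (f y) * extDFlat g y := by
  have h := (mulL n).hasFDerivAt_of_bilinear hf.hasFDerivAt hg.hasFDerivAt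
  rw [extDFlat_eq_wedgeTrace hf, extDFlat_eq_wedgeTrace hg]
  refine (extDFlat_eq_wedgeTrace h.differentiableAt).trans ?_
  rw [h.fderiv, wedgeTrace, wedgeTrace, wedgeTrace, Finset.sum_mul, Finset.mul_sum,
    ← Finset.sum_add_distrib]
  refine Finset.sum_congr rfl fun i _ => ?_
  have h2 : ExteriorAlgebra.ι ℝ (dx i) * (f y * fderiv ℝ g y (stdVec i)) =
      CliffordAlgebra.involute (f y) * (ExteriorAlgebra.ι ℝ (dx i) * fderiv ℝ g y (stdVec i)) := by
    rw [← mul_assoc, involute_mul_ι, mul_assoc]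
  rw [← h2, mul_assoc, ← mul_add, add_comm]
  rfl

theorem extDFlat_add {f g : Euc n → Forms (Euc n)} {y : Euc n} (hf : DifferentiableAt ℝ f y)
    (hg : DifferentiableAt ℝ g y) :
    extDFlat (fun z => f z + g z) y = extDFlat f y + extDFlat g y := by
  rw [extDFlat_eq_wedgeTrace hf, extDFlat_eq_wedgeTrace hg]
  refine (extDFlat_eq_wedgeTrace (hf.add hg)).trans ?_
  rw [fderiv_add hf hg]
  simp [wedgeTrace, mul_add, Finset.sum_add_distrib]

theorem extDFlat_const (c : Forms (Euc n)) (y : Euc n) : extDFlat (fun _ => c) y = 0 := by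
  rw [extDFlat_eq_wedgeTrace (differentiableAt_const c)]
  simp [wedgeTrace]

/-- Symmetric coefficients are annihilated by antisymmetrisation. -/
theorem sum_dx_mul_dx_eq_zero (s : Fin n → Fin n → Forms (Euc n)) (hs : ∀ i j, s i j = s j i) :
    ∑ i, ∑ j, ExteriorAlgebra.ι ℝ (dx i) * (ExteriorAlgebra.ι ℝ (dx j) * s i j) = 0 := by
  have h : ∑ i, ∑ j, ExteriorAlgebra.ι ℝ (dx i) * (ExteriorAlgebra.ι ℝ (dx j) * s i j) =
      -∑ i, ∑ j, ExteriorAlgebra.ι ℝ (dx i) * (ExteriorAlgebra.ι ℝ (dx j) * s i j) := by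
    conv_lhs => rw [Finset.sum_comm]
    rw [← Finset.sum_neg_distrib]
    refine Finset.sum_congr rfl fun i _ => ?_
    rw [← Finset.sum_neg_distrib]
    refine Finset.sum_congr rfl fun j _ => ?_
    rw [← mul_assoc, ← mul_assoc, eq_neg_of_add_eq_zero_left
      (ExteriorAlgebra.ι_add_mul_swap (R := ℝ) (dx j) (dx i)), hs j i, neg_mul]
  have h2 : (2 : ℝ) • ∑ i, ∑ j, ExteriorAlgebra.ι ℝ (dx i) * (ExteriorAlgebra.ι ℝ (dx j) * s i j)
      = 0 := by
    rw [two_smul]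
    nth_rewrite 1 [h]
    exact neg_add_cancel _
  exact (smul_eq_zero_iff_right two_ne_zero).1 h2

theorem contDiffAt_extDFlat {f : Euc n → Forms (Euc n)} {y : Euc n}
    (hf : ContDiffAt ℝ ∞ f y) : ContDiffAt ℝ ∞ (extDFlat f) y := by
  have h1 : extDFlat f =ᶠ[𝓝 y] fun z => wedgeTrace (fderiv ℝ f z) := by
    have h2 := (hf.of_le (m := 1) (by exact_mod_cast le_top)).eventually (by simp)
    filter_upwards [h2] with z hz
    exact extDFlat_eq_wedgeTrace (hz.differentiableAt one_ne_zero)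
  refine ContDiffAt.congr_of_eventuallyEq ?_ h1
  have h3 : ContDiffAt ℝ ∞ (fderiv ℝ f) y := hf.fderiv_right (m := ∞) (by simp)
  exact ContDiffAt.sum fun i _ => contDiffAt_mul_forms contDiffAt_const
    (h3.clm_apply contDiffAt_const)

/-- Second derivatives are symmetric, while `dxᵢ ∧ dxⱼ` is antisymmetric. -/
theorem extDFlat_extDFlat {f : Euc n → Forms (Euc n)} {y : Euc n} (hf : ContDiffAt ℝ ∞ f y) :
    extDFlat (extDFlat f) y = 0 := by
  have h2 : ContDiffAt ℝ 2 f y := hf.of_le (WithTop.coe_le_coe.2 (le_top : (2 : ℕ∞) ≤ ⊤))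
  have h1 : extDFlat f =ᶠ[𝓝 y] fun z => wedgeTrace (fderiv ℝ f z) := by
    filter_upwards [(h2.of_le (m := 1) one_le_two).eventually (by simp)] with z hz
    exact extDFlat_eq_wedgeTrace (hz.differentiableAt one_ne_zero)
  have h3 : DifferentiableAt ℝ (fderiv ℝ f) y :=
    (h2.fderiv_right (m := 1) (by norm_num)).differentiableAt one_ne_zero
  have h4 : ∀ i, HasFDerivAt (fun z => ExteriorAlgebra.ι ℝ (dx i) * fderiv ℝ f z (stdVec i))
      ((mulL n (ExteriorAlgebra.ι ℝ (dx i))).comp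
        ((fderiv ℝ (fderiv ℝ f) y).flip (stdVec i))) y := fun i => by
    refine (mulL n (ExteriorAlgebra.ι ℝ (dx i))).hasFDerivAt.comp y ?_
    exact ((ContinuousLinearMap.apply ℝ _ (stdVec i)).hasFDerivAt.comp y h3.hasFDerivAt)
  have h5 := HasFDerivAt.fun_sum (u := Finset.univ) fun i _ => h4 i
  have hsymm := h2.isSymmSndFDerivAt (by simp)
  rw [extDFlat_congr h1]
  refine (extDFlat_eq_wedgeTrace h5.differentiableAt).trans ?_
  rw [h5.fderiv]
  refine Eq.trans ?_ (sum_dx_mul_dx_eq_zero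
    (fun i j => fderiv ℝ (fderiv ℝ f) y (stdVec i) (stdVec j)) fun i j => hsymm _ _)
  refine Finset.sum_congr rfl fun i _ => ?_
  rw [sum_apply, Finset.mul_sum]
  rfl

/-- The pullback `A ↦ ξ ∘ A` of a 1-form. -/
def ιCompL (n : ℕ) (ξ : Module.Dual ℝ (Euc n')) : (Euc n →L[ℝ] Euc n') →L[ℝ] Forms (Euc n) :=
  LinearMap.toContinuousLinearMap
    { toFun := fun A => ExteriorAlgebra.ι ℝ (ξ.comp A.toLinearMap)
      map_add' := fun A B => by
        rw [← map_add]; congr 1; ext; simp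
      map_smul' := fun c A => by
        rw [RingHom.id_apply, ← map_smul]; congr 1; ext; simp }

theorem ιCompL_apply (ξ : Module.Dual ℝ (Euc n')) (A : Euc n →L[ℝ] Euc n') :
    ιCompL n ξ A = ExteriorAlgebra.ι ℝ (ξ.comp A.toLinearMap) := rfl

theorem contDiffAt_linPullback_const {F : Type*} [NormedAddCommGroup F] [NormedSpace ℝ F]
    {k : WithTop ℕ∞} {A : F → Euc n →L[ℝ] Euc n'} {y : F}
    (hA : ContDiffAt ℝ k A y) (c : Forms (Euc n')) :
    ContDiffAt ℝ k (fun z => linPullback (A z).toLinearMap c) y := by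
  induction c using Forms.left_induction with
  | algebraMap r => simp only [AlgHom.commutes]; exact contDiffAt_const
  | add α β h1 h2 => simp only [map_add]; exact h1.add h2
  | ι_mul α ξ h =>
    simp only [map_mul, linPullback_ι]
    exact contDiffAt_mul_forms ((ιCompL n ξ).contDiff.contDiffAt.comp y hA) h

theorem contDiffAt_linPullback {F : Type*} [NormedAddCommGroup F] [NormedSpace ℝ F]
    {k : WithTop ℕ∞} {A : F → Euc n →L[ℝ] Euc n'} {α : F → Forms (Euc n')} {y : F}
    (hA : ContDiffAt ℝ k A y) (hα : ContDiffAt ℝ k α y) :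
    ContDiffAt ℝ k (fun z => linPullback (A z).toLinearMap (α z)) y := by
  have h : ∀ z, linPullback (A z).toLinearMap (α z) =
      ∑ S, coeffL S (α z) • linPullback (A z).toLinearMap (formBasis n' S) := fun z => by
    conv_lhs => rw [← (formBasis n').sum_repr (α z)]
    rw [map_sum]
    exact Finset.sum_congr rfl fun S _ => map_smul _ _ _
  simp only [h]
  exact ContDiffAt.sum fun S _ => ((coeffL S).contDiff.contDiffAt.comp y hα).smul
    (contDiffAt_linPullback_const hA _)

/-- The contraction as a continuous bilinear map. -/
def contractL (n : ℕ) : Euc n →L[ℝ] Forms (Euc n) →L[ℝ] Forms (Euc n) :=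
  (CliffordAlgebra.contractLeft.comp (Module.Dual.eval ℝ (Euc n)) :
    Euc n →ₗ[ℝ] Forms (Euc n) →ₗ[ℝ] Forms (Euc n)).toContinuousBilinearMap

theorem contDiffAt_contract {F : Type*} [NormedAddCommGroup F] [NormedSpace ℝ F]
    {k : WithTop ℕ∞} {v : F → Euc n} {α : F → Forms (Euc n)} {y : F}
    (hv : ContDiffAt ℝ k v y) (hα : ContDiffAt ℝ k α y) :
    ContDiffAt ℝ k (fun z => contract (v z) (α z)) y :=
  ((contractL n).contDiff.contDiffAt.comp y hv).clm_apply hα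

/-- The pullback of a form on `ℝⁿ`. -/
def flatPullback (φ : Euc n → Euc n') (α : Euc n' → Forms (Euc n')) (y : Euc n) : Forms (Euc n) :=
  linPullback (fderiv ℝ φ y).toLinearMap (α (φ y))

theorem contDiffAt_flatPullback {φ : Euc n → Euc n'} {α : Euc n' → Forms (Euc n')} {y : Euc n}
    (hφ : ContDiffAt ℝ ∞ φ y) (hα : ContDiffAt ℝ ∞ α (φ y)) :
    ContDiffAt ℝ ∞ (flatPullback φ α) y :=
  contDiffAt_linPullback (hφ.fderiv_right (m := ∞) (by simp)) (hα.comp y hφ)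

/-- On a constant covector the pullback is `d(ξ ∘ φ)`, closed by symmetry of the second derivative
of `φ`; the Leibniz rule extends this to products. -/
theorem extDFlat_linPullback_const {φ : Euc n → Euc n'} {y : Euc n} (hφ : ContDiffAt ℝ ∞ φ y)
    (c : Forms (Euc n')) :
    extDFlat (fun z => linPullback (fderiv ℝ φ z).toLinearMap c) y = 0 := by
  have hφ' : ContDiffAt ℝ ∞ (fderiv ℝ φ) y := hφ.fderiv_right (m := ∞) (by simp)
  have hd : ∀ c, DifferentiableAt ℝ (fun z => linPullback (fderiv ℝ φ z).toLinearMap c) y :=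
    fun c => (contDiffAt_linPullback_const hφ' c).differentiableAt (by simp)
  induction c using Forms.left_induction with
  | algebraMap r => simp only [AlgHom.commutes]; exact extDFlat_const _ _
  | add α β h1 h2 =>
    simp only [map_add]
    rw [extDFlat_add (hd α) (hd β), h1, h2, add_zero]
  | ι_mul α ξ h =>
    simp only [map_mul]
    rw [extDFlat_mul (hd _) (hd α), h, mul_zero, add_zero]
    suffices h0 : extDFlat (fun z => linPullback (fderiv ℝ φ z).toLinearMap
        (ExteriorAlgebra.ι ℝ ξ)) y = 0 by rw [h0, zero_mul]
    have h1 : HasFDerivAt (fun z => linPullback (fderiv ℝ φ z).toLinearMap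
        (ExteriorAlgebra.ι ℝ ξ)) ((ιCompL n ξ).comp (fderiv ℝ (fderiv ℝ φ) y)) y := by
      simp only [linPullback_ι]
      exact (ιCompL n ξ).hasFDerivAt.comp y (hφ'.differentiableAt (by simp)).hasFDerivAt
    rw [extDFlat_eq_wedgeTrace h1.differentiableAt, h1.fderiv, wedgeTrace]
    have hsymm := (hφ.of_le (m := 2) (WithTop.coe_le_coe.2 (le_top : (2 : ℕ∞) ≤ ⊤))).isSymmSndFDerivAt
      (by simp)
    refine Eq.trans ?_ (sum_dx_mul_dx_eq_zero (fun i j => algebraMap ℝ _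
      (ξ (fderiv ℝ (fderiv ℝ φ) y (stdVec i) (stdVec j)))) fun i j => by rw [hsymm.eq])
    refine Finset.sum_congr rfl fun i _ => ?_
    rw [← Finset.mul_sum, ContinuousLinearMap.comp_apply, ιCompL_apply,
      ← sum_apply_dx (ξ.comp (fderiv ℝ (fderiv ℝ φ) y (stdVec i)).toLinearMap), map_sum]
    congr 1
    refine Finset.sum_congr rfl fun j _ => ?_
    rw [← Algebra.commutes, ← Algebra.smul_def, map_smul]
    rfl

/-- Expand `α = ∑ f_S dx_S`. Pullbacks of the constant forms `dx_S` are closed, so only the chain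
rule for the functions `f_S ∘ φ` remains. -/
theorem extDFlat_flatPullback {φ : Euc n → Euc n'} {α : Euc n' → Forms (Euc n')} {y : Euc n}
    (hφ : ContDiffAt ℝ ∞ φ y) (hα : ContDiffAt ℝ ∞ α (φ y)) :
    extDFlat (flatPullback φ α) y =
      linPullback (fderiv ℝ φ y).toLinearMap (extDFlat α (φ y)) := by
  have hφ' : ContDiffAt ℝ ∞ (fderiv ℝ φ) y := hφ.fderiv_right (m := ∞) (by simp)
  have hαS : ∀ S, ContDiffAt ℝ ∞ (fun z => (formBasis n').repr (α z) S) (φ y) :=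
    contDiffAt_coeff_iff.1 hα
  have h : flatPullback φ α = fun z => ∑ S, algebraMap ℝ (Forms (Euc n))
      ((formBasis n').repr (α (φ z)) S) *
        linPullback (fderiv ℝ φ z).toLinearMap (formBasis n' S) := by
    ext1 z
    rw [flatPullback]
    conv_lhs => rw [← (formBasis n').sum_repr (α (φ z))]
    rw [map_sum]
    exact Finset.sum_congr rfl fun S _ => by rw [map_smul, Algebra.smul_def]
  set L : ℝ →L[ℝ] Forms (Euc n) := LinearMap.toContinuousLinearMap (Algebra.linearMap ℝ _) with hL
  have hc : ∀ S, HasFDerivAt (fun z => algebraMap ℝ (Forms (Euc n))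
      ((formBasis n').repr (α (φ z)) S)) (L.comp ((fderiv ℝ (fun z => (formBasis n').repr (α z) S)
        (φ y)).comp (fderiv ℝ φ y))) y := fun S =>
    L.hasFDerivAt.comp y (HasFDerivAt.comp y
      ((hαS S).differentiableAt (by simp)).hasFDerivAt (hφ.differentiableAt (by simp)).hasFDerivAt)
  have hp : ∀ S, DifferentiableAt ℝ
      (fun z => linPullback (fderiv ℝ φ z).toLinearMap (formBasis n' S)) y := fun S =>
    (contDiffAt_linPullback_const hφ' _).differentiableAt (by simp)
  have hprod : ∀ S, DifferentiableAt ℝ (fun z => algebraMap ℝ (Forms (Euc n))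
      ((formBasis n').repr (α (φ z)) S) *
        linPullback (fderiv ℝ φ z).toLinearMap (formBasis n' S)) y := fun S =>
    ((mulL n).hasFDerivAt_of_bilinear (hc S) (hp S).hasFDerivAt).differentiableAt
  have hsum : ∀ s : Finset (Finset (Fin n')), extDFlat (fun z => ∑ S ∈ s,
      algebraMap ℝ (Forms (Euc n)) ((formBasis n').repr (α (φ z)) S) *
        linPullback (fderiv ℝ φ z).toLinearMap (formBasis n' S)) y =
      ∑ S ∈ s, extDFlat (fun z => algebraMap ℝ (Forms (Euc n))
        ((formBasis n').repr (α (φ z)) S) *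
        linPullback (fderiv ℝ φ z).toLinearMap (formBasis n' S)) y := by
    intro s
    induction s using Finset.induction_on with
    | empty => simpa using extDFlat_const (n := n) 0 y
    | insert a s ha ih =>
      simp only [Finset.sum_insert ha]
      rw [extDFlat_add (hprod a) (DifferentiableAt.fun_sum fun S _ => hprod S), ih]
  rw [h, hsum]
  simp only [extDFlat, map_sum]
  refine Finset.sum_congr rfl fun S _ => ?_
  change extDFlat (fun z => algebraMap ℝ (Forms (Euc n)) ((formBasis n').repr (α (φ z)) S) *
        linPullback (fderiv ℝ φ z).toLinearMap (formBasis n' S)) y = _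
  rw [extDFlat_mul (hc S).differentiableAt (hp S), extDFlat_linPullback_const hφ, mul_zero, add_zero,
    map_mul, linPullback_ι, extDFlat_eq_wedgeTrace (hc S).differentiableAt, (hc S).fderiv]
  congr 1
  rw [← sum_apply_dx (LinearMap.comp _ _), map_sum]
  refine Finset.sum_congr rfl fun i _ => ?_
  rw [map_smul, Algebra.smul_def, Algebra.commutes]
  rfl

end Flat

/-! ## Calculus of forms on manifolds -/

section ManifoldCalculus

open Filter Topology

variable {n n' n'' : ℕ} {N N' N'' : Type*} [TopologicalSpace N] [TopologicalSpace N']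
  [TopologicalSpace N'']
  [ChartedSpace (EuclideanSpace ℝ (Fin n)) N] [ChartedSpace (EuclideanSpace ℝ (Fin n')) N']
  [ChartedSpace (EuclideanSpace ℝ (Fin n'')) N'']

/-- The values `α z` and `α z'` live over different points, but both are forms on the model space;
the lemma compares them there. -/
theorem linPullback_congr_point {z z' : N'} (h : z = z') (A : Euc n →ₗ[ℝ] Euc n')
    (α : MixedForm n' N') :
    (linPullback A : Forms (Euc n') →ₐ[ℝ] Forms (Euc n)) (α z) =
      (linPullback A : Forms (Euc n') →ₐ[ℝ] Forms (Euc n)) (α z') := by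
  subst h; rfl

theorem pullback_congr {f g : N → N'} {x : N} (h : f =ᶠ[𝓝 x] g) (α : MixedForm n' N') :
    pullback (n := n) f α x = pullback g α x := by
  have h1 : (mfderiv (𝓡 n) (𝓡 n') f x : Euc n →L[ℝ] Euc n') = mfderiv (𝓡 n) (𝓡 n') g x :=
    h.mfderiv_eq
  have h2 := linPullback_congr_point h.eq_of_nhds
    (mfderiv (𝓡 n) (𝓡 n') f x : Euc n →L[ℝ] Euc n').toLinearMap α
  exact h2.trans (by rw [h1]; rfl)

theorem pullback_comp {f : N → N'} {g : N' → N''} {x : N}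
    (hg : MDifferentiableAt (𝓡 n') (𝓡 n'') g (f x)) (hf : MDifferentiableAt (𝓡 n) (𝓡 n') f x)
    (α : MixedForm n'' N'') : pullback (n := n) (g ∘ f) α x =
      pullback (n' := n') f (pullback g α) x := by
  have h1 := mfderiv_comp x hg hf
  refine Eq.trans ?_ (linPullback_comp _ _ _).symm
  simp only [pullback, h1]
  rfl

theorem pullback_id (α : MixedForm n N) (x : N) : pullback (n := n) (n' := n) id α x = α x := by
  have h : mfderiv (𝓡 n) (𝓡 n) (id : N → N) x = ContinuousLinearMap.id ℝ _ := mfderiv_id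
  simp only [pullback, h]
  exact linPullback_id _

theorem pullback_mul (f : N → N') (α β : MixedForm n' N') :
    pullback (n := n) f (α * β) = pullback f α * pullback f β :=
  funext fun _ => map_mul _ _ _

theorem pullback_add (f : N → N') (α β : MixedForm n' N') :
    pullback (n := n) f (α + β) = pullback f α + pullback f β :=
  funext fun _ => map_add _ _ _

theorem pullback_neg (f : N → N') (α : MixedForm n' N') :
    pullback (n := n) f (-α) = -pullback f α :=
  funext fun _ => map_neg _ _

theorem pullback_zero (f : N → N') :
    pullback (n := n) f (0 : MixedForm n' N') = 0 :=
  funext fun _ => map_zero _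

/-- Smoothness of a form at a point. -/
def SmoothFormAt (α : MixedForm n N) (x : N) : Prop :=
  ContDiffAt ℝ ∞ (chartRep α x) (extChartAt (𝓡 n) x x)

theorem SmoothFormAt.congr {α β : MixedForm n N} {x : N} (hα : SmoothFormAt α x)
    (h : ∀ᶠ z in 𝓝 x, α z = β z) : SmoothFormAt β x := by
  refine ContDiffAt.congr_of_eventuallyEq hα ?_
  have h1 : Tendsto (extChartAt (𝓡 n) x).symm (𝓝 (extChartAt (𝓡 n) x x)) (𝓝 x) := by
    have := (continuousAt_extChartAt_symm (I := 𝓡 n) x).tendsto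
    rwa [extChartAt_to_inv] at this
  filter_upwards [h1.eventually h] with y hy
  exact (congrArg _ hy).symm

theorem infty_ne_zero : (∞ : WithTop ℕ∞) ≠ 0 := by simp

theorem SmoothFormAt.add {α β : MixedForm n N} {x : N} (hα : SmoothFormAt α x)
    (hβ : SmoothFormAt β x) : SmoothFormAt (α + β) x := by
  have h : chartRep (α + β) x = fun y => chartRep α x y + chartRep β x y :=
    pullback_add _ α β
  rw [SmoothFormAt, h]
  exact ContDiffAt.add hα hβ

theorem SmoothFormAt.mul {α β : MixedForm n N} {x : N} (hα : SmoothFormAt α x)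
    (hβ : SmoothFormAt β x) : SmoothFormAt (α * β) x := by
  have h : chartRep (α * β) x = fun y => chartRep α x y * chartRep β x y :=
    pullback_mul _ α β
  rw [SmoothFormAt, h]
  exact contDiffAt_mul_forms hα hβ

theorem SmoothFormAt.neg {α : MixedForm n N} {x : N} (hα : SmoothFormAt α x) :
    SmoothFormAt (-α) x := by
  have h : chartRep (-α) x = fun y => -chartRep α x y := pullback_neg _ α
  rw [SmoothFormAt, h]
  exact ContDiffAt.neg hα

theorem SmoothFormAt.smul {α : MixedForm n N} {x : N} (c : ℝ) (hα : SmoothFormAt α x) :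
    SmoothFormAt (c • α) x := by
  have h : chartRep (c • α) x = fun y => c • chartRep α x y := funext fun y =>
    map_smul (linPullback (mfderiv (𝓡 n) (𝓡 n) (extChartAt (𝓡 n) x).symm y).toLinearMap) c (α _)
  rw [SmoothFormAt, h]
  exact (contDiffAt_const (c := c)).smul hα

theorem extD_add {α β : MixedForm n N} {x : N} (hα : SmoothFormAt α x) (hβ : SmoothFormAt β x) :
    extD (α + β) x = extD α x + extD β x := by
  have h : chartRep (α + β) x = fun y => chartRep α x y + chartRep β x y :=
    pullback_add _ α β
  rw [extD, h, extDFlat_add (hα.differentiableAt infty_ne_zero) (hβ.differentiableAt infty_ne_zero)]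
  exact map_add _ _ _

theorem extD_neg {α : MixedForm n N} {x : N} (hα : SmoothFormAt α x) :
    extD (-α) x = -extD α x := by
  have h := extD_add hα hα.neg
  rw [add_neg_cancel] at h
  have h0 : extD (0 : MixedForm n N) x = 0 := by
    have h : chartRep (0 : MixedForm n N) x = fun _ => 0 := pullback_zero _
    rw [extD, h, extDFlat_const]
    exact map_zero _
  rw [h0] at h
  exact eq_neg_of_add_eq_zero_right h.symm

theorem extD_eq_pullback (α : MixedForm n N) (x : N) :
    extD α x = pullback (n := n) (n' := n) (extChartAt (𝓡 n) x) (extDFlat (chartRep α x)) x := rfl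

variable [IsManifold (𝓡 n) ∞ N] [IsManifold (𝓡 n') ∞ N'] [IsManifold (𝓡 n'') ∞ N'']

theorem contMDiffAt_chart_symm (x₀ : N) {y : Euc n} (hy : y ∈ (extChartAt (𝓡 n) x₀).target) :
    ContMDiffAt (𝓡 n) (𝓡 n) ∞ (extChartAt (𝓡 n) x₀).symm y :=
  (contMDiffOn_extChartAt_symm x₀).contMDiffAt (extChartAt_target_mem_nhds' hy)

theorem contMDiffAt_chart {x₀ x : N} (hx : x ∈ (extChartAt (𝓡 n) x₀).source) :
    ContMDiffAt (𝓡 n) (𝓡 n) ∞ (extChartAt (𝓡 n) x₀) x :=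
  contMDiffAt_extChartAt' (by rwa [extChartAt_source] at hx)

theorem contMDiffAt_eventually_one {f : N → N'} {x : N} (hf : ContMDiffAt (𝓡 n) (𝓡 n') ∞ f x) :
    ∀ᶠ z in 𝓝 x, ContMDiffAt (𝓡 n) (𝓡 n') 1 f z := by
  have : IsManifold (𝓡 n) 1 N := IsManifold.of_le (n := ∞) (by exact_mod_cast le_top)
  have : IsManifold (𝓡 n') 1 N' := IsManifold.of_le (n := ∞) (by exact_mod_cast le_top)
  exact (contMDiffAt_iff_contMDiffAt_nhds (by simp)).1 (hf.of_le (by exact_mod_cast le_top))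

theorem contDiffAt_written {f : N → N'} {x₀ : N} {z₀ : N'} {y : Euc n}
    (hy : y ∈ (extChartAt (𝓡 n) x₀).target)
    (hf : ContMDiffAt (𝓡 n) (𝓡 n') ∞ f ((extChartAt (𝓡 n) x₀).symm y))
    (hz : f ((extChartAt (𝓡 n) x₀).symm y) ∈ (extChartAt (𝓡 n') z₀).source) :
    ContDiffAt ℝ ∞ (extChartAt (𝓡 n') z₀ ∘ f ∘ (extChartAt (𝓡 n) x₀).symm) y := by
  rw [← contMDiffAt_iff_contDiffAt]
  exact (contMDiffAt_chart hz).comp y (hf.comp y (contMDiffAt_chart_symm x₀ hy))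

/-- In charts, the pullback along `f` is the flat pullback along the coordinate expression of `f`.
For `f = id` this is the change of charts. -/
theorem chartRep_pullback {f : N → N'} {x₀ : N} {z₀ : N'} {y : Euc n}
    (hy : y ∈ (extChartAt (𝓡 n) x₀).target)
    (hf : MDifferentiableAt (𝓡 n) (𝓡 n') f ((extChartAt (𝓡 n) x₀).symm y))
    (hz : f ((extChartAt (𝓡 n) x₀).symm y) ∈ (extChartAt (𝓡 n') z₀).source)
    (α : MixedForm n' N') : chartRep (pullback f α) x₀ y =
      flatPullback (extChartAt (𝓡 n') z₀ ∘ f ∘ (extChartAt (𝓡 n) x₀).symm) (chartRep α z₀) y := by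
  set ψ := extChartAt (𝓡 n) x₀
  set ψ' := extChartAt (𝓡 n') z₀
  have h1 : MDifferentiableAt (𝓡 n) (𝓡 n) ψ.symm y :=
    (contMDiffAt_chart_symm x₀ hy).mdifferentiableAt infty_ne_zero
  have h2 : MDifferentiableAt (𝓡 n) (𝓡 n') (f ∘ ψ.symm) y := hf.comp y h1
  have h3 : MDifferentiableAt (𝓡 n') (𝓡 n') ψ' ((f ∘ ψ.symm) y) :=
    (contMDiffAt_chart hz).mdifferentiableAt infty_ne_zero
  have h4 : MDifferentiableAt (𝓡 n') (𝓡 n') ψ'.symm ((ψ' ∘ f ∘ ψ.symm) y) :=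
    (contMDiffAt_chart_symm z₀ (ψ'.map_source hz)).mdifferentiableAt infty_ne_zero
  have h5 : flatPullback (ψ' ∘ f ∘ ψ.symm) (chartRep α z₀) y =
      pullback (n := n) (n' := n') (ψ' ∘ f ∘ ψ.symm) (pullback ψ'.symm α) y := by
    rw [flatPullback, ← mfderiv_eq_fderiv]
    rfl
  have h6 : chartRep (pullback f α) x₀ y = pullback (n := n) ψ.symm (pullback f α) y := rfl
  rw [h5, h6, ← pullback_comp hf h1, ← pullback_comp h4 (h3.comp y h2)]
  refine pullback_congr ?_ α
  have h7 : ∀ᶠ z in 𝓝 y, (f ∘ ψ.symm) z ∈ ψ'.source :=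
    h2.continuousAt.eventually ((isOpen_extChartAt_source z₀).mem_nhds hz)
  filter_upwards [h7] with z hz'
  exact (ψ'.left_inv hz').symm

theorem chartRep_pullback_eventuallyEq {f : N → N'} {x₀ : N} {z₀ : N'} {y : Euc n}
    (hy : y ∈ (extChartAt (𝓡 n) x₀).target)
    (hf : ContMDiffAt (𝓡 n) (𝓡 n') ∞ f ((extChartAt (𝓡 n) x₀).symm y))
    (hz : f ((extChartAt (𝓡 n) x₀).symm y) ∈ (extChartAt (𝓡 n') z₀).source)
    (α : MixedForm n' N') : chartRep (pullback f α) x₀ =ᶠ[𝓝 y]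
      flatPullback (extChartAt (𝓡 n') z₀ ∘ f ∘ (extChartAt (𝓡 n) x₀).symm) (chartRep α z₀) := by
  have hc : ContinuousAt (extChartAt (𝓡 n) x₀).symm y :=
    (contMDiffAt_chart_symm x₀ hy).continuousAt
  have h1 : ∀ᶠ z in 𝓝 ((extChartAt (𝓡 n) x₀).symm y), ContMDiffAt (𝓡 n) (𝓡 n') 1 f z :=
    contMDiffAt_eventually_one hf
  filter_upwards [extChartAt_target_mem_nhds' hy, hc.eventually h1,
    (hf.continuousAt.comp hc).eventually ((isOpen_extChartAt_source z₀).mem_nhds hz)]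
    with z h2 h3 h4
  exact chartRep_pullback h2 (h3.mdifferentiableAt one_ne_zero) h4 α

theorem chartRep_eventuallyEq {x₀ z₀ : N} {y : Euc n}
    (hy : y ∈ (extChartAt (𝓡 n) x₀).target)
    (hz : (extChartAt (𝓡 n) x₀).symm y ∈ (extChartAt (𝓡 n) z₀).source)
    (α : MixedForm n N) : chartRep α x₀ =ᶠ[𝓝 y]
      flatPullback (extChartAt (𝓡 n) z₀ ∘ (extChartAt (𝓡 n) x₀).symm) (chartRep α z₀) := by
  have h := chartRep_pullback_eventuallyEq (f := (id : N → N)) hy contMDiffAt_id hz α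
  rwa [show pullback (n := n) (n' := n) id α = α from funext (pullback_id α)] at h

theorem SmoothFormAt.contDiffAt_chartRep {α : MixedForm n N} {x₀ : N} {y : Euc n}
    (hy : y ∈ (extChartAt (𝓡 n) x₀).target) (h : SmoothFormAt α ((extChartAt (𝓡 n) x₀).symm y)) :
    ContDiffAt ℝ ∞ (chartRep α x₀) y := by
  have hz := mem_extChartAt_source (I := 𝓡 n) ((extChartAt (𝓡 n) x₀).symm y)
  exact (contDiffAt_flatPullback (contDiffAt_written (f := id) hy contMDiffAt_id hz)
    h).congr_of_eventuallyEq (chartRep_eventuallyEq hy hz α)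

/-- Any chart differs from the preferred chart at a point by a smooth transition map, so it suffices
to test each point in its own chart. -/
theorem isSmoothForm_iff {α : MixedForm n N} : IsSmoothForm α ↔ ∀ x, SmoothFormAt α x := by
  constructor
  · intro h x
    refine contDiffAt_coeff_iff.2 fun S => (h x S).contDiffAt ?_
    exact extChartAt_target_mem_nhds x
  · intro h x₀ S y hy
    exact (contDiffAt_coeff_iff.1 ((h _).contDiffAt_chartRep hy) S).contDiffWithinAt

theorem SmoothFormAt.pullback {f : N → N'} {x : N} {α : MixedForm n' N'}
    (hf : ContMDiffAt (𝓡 n) (𝓡 n') ∞ f x) (hα : SmoothFormAt α (f x)) :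
    SmoothFormAt (GenGeom.pullback (n := n) f α) x := by
  have hy := mem_extChartAt_target (I := 𝓡 n) x
  have hx : (extChartAt (𝓡 n) x).symm (extChartAt (𝓡 n) x x) = x := extChartAt_to_inv x
  have hz := mem_extChartAt_source (I := 𝓡 n') (f x)
  rw [← hx] at hf
  have hz' : f ((extChartAt (𝓡 n) x).symm (extChartAt (𝓡 n) x x)) ∈
    (extChartAt (𝓡 n') (f x)).source := by rwa [hx]
  refine (contDiffAt_flatPullback (contDiffAt_written hy hf hz') ?_).congr_of_eventuallyEq
    (chartRep_pullback_eventuallyEq hy hf hz' α)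
  simp only [Function.comp_apply, hx]
  exact hα

theorem pullback_chart_chartRep (α : MixedForm n N) (x : N) :
    pullback (n := n) (n' := n) (extChartAt (𝓡 n) x) (chartRep α x) x = α x := by
  have h1 : MDifferentiableAt (𝓡 n) (𝓡 n) (extChartAt (𝓡 n) x) x :=
    (contMDiffAt_chart (mem_extChartAt_source x)).mdifferentiableAt infty_ne_zero
  have h2 : MDifferentiableAt (𝓡 n) (𝓡 n) (extChartAt (𝓡 n) x).symm (extChartAt (𝓡 n) x x) :=
    (contMDiffAt_chart_symm x (mem_extChartAt_target x)).mdifferentiableAt infty_ne_zero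
  refine (pullback_comp h2 h1 α).symm.trans ?_
  refine (pullback_congr (g := id) ?_ α).trans (pullback_id α x)
  filter_upwards [extChartAt_source_mem_nhds (I := 𝓡 n) x] with z hz
  exact (extChartAt (𝓡 n) x).left_inv hz

/-- The charts at `x` and `f x` reduce naturality to that of the flat derivative, because the
coordinate expression of `f` intertwines them. -/
theorem extD_pullback {f : N → N'} {x : N} {α : MixedForm n' N'}
    (hf : ContMDiffAt (𝓡 n) (𝓡 n') ∞ f x) (hα : SmoothFormAt α (f x)) :
    extD (pullback (n := n) f α) x = pullback (n := n) f (extD α) x := by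
  have hy := mem_extChartAt_target (I := 𝓡 n) x
  have hx : (extChartAt (𝓡 n) x).symm (extChartAt (𝓡 n) x x) = x := extChartAt_to_inv x
  have hz := mem_extChartAt_source (I := 𝓡 n') (f x)
  have hf' := hf
  rw [← hx] at hf'
  have hz' : f ((extChartAt (𝓡 n) x).symm (extChartAt (𝓡 n) x x)) ∈
    (extChartAt (𝓡 n') (f x)).source := by rwa [hx]
  set φ := extChartAt (𝓡 n') (f x) ∘ f ∘ (extChartAt (𝓡 n) x).symm with hφ
  have hφs : ContDiffAt ℝ ∞ φ (extChartAt (𝓡 n) x x) := contDiffAt_written hy hf' hz'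
  have hφx : φ (extChartAt (𝓡 n) x x) = extChartAt (𝓡 n') (f x) (f x) := by
    simp only [hφ, Function.comp_apply, hx]
  have h1 : extDFlat (chartRep (pullback f α) x) (extChartAt (𝓡 n) x x) =
      pullback (n := n) (n' := n') φ (extDFlat (chartRep α (f x))) (extChartAt (𝓡 n) x x) := by
    rw [extDFlat_congr (chartRep_pullback_eventuallyEq hy hf' hz' α),
      extDFlat_flatPullback hφs (by rw [hφx]; exact hα), ← mfderiv_eq_fderiv]
    rfl
  have h2 : MDifferentiableAt (𝓡 n) (𝓡 n) (extChartAt (𝓡 n) x) x :=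
    (contMDiffAt_chart (mem_extChartAt_source x)).mdifferentiableAt infty_ne_zero
  have h3 : MDifferentiableAt (𝓡 n) (𝓡 n') φ (extChartAt (𝓡 n) x x) :=
    (contMDiffAt_iff_contDiffAt.2 hφs).mdifferentiableAt infty_ne_zero
  have h4 : MDifferentiableAt (𝓡 n') (𝓡 n') (extChartAt (𝓡 n') (f x)) (f x) :=
    (contMDiffAt_chart hz).mdifferentiableAt infty_ne_zero
  have h5 : extD (pullback f α) x = pullback (n := n) (n' := n) (extChartAt (𝓡 n) x)
      (pullback (n := n) (n' := n') φ (extDFlat (chartRep α (f x)))) x := by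
    rw [extD, h1]; rfl
  have h6 : pullback f (extD α) x = pullback (n := n) f
      (pullback (n := n') (n' := n') (extChartAt (𝓡 n') (f x)) (extDFlat (chartRep α (f x)))) x :=
    congrArg (linPullback (mfderiv (𝓡 n) (𝓡 n') f x).toLinearMap) (extD_eq_pullback α (f x))
  refine (h5.trans (pullback_comp h3 h2 _).symm).trans (Eq.trans ?_
    ((pullback_comp h4 (hf.mdifferentiableAt infty_ne_zero) _).trans h6.symm))
  refine pullback_congr ?_ _
  filter_upwards [extChartAt_source_mem_nhds (I := 𝓡 n) x] with z hz
  simp only [hφ, Function.comp_apply, (extChartAt (𝓡 n) x).left_inv hz]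

/-- `extD` uses a different chart at each point. One fixed chart computes it at nearby points as
well, which is what `d² = 0` and smoothness of the derivative require. -/
theorem chartRep_extD {α : MixedForm n N} {x₀ : N} {y : Euc n}
    (hy : y ∈ (extChartAt (𝓡 n) x₀).target) (h : SmoothFormAt α ((extChartAt (𝓡 n) x₀).symm y)) :
    chartRep (extD α) x₀ y = extDFlat (chartRep α x₀) y := by
  set x := (extChartAt (𝓡 n) x₀).symm y with hx
  have hz := mem_extChartAt_source (I := 𝓡 n) x
  have h1 := contDiffAt_written (f := (id : N → N)) hy contMDiffAt_id hz
  rw [extDFlat_congr (chartRep_eventuallyEq hy hz α)]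
  refine Eq.trans ?_ (extDFlat_flatPullback h1 h).symm
  have h2 : MDifferentiableAt (𝓡 n) (𝓡 n) (extChartAt (𝓡 n) x) x :=
    (contMDiffAt_chart hz).mdifferentiableAt infty_ne_zero
  have h3 : MDifferentiableAt (𝓡 n) (𝓡 n) (extChartAt (𝓡 n) x₀).symm y :=
    (contMDiffAt_chart_symm x₀ hy).mdifferentiableAt infty_ne_zero
  have h4 : chartRep (extD α) x₀ y = pullback (n := n) (n' := n) (extChartAt (𝓡 n) x₀).symm
      (pullback (n := n) (n' := n) (extChartAt (𝓡 n) x) (extDFlat (chartRep α x))) y :=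
    congrArg (linPullback (mfderiv (𝓡 n) (𝓡 n) (extChartAt (𝓡 n) x₀).symm y).toLinearMap)
      (extD_eq_pullback α x)
  rw [← mfderiv_eq_fderiv]
  exact h4.trans (pullback_comp h2 h3 (extDFlat (chartRep α x))).symm

theorem chartRep_extD_eventuallyEq {α : MixedForm n N} (h : ∀ x, SmoothFormAt α x) {x₀ : N}
    {y : Euc n} (hy : y ∈ (extChartAt (𝓡 n) x₀).target) :
    chartRep (extD α) x₀ =ᶠ[𝓝 y] extDFlat (chartRep α x₀) := by
  filter_upwards [extChartAt_target_mem_nhds' hy] with z hz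
  exact chartRep_extD hz (h _)

theorem SmoothFormAt.extD {α : MixedForm n N} (h : ∀ x, SmoothFormAt α x) (x : N) :
    SmoothFormAt (GenGeom.extD α) x :=
  (contDiffAt_extDFlat (h x)).congr_of_eventuallyEq
    (chartRep_extD_eventuallyEq h (mem_extChartAt_target x))

theorem extD_extD {α : MixedForm n N} (h : ∀ x, SmoothFormAt α x) : extD (extD α) = 0 := by
  funext x
  rw [extD, extDFlat_congr (chartRep_extD_eventuallyEq h (mem_extChartAt_target x)),
    extDFlat_extDFlat (h x)]
  exact map_zero _

theorem extD_mul {α β : MixedForm n N} {x : N} (hα : SmoothFormAt α x) (hβ : SmoothFormAt β x) :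
    extD (α * β) x = extD α x * β x + CliffordAlgebra.involute (α x) * extD β x := by
  have h : chartRep (α * β) x = fun y => chartRep α x y * chartRep β x y :=
    pullback_mul _ α β
  have h1 := pullback_chart_chartRep α x
  have h2 := pullback_chart_chartRep β x
  rw [extD, h, extDFlat_mul (hα.differentiableAt infty_ne_zero)
    (hβ.differentiableAt infty_ne_zero)]
  conv_rhs => rw [← h1, ← h2]
  refine (map_add _ _ _).trans ?_
  refine congrArg₂ _ (map_mul _ _ _) ?_
  refine (map_mul _ _ _).trans ?_
  exact congrArg (· * _) (involute_linPullback _ _).symm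

end ManifoldCalculus

/-! ## T-duality of forms on a vector space -/

section LinearTDuality

variable {V V' W : Type*} [AddCommGroup V] [Module ℝ V] [AddCommGroup V'] [Module ℝ V']
  [AddCommGroup W] [Module ℝ W]

theorem linPullback_injective {f : V →ₗ[ℝ] W} (hf : Function.Surjective f) :
    Function.Injective (linPullback f) := by
  obtain ⟨g, hg⟩ := f.exists_rightInverse_of_surjective (LinearMap.range_eq_top.2 hf)
  intro α β h
  have := congrArg (linPullback g) h
  rwa [linPullback_comp, linPullback_comp, hg, linPullback_id, linPullback_id] at this

theorem contract_linPullback_of_apply_eq_zero {π : V →ₗ[ℝ] W} {X : V} (hX : π X = 0)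
    (α : Forms W) : contract X (linPullback π α) = 0 := by
  rw [contract_linPullback, hX, contract_zero_left, map_zero]

theorem contract_ι_mul_add_linPullback {π : V →ₗ[ℝ] W} {X : V} {θ : Module.Dual ℝ V} (hX : π X = 0)
    (hθ : θ X = 1) (a b : Forms W) :
    contract X (ExteriorAlgebra.ι ℝ θ * linPullback π a + linPullback π b) = linPullback π a := by
  rw [map_add, contract_ι_mul, contract_linPullback_of_apply_eq_zero hX,
    contract_linPullback_of_apply_eq_zero hX, hθ, one_smul, mul_zero, sub_zero, add_zero]

/-- Contraction with the vertical vector isolates the first component; pullback along a surjection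
is injective. -/
theorem ι_mul_add_linPullback_inj {π : V →ₗ[ℝ] W} {X : V} {θ : Module.Dual ℝ V}
    (hπ : Function.Surjective π) (hX : π X = 0) (hθ : θ X = 1) {a b a' b' : Forms W}
    (h : ExteriorAlgebra.ι ℝ θ * linPullback π a + linPullback π b =
      ExteriorAlgebra.ι ℝ θ * linPullback π a' + linPullback π b') : a = a' ∧ b = b' := by
  have h1 := congrArg (contract X) h
  rw [contract_ι_mul_add_linPullback hX hθ, contract_ι_mul_add_linPullback hX hθ] at h1
  have h2 := linPullback_injective hπ h1
  rw [h2, add_right_inj] at h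
  exact ⟨h2, linPullback_injective hπ h⟩

/-- Here `σ` is the horizontal lift: `α` splits into `θ ∧ (X ⌟ α)` and its horizontal part, and both
factors are pulled back from `W`. -/
theorem eq_ι_mul_add_linPullback {π : V →ₗ[ℝ] W} {X : V} {θ : Module.Dual ℝ V} {σ : W →ₗ[ℝ] V}
    (h : ∀ v, v = θ v • X + σ (π v)) (α : Forms V) :
    α = ExteriorAlgebra.ι ℝ θ * linPullback π (linPullback σ (contract X α)) +
      linPullback π (linPullback σ α) := by
  simp only [linPullback_comp]
  induction α using Forms.left_induction with
  | algebraMap r => simp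
  | add α β h1 h2 =>
    simp only [map_add, mul_add]
    nth_rewrite 1 [h1, h2]
    abel
  | ι_mul α ξ ih =>
    have h1 : (ExteriorAlgebra.ι ℝ ξ : Forms V) = ξ X • ExteriorAlgebra.ι ℝ θ +
        linPullback (σ.comp π) (ExteriorAlgebra.ι ℝ ξ) := by
      rw [linPullback_ι, ← map_smul, ← map_add]
      congr 1
      ext v
      conv_lhs => rw [h v]
      simp [mul_comm]
    have h2 : (ExteriorAlgebra.ι ℝ θ : Forms V) * ExteriorAlgebra.ι ℝ θ = 0 :=
      ExteriorAlgebra.ι_sq_zero θ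
    have h3 : linPullback (σ.comp π) (ExteriorAlgebra.ι ℝ ξ) * ExteriorAlgebra.ι ℝ θ =
        -(ExteriorAlgebra.ι ℝ θ * linPullback (σ.comp π) (ExteriorAlgebra.ι ℝ ξ)) := by
      rw [linPullback_ι]
      exact eq_neg_of_add_eq_zero_left (ExteriorAlgebra.ι_add_mul_swap _ _)
    rw [contract_ι_mul, map_sub, map_smul, map_mul, map_mul]
    nth_rewrite 1 [ih]
    nth_rewrite 1 [h1]
    simp only [add_mul, mul_add, smul_mul_assoc, mul_sub, mul_smul_comm, ← mul_assoc, h2, h3]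
    simp only [zero_mul, smul_zero, neg_mul]
    abel

theorem bijective_prod_of_splitting [FiniteDimensional ℝ W] [FiniteDimensional ℝ V] {π : V →ₗ[ℝ] W}
    {X : V} {θ : Module.Dual ℝ V} (hV : Module.finrank ℝ V = Module.finrank ℝ W + 1)
    (hπ : Function.Surjective π) (hX : π X = 0) (hθ : θ X = 1) :
    Function.Bijective (LinearMap.prod θ π) := by
  have hs : Function.Surjective (LinearMap.prod θ π) := by
    rintro ⟨c, w⟩
    obtain ⟨v, rfl⟩ := hπ w
    exact ⟨v + (c - θ v) • X, by simp [hX, hθ]⟩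
  refine ⟨(LinearMap.injective_iff_surjective_of_finrank_eq_finrank ?_).2 hs, hs⟩
  rw [hV, Module.finrank_prod, Module.finrank_self, add_comm]

theorem exists_eq_ι_mul_add_linPullback [FiniteDimensional ℝ W] [FiniteDimensional ℝ V]
    {π : V →ₗ[ℝ] W} {X : V} {θ : Module.Dual ℝ V}
    (hV : Module.finrank ℝ V = Module.finrank ℝ W + 1)
    (hπ : Function.Surjective π) (hX : π X = 0) (hθ : θ X = 1) (α : Forms V) :
    ∃ a b : Forms W, α = ExteriorAlgebra.ι ℝ θ * linPullback π a + linPullback π b := by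
  set Φ := LinearEquiv.ofBijective _ (bijective_prod_of_splitting hV hπ hX hθ) with hΦ
  refine ⟨_, _, eq_ι_mul_add_linPullback (X := X)
    (σ := Φ.symm.toLinearMap.comp (LinearMap.inr ℝ ℝ W)) (fun v => Φ.injective ?_) α⟩
  change Φ v = Φ (θ v • X + Φ.symm (0, π v))
  rw [map_add, map_smul, Φ.apply_symm_apply]
  simp [hΦ, hX, hθ]

/-- The pair `(θ, π)` identifies either space with `ℝ × W`. -/
theorem exists_equiv_of_splitting {π : V →ₗ[ℝ] W} {X : V} {θ : Module.Dual ℝ V}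
    {π' : V' →ₗ[ℝ] W} {X' : V'} {θ' : Module.Dual ℝ V'} [FiniteDimensional ℝ W]
    [FiniteDimensional ℝ V] [FiniteDimensional ℝ V']
    (hV : Module.finrank ℝ V = Module.finrank ℝ W + 1)
    (hV' : Module.finrank ℝ V' = Module.finrank ℝ W + 1)
    (hπ : Function.Surjective π) (hX : π X = 0) (hθ : θ X = 1)
    (hπ' : Function.Surjective π') (hX' : π' X' = 0) (hθ' : θ' X' = 1) :
    ∃ f : V' ≃ₗ[ℝ] V, π.comp f.toLinearMap = π' ∧ θ.comp f.toLinearMap = θ' := by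
  set Φ := LinearEquiv.ofBijective _ (bijective_prod_of_splitting hV hπ hX hθ)
  set Φ' := LinearEquiv.ofBijective _ (bijective_prod_of_splitting hV' hπ' hX' hθ')
  have h : ∀ v, LinearMap.prod θ π (Φ.symm (Φ' v)) = LinearMap.prod θ' π' v := fun v =>
    Φ.apply_symm_apply (Φ' v)
  exact ⟨Φ'.trans Φ.symm, LinearMap.ext fun v => congrArg Prod.snd (h v),
    LinearMap.ext fun v => congrArg Prod.fst (h v)⟩

/-- The wedge with `θ` kills `θ ∧ a` and the contraction with `X` kills `b`, so Clifford
multiplication interchanges the components: this is T-duality at a point. -/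
theorem linPullback_vectorAction_of_splitting {π : V →ₗ[ℝ] W} {X : V} {θ : Module.Dual ℝ V}
    (hX : π X = 0) (hθ : θ X = 1) (f : V' →ₗ[ℝ] V) (a b : Forms W) :
    linPullback f (vectorAction V (θ, X)
      (ExteriorAlgebra.ι ℝ θ * linPullback π a + linPullback π b)) =
      ExteriorAlgebra.ι ℝ (θ.comp f) * linPullback (π.comp f) b + linPullback (π.comp f) a := by
  rw [vectorAction_apply, contract_ι_mul_add_linPullback hX hθ, mul_add, ← mul_assoc,
    ExteriorAlgebra.ι_sq_zero, zero_mul, zero_add, map_add, map_mul, linPullback_ι,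
    linPullback_comp, linPullback_comp]

end LinearTDuality

/-! ## Principal circle bundles -/

section Bundle

open Filter Topology

variable {m : ℕ} {M P : Type*} [TopologicalSpace M] [TopologicalSpace P]
  [ChartedSpace (EuclideanSpace ℝ (Fin m)) M]
  [ChartedSpace (EuclideanSpace ℝ (Fin (m + 1))) P] [MulAction Circle P] {p : P → M}

/-- The differential of the bundle projection, with the tangent spaces identified with the model
spaces. -/
def projD (p : P → M) (x : P) : Euc (m + 1) →ₗ[ℝ] Euc m :=
  (mfderiv (𝓡 (m + 1)) (𝓡 m) p x : Euc (m + 1) →L[ℝ] Euc m).toLinearMap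

/-- The generator as a vector of the model space. -/
def genVec (x : P) : Euc (m + 1) := generator (n := m + 1) x

theorem IsPrincipalCircleBundle.contMDiff_smul
    (h : IsPrincipalCircleBundle (n := m + 1) (n' := m) p) (z : Circle) :
    ContMDiff (𝓡 (m + 1)) (𝓡 (m + 1)) ∞ fun x : P => z • x :=
  h.smooth_action.comp (contMDiff_const.prodMk contMDiff_id)

theorem IsPrincipalCircleBundle.contMDiff_flow
    (h : IsPrincipalCircleBundle (n := m + 1) (n' := m) p) :
    ContMDiff (𝓘(ℝ, ℝ).prod (𝓡 (m + 1))) (𝓡 (m + 1)) ∞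
      fun q : ℝ × P => Circle.exp (2 * Real.pi * q.1) • q.2 := by
  have h1 : ContMDiff 𝓘(ℝ, ℝ) 𝓘(ℝ, ℝ) ∞ fun t : ℝ => 2 * Real.pi * t :=
    (contDiff_const.mul contDiff_id).contMDiff
  have h2 : ContMDiff 𝓘(ℝ, ℝ) (𝓡 1) ∞ fun t : ℝ => Circle.exp (2 * Real.pi * t) :=
    contMDiff_circleExp.comp h1
  exact h.smooth_action.comp ((h2.comp contMDiff_fst).prodMk contMDiff_snd)

theorem IsPrincipalCircleBundle.contMDiff_orbit
    (h : IsPrincipalCircleBundle (n := m + 1) (n' := m) p) (x : P) :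
    ContMDiff 𝓘(ℝ, ℝ) (𝓡 (m + 1)) ∞ fun t : ℝ => Circle.exp (2 * Real.pi * t) • x :=
  h.contMDiff_flow.comp (contMDiff_id.prodMk contMDiff_const)

/-- The differential of the action of a group element. -/
def actD (z : Circle) (x : P) : Euc (m + 1) →ₗ[ℝ] Euc (m + 1) :=
  (mfderiv (𝓡 (m + 1)) (𝓡 (m + 1)) (fun x : P => z • x) x :
    Euc (m + 1) →L[ℝ] Euc (m + 1)).toLinearMap

theorem IsPrincipalCircleBundle.projD_genVec
    (h : IsPrincipalCircleBundle (n := m + 1) (n' := m) p) (x : P) :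
    projD p x (genVec (m := m) x) = 0 := by
  have h0 : Circle.exp (2 * Real.pi * 0) • x = x := by simp
  have h1 : MDifferentiableAt 𝓘(ℝ, ℝ) (𝓡 (m + 1))
      (fun t : ℝ => Circle.exp (2 * Real.pi * t) • x) 0 :=
    (h.contMDiff_orbit x).contMDiffAt.mdifferentiableAt infty_ne_zero
  have h2 : MDifferentiableAt (𝓡 (m + 1)) (𝓡 m) p x :=
    h.smooth.contMDiffAt.mdifferentiableAt infty_ne_zero
  have h3 := mfderiv_comp_apply_of_eq (0 : ℝ) h2 h1 h0 (1 : ℝ)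
  have h4 : p ∘ (fun t : ℝ => Circle.exp (2 * Real.pi * t) • x) = fun _ => p x :=
    funext fun t => h.invariant _ x
  rw [h4, mfderiv_const] at h3
  exact h3.symm

theorem IsPrincipalCircleBundle.projD_comp_actD
    (h : IsPrincipalCircleBundle (n := m + 1) (n' := m) p) (z : Circle) (x : P) :
    (projD p (z • x)).comp (actD (m := m) z x) = projD p x := by
  have h1 : MDifferentiableAt (𝓡 (m + 1)) (𝓡 (m + 1)) (fun x : P => z • x) x :=
    (h.contMDiff_smul z).contMDiffAt.mdifferentiableAt infty_ne_zero
  have h2 : MDifferentiableAt (𝓡 (m + 1)) (𝓡 m) p (z • x) :=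
    h.smooth.contMDiffAt.mdifferentiableAt infty_ne_zero
  have h3 := mfderiv_comp x h2 h1
  have h4 : p ∘ (fun x : P => z • x) = p := funext fun y => h.invariant z y
  rw [h4] at h3
  exact congrArg ContinuousLinearMap.toLinearMap h3.symm

theorem IsPrincipalCircleBundle.actD_comp_actD
    (h : IsPrincipalCircleBundle (n := m + 1) (n' := m) p) (z : Circle) (x : P) :
    (actD (m := m) z⁻¹ (z • x)).comp (actD (m := m) z x) = LinearMap.id := by
  have h1 : MDifferentiableAt (𝓡 (m + 1)) (𝓡 (m + 1)) (fun x : P => z • x) x :=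
    (h.contMDiff_smul z).contMDiffAt.mdifferentiableAt infty_ne_zero
  have h2 : MDifferentiableAt (𝓡 (m + 1)) (𝓡 (m + 1)) (fun x : P => z⁻¹ • x) (z • x) :=
    (h.contMDiff_smul z⁻¹).contMDiffAt.mdifferentiableAt infty_ne_zero
  have h3 := mfderiv_comp x h2 h1
  have h4 : (fun x : P => z⁻¹ • x) ∘ (fun x : P => z • x) = id :=
    funext fun y => inv_smul_smul z y
  rw [h4, mfderiv_id] at h3
  exact congrArg ContinuousLinearMap.toLinearMap h3.symm

/-- The differential of the action is an equivalence. -/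
theorem IsPrincipalCircleBundle.exists_actD_equiv
    (h : IsPrincipalCircleBundle (n := m + 1) (n' := m) p) (z : Circle) (x : P) :
    ∃ f : Euc (m + 1) ≃ₗ[ℝ] Euc (m + 1), f.toLinearMap = actD (m := m) z x := by
  have h1 : Function.Injective (actD (m := m) z x) :=
    (Function.LeftInverse.injective (g := actD (m := m) z⁻¹ (z • x))
      fun v => LinearMap.congr_fun (h.actD_comp_actD z x) v)
  exact ⟨LinearEquiv.ofInjectiveEndo _ h1, LinearMap.ext fun _ => rfl⟩

/-- A local section is translated by a fixed group element so that it passes through `x`. -/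
theorem IsPrincipalCircleBundle.exists_section
    (h : IsPrincipalCircleBundle (n := m + 1) (n' := m) p) (x : P) :
    ∃ σ : M → P, ContMDiffAt (𝓡 m) (𝓡 (m + 1)) ∞ σ (p x) ∧ σ (p x) = x ∧
      ∀ᶠ b in 𝓝 (p x), p (σ b) = b := by
  obtain ⟨U, hU, hb, s, c, hs, -, hps, -, hcs⟩ := h.locally_trivial (p x)
  refine ⟨fun b => c x • s b, ?_, hcs x hb, ?_⟩
  · exact (h.contMDiff_smul (c x)).contMDiffAt.comp (p x) (hs.contMDiffAt (hU.mem_nhds hb))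
  · filter_upwards [hU.mem_nhds hb] with b hb'
    rw [h.invariant, hps b hb']

theorem IsPrincipalCircleBundle.surjective
    (h : IsPrincipalCircleBundle (n := m + 1) (n' := m) p) : Function.Surjective p := fun b => by
  obtain ⟨U, -, hb, s, -, -, -, hps, -⟩ := h.locally_trivial b
  exact ⟨s b, hps b hb⟩

theorem IsPrincipalCircleBundle.exists_smul_eq
    (h : IsPrincipalCircleBundle (n := m + 1) (n' := m) p) {x y : P} (hxy : p x = p y) :
    ∃ z : Circle, z • x = y := by
  obtain ⟨U, -, hb, s, c, -, -, -, -, hcs⟩ := h.locally_trivial (p x)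
  refine ⟨c y * (c x)⁻¹, ?_⟩
  have h1 := hcs x hb
  have h2 := hcs y (show p y ∈ U from hxy ▸ hb)
  rw [← hxy] at h2
  rw [mul_smul]
  conv_lhs => rw [← h1]
  conv_rhs => rw [← h2]
  congr 1
  have h3 : c (c x • s (p x)) = c x := by rw [h1]
  rw [h3, inv_smul_smul]

theorem IsPrincipalCircleBundle.projD_surjective
    (h : IsPrincipalCircleBundle (n := m + 1) (n' := m) p) (x : P) :
    Function.Surjective (projD (m := m) p x) := by
  obtain ⟨σ, hσ, hx, hp⟩ := h.exists_section x
  have h1 : MDifferentiableAt (𝓡 m) (𝓡 (m + 1)) σ (p x) := hσ.mdifferentiableAt infty_ne_zero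
  have h2 : MDifferentiableAt (𝓡 (m + 1)) (𝓡 m) p x :=
    h.smooth.contMDiffAt.mdifferentiableAt infty_ne_zero
  intro w
  have h3 := mfderiv_comp_apply_of_eq (p x) h2 h1 hx w
  have h4 : p ∘ σ =ᶠ[𝓝 (p x)] id := hp
  rw [h4.mfderiv_eq, mfderiv_id] at h3
  exact ⟨_, h3.symm⟩

theorem IsConnectionForm.exists_covector {θ : MixedForm (m + 1) P} (h : IsConnectionForm θ) (x : P) :
    ∃ ϑ : Module.Dual ℝ (Euc (m + 1)), (θ x : Forms (Euc (m + 1))) = ExteriorAlgebra.ι ℝ ϑ ∧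
      ϑ (genVec (m := m) x) = 1 := by
  have h0 : ∃ ϑ : Module.Dual ℝ (Euc (m + 1)), (θ x : Forms (Euc (m + 1))) =
      ExteriorAlgebra.ι ℝ ϑ := mem_exteriorPower_one (V := Euc (m + 1)) (h.isForm.2 x)
  obtain ⟨ϑ, hϑ⟩ := h0
  refine ⟨ϑ, hϑ, ?_⟩
  have h1 : contract (V := Euc (m + 1)) (genVec (m := m) x) (θ x) = 1 := h.vertical x
  rw [hϑ] at h1
  rw [contract_ι] at h1
  exact (ExteriorAlgebra.algebraMap_inj _ _ _).1 (h1.trans (map_one _).symm)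

theorem finrank_euc_succ (m : ℕ) :
    Module.finrank ℝ (Euc (m + 1)) = Module.finrank ℝ (Euc m) + 1 := by simp

end Bundle

/-! ## T-duality at a point -/

section PointwiseTDuality

variable {m : ℕ} {M P Pt : Type*} [TopologicalSpace M] [TopologicalSpace P] [TopologicalSpace Pt]
  [ChartedSpace (EuclideanSpace ℝ (Fin m)) M]
  [ChartedSpace (EuclideanSpace ℝ (Fin (m + 1))) P]
  [ChartedSpace (EuclideanSpace ℝ (Fin (m + 1))) Pt]
  {p : P → M} {pt : Pt → M}
  {θ : MixedForm (m + 1) P} {θt : MixedForm (m + 1) Pt}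
  {F Ft : MixedForm m M}

theorem IsTDual.symm {ρ : MixedForm (m + 1) P} {ρt : MixedForm (m + 1) Pt}
    (h : IsTDual p pt θ θt ρ ρt) : IsTDual pt p θt θ ρt ρ := by
  obtain ⟨a, b, ha, hb, h1, h2⟩ := h
  exact ⟨b, a, hb, ha, h2, h1⟩

theorem IsTDualTorsion.symm {T : MixedForm (m + 1) P} {Tt : MixedForm (m + 1) Pt}
    (h : IsTDualTorsion p pt θ θt F Ft T Tt) : IsTDualTorsion pt p θt θ Ft F Tt T := by
  obtain ⟨T₀, h0, h1, h2⟩ := h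
  exact ⟨T₀, h0, h2, h1⟩

variable [MulAction Circle P] [MulAction Circle Pt]

theorem IsBundlePair.symm (h : IsBundlePair p pt θ θt F Ft) : IsBundlePair pt p θt θ Ft F :=
  ⟨h.bundle_t, h.bundle, h.connection_t, h.connection, h.isForm_t, h.isForm, h.curvature_t,
    h.curvature⟩

/-- Over each point of the base, T-duality is the composition of a reflection and an isomorphism
of the tangent spaces. -/
theorem IsBundlePair.exists_equiv (h : IsBundlePair p pt θ θt F Ft) {x : P} {y : Pt}
    (hxy : p x = pt y) : ∃ (f : Euc (m + 1) ≃ₗ[ℝ] Euc (m + 1)) (ϑ : Module.Dual ℝ (Euc (m + 1)))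
      (X : Euc (m + 1)), ϑ X = 1 ∧
      (∀ ρ ρt, IsTDual p pt θ θt ρ ρt →
        linPullback f.toLinearMap (vectorAction (Euc (m + 1)) (ϑ, X) (ρ x)) = ρt y) ∧
      ∀ (ν : MixedForm m M) (μ : MixedForm (m + 1) P) (μt : MixedForm (m + 1) Pt),
        μ = θ * pullback p ν → μt = θt * pullback pt ν →
        linPullback f.toLinearMap (μ x : Forms (Euc (m + 1))) = μt y := by
  obtain ⟨ϑ, hϑ, hX⟩ := h.connection.exists_covector x
  obtain ⟨ϑt, hϑt, hXt⟩ := h.connection_t.exists_covector y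
  obtain ⟨f, hf1, hf2⟩ := exists_equiv_of_splitting (finrank_euc_succ m) (finrank_euc_succ m)
    (h.bundle.projD_surjective x) (h.bundle.projD_genVec x) hX
    (h.bundle_t.projD_surjective y) (h.bundle_t.projD_genVec y) hXt
  have hpt : ∀ a : MixedForm m M, linPullback (projD pt y) (a (p x) : Forms (Euc m)) =
    linPullback (projD pt y) (a (pt y) : Forms (Euc m)) := fun a =>
      linPullback_congr_point hxy (projD pt y) a
  refine ⟨f, ϑ, _, hX, ?_, ?_⟩
  · rintro ρ ρt ⟨a, b, -, -, rfl, rfl⟩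
    have h1 := linPullback_vectorAction_of_splitting (h.bundle.projD_genVec x) hX f.toLinearMap
      (a (p x) : Forms (Euc m)) (b (p x) : Forms (Euc m))
    rw [hf1, hf2, hpt a, hpt b, ← hϑ, ← hϑt] at h1
    exact h1
  · rintro ν _ _ rfl rfl
    have h1 : ∀ a : Forms (Euc m), linPullback f.toLinearMap (ExteriorAlgebra.ι ℝ ϑ *
        linPullback (projD p x) a) = ExteriorAlgebra.ι ℝ ϑt * linPullback (projD pt y) a :=
      fun a => by rw [map_mul, linPullback_ι, linPullback_comp, hf1, hf2]
    have h1 := h1 (ν (p x))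
    rw [hpt, ← hϑ, ← hϑt] at h1
    exact h1

theorem IsTDual.mem_parityForms {ρ : MixedForm (m + 1) P} {ρt : MixedForm (m + 1) Pt}
    (h : IsBundlePair p pt θ θt F Ft) (hρ : IsTDual p pt θ θt ρ ρt) {ε : ZMod 2}
    (hε : ∀ x, ρ x ∈ parityForms (TangentSpace (𝓡 (m + 1)) x) ε) (y : Pt) :
    ρt y ∈ parityForms (TangentSpace (𝓡 (m + 1)) y) (ε + 1) := by
  obtain ⟨x, hx⟩ := h.bundle.surjective (pt y)
  obtain ⟨f, ϑ, X, -, h1, -⟩ := h.exists_equiv hx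
  have h2 := linPullback_mem_parityForms (V := Euc (m + 1)) (W := Euc (m + 1)) f.toLinearMap
    (vectorAction_mem_parityForms (ϑ, X) (hε x))
  rw [h1 ρ ρt hρ] at h2
  exact h2

theorem IsTDual.isG2Form {ρ : MixedForm (m + 1) P} {ρt : MixedForm (m + 1) Pt}
    (h : IsBundlePair p pt θ θt F Ft) (hρ : IsTDual p pt θ θt ρ ρt)
    (hG : ∀ x, IsG2Form (ρ x)) (y : Pt) : IsG2Form (ρt y) := by
  obtain ⟨x, hx⟩ := h.bundle.surjective (pt y)
  obtain ⟨f, ϑ, X, hX, h1, -⟩ := h.exists_equiv hx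
  have h2 := (SpinIso.ofEquiv f).isG2Form ((SpinIso.reflection (V := Euc (m + 1)) (ϑ, X) hX).isG2Form
    (hG x))
  change IsG2Form (linPullback f.toLinearMap (vectorAction (Euc (m + 1)) (ϑ, X) (ρ x))) at h2
  rw [h1 ρ ρt hρ] at h2
  exact h2

theorem IsTDual.isSpin7Form {ρ : MixedForm (m + 1) P} {ρt : MixedForm (m + 1) Pt}
    (h : IsBundlePair p pt θ θt F Ft) (hρ : IsTDual p pt θ θt ρ ρt)
    (hG : ∀ x, IsSpin7Form (ρ x)) (y : Pt) : IsSpin7Form (ρt y) := by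
  obtain ⟨x, hx⟩ := h.bundle.surjective (pt y)
  obtain ⟨f, ϑ, X, hX, h1, -⟩ := h.exists_equiv hx
  have h2 := (SpinIso.ofEquiv f).isSpin7Form
    ((SpinIso.reflection (V := Euc (m + 1)) (ϑ, X) hX).isSpin7Form (hG x))
  change IsSpin7Form (linPullback f.toLinearMap (vectorAction (Euc (m + 1)) (ϑ, X) (ρ x))) at h2
  rw [h1 ρ ρt hρ] at h2
  exact h2

/-- Each fibre of `Pᵗ` lies over a point that also has a preimage in `P`, where the reflection
reverses the orientation and the tangent space isomorphism matches `θ ∧ ν` with `θᵗ ∧ ν`. -/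
theorem IsTDual.isCompanion {ρ ρ' : MixedForm (m + 1) P} {ρt ρt' : MixedForm (m + 1) Pt}
    (h : IsBundlePair p pt θ θt F Ft) (hρ : IsTDual p pt θ θt ρ ρt)
    (hρ' : IsTDual p pt θ θt ρ' ρt') {ν : MixedForm m M}
    (hc : ∀ x, IsCompanion ((θ * pullback p ν : MixedForm (m + 1) P) x) (ρ x) (ρ' x)) (y : Pt) :
    IsCompanion ((-(θt * pullback pt ν) : MixedForm (m + 1) Pt) y) (ρt y) (ρt' y) := by
  obtain ⟨x, hx⟩ := h.bundle.surjective (pt y)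
  obtain ⟨f, ϑ, X, hX, h1, h2⟩ := h.exists_equiv hx
  have h4 : ∀ {μ r r' : Forms (Euc (m + 1))}, IsCompanion μ r r' →
      IsCompanion (-linPullback f.toLinearMap μ)
        (linPullback f.toLinearMap (vectorAction (Euc (m + 1)) (ϑ, X) r))
        (linPullback f.toLinearMap (vectorAction (Euc (m + 1)) (ϑ, X) r')) := fun h => by
    rw [← map_neg]
    exact (h.vectorAction hX).linPullback f
  have h3 := h4 (hc x)
  rw [h1 ρ ρt hρ, h1 ρ' ρt' hρ', h2 ν _ _ rfl rfl] at h3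
  exact h3

end PointwiseTDuality

/-! ## T-duality and the twisted differential -/

section SmoothForms

variable {n n' : ℕ} {N N' : Type*} [TopologicalSpace N] [TopologicalSpace N']
  [ChartedSpace (EuclideanSpace ℝ (Fin n)) N] [ChartedSpace (EuclideanSpace ℝ (Fin n')) N']
  [IsManifold (𝓡 n) ∞ N] [IsManifold (𝓡 n') ∞ N'] {α β : MixedForm n N}

theorem IsSmoothForm.add (hα : IsSmoothForm α) (hβ : IsSmoothForm β) : IsSmoothForm (α + β) :=
  isSmoothForm_iff.2 fun x => (isSmoothForm_iff.1 hα x).add (isSmoothForm_iff.1 hβ x)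

theorem IsSmoothForm.mul (hα : IsSmoothForm α) (hβ : IsSmoothForm β) : IsSmoothForm (α * β) :=
  isSmoothForm_iff.2 fun x => (isSmoothForm_iff.1 hα x).mul (isSmoothForm_iff.1 hβ x)

theorem IsSmoothForm.neg (hα : IsSmoothForm α) : IsSmoothForm (-α) :=
  isSmoothForm_iff.2 fun x => (isSmoothForm_iff.1 hα x).neg

theorem IsSmoothForm.smul (c : ℝ) (hα : IsSmoothForm α) : IsSmoothForm (c • α) :=
  isSmoothForm_iff.2 fun x => (isSmoothForm_iff.1 hα x).smul c

theorem IsSmoothForm.extD (hα : IsSmoothForm α) : IsSmoothForm (extD α) :=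
  isSmoothForm_iff.2 fun x => SmoothFormAt.extD (isSmoothForm_iff.1 hα) x

theorem IsSmoothForm.pullback {f : N → N'} (hf : ContMDiff (𝓡 n) (𝓡 n') ∞ f) {α : MixedForm n' N'}
    (hα : IsSmoothForm α) : IsSmoothForm (GenGeom.pullback (n := n) f α) :=
  isSmoothForm_iff.2 fun _ => SmoothFormAt.pullback hf.contMDiffAt (isSmoothForm_iff.1 hα _)

theorem pullback_smul (f : N → N') (c : ℝ) (α : MixedForm n' N') :
    pullback (n := n) f (c • α) = c • pullback f α := funext fun x =>
  map_smul (linPullback (mfderiv (𝓡 n) (𝓡 n') f x).toLinearMap) c (α (f x))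

theorem extD_pullback_eq {f : N → N'} (hf : ContMDiff (𝓡 n) (𝓡 n') ∞ f) {α : MixedForm n' N'}
    (hα : IsSmoothForm α) : extD (pullback (n := n) f α) = pullback f (extD α) :=
  funext fun _ => extD_pullback hf.contMDiffAt (isSmoothForm_iff.1 hα _)

theorem extD_one_form_mul {θ : MixedForm n N} (hθ : IsForm 1 θ) (hα : IsSmoothForm α) :
    extD (θ * α) = extD θ * α - θ * extD α := by
  funext x
  refine (extD_mul (isSmoothForm_iff.1 hθ.1 x) (isSmoothForm_iff.1 hα x)).trans ?_
  obtain ⟨ξ, hξ⟩ := mem_exteriorPower_one (hθ.2 x)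
  have h1 : CliffordAlgebra.involute (θ x) = -θ x := by rw [hξ]; exact involute_ι_form ξ
  rw [h1, neg_mul, ← sub_eq_add_neg]
  rfl

end SmoothForms

/-! ### The twisted differential in terms of components on the base -/

section TwistedDifferential

variable {m : ℕ} {M P Pt : Type*} [TopologicalSpace M] [TopologicalSpace P] [TopologicalSpace Pt]
  [ChartedSpace (EuclideanSpace ℝ (Fin m)) M]
  [ChartedSpace (EuclideanSpace ℝ (Fin (m + 1))) P]
  [ChartedSpace (EuclideanSpace ℝ (Fin (m + 1))) Pt]
  [MulAction Circle P] [MulAction Circle Pt] {p : P → M} {pt : Pt → M}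
  {θ : MixedForm (m + 1) P} {θt : MixedForm (m + 1) Pt}
  {F Ft : MixedForm m M}

theorem IsPrincipalCircleBundle.mul_pullback_add_pullback_inj
    (h : IsPrincipalCircleBundle (n := m + 1) (n' := m) p) (hθ : IsConnectionForm θ)
    {a b a' b' : MixedForm m M}
    (he : θ * pullback p a + pullback p b = θ * pullback p a' + pullback p b') :
    a = a' ∧ b = b' := by
  have key : ∀ x, a (p x) = a' (p x) ∧ b (p x) = b' (p x) := fun x => by
    obtain ⟨ϑ, hϑ, hX⟩ := hθ.exists_covector x
    have h1 : ∀ τ : Forms (Euc (m + 1)), τ = ExteriorAlgebra.ι ℝ ϑ → ∀ a b a' b' : Forms (Euc m),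
        τ * linPullback (projD p x) a + linPullback (projD p x) b =
          τ * linPullback (projD p x) a' + linPullback (projD p x) b' → a = a' ∧ b = b' := by
      rintro _ rfl a b a' b' h1
      exact ι_mul_add_linPullback_inj (h.projD_surjective x) (h.projD_genVec x) hX h1
    exact h1 _ hϑ _ _ _ _ (congrFun he x)
  constructor <;> funext b₀ <;> obtain ⟨x, rfl⟩ := h.surjective b₀
  · exact (key x).1
  · exact (key x).2

theorem one_form_mul_self {n : ℕ} {N : Type*} [TopologicalSpace N]
    [ChartedSpace (EuclideanSpace ℝ (Fin n)) N] {θ : MixedForm n N} (hθ : IsForm 1 θ) :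
    θ * θ = 0 := funext fun x => by
  obtain ⟨ξ, hξ⟩ := mem_exteriorPower_one (hθ.2 x)
  have h1 : θ x * θ x = 0 := by rw [hξ]; exact ExteriorAlgebra.ι_sq_zero ξ
  exact h1

theorem involute_three_form {V : Type*} [AddCommGroup V] [Module ℝ V] {α : Forms V}
    (hα : α ∈ ⋀[ℝ]^3 (Module.Dual ℝ V)) : CliffordAlgebra.involute α = -α := by
  rw [ExteriorAlgebra.exteriorPower, pow_succ] at hα
  induction hα using Submodule.mul_induction_on' with
  | mem_mul_mem β hβ γ hγ =>
    obtain ⟨ξ, rfl⟩ := hγ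
    have h1 : CliffordAlgebra.involute β = β := by
      refine exteriorPower_two_induction (C := fun β => CliffordAlgebra.involute β = β)
        (fun x y hx hy => by rw [map_add, hx, hy]) (fun ξ η => ?_) hβ
      rw [map_mul, involute_ι_form, involute_ι_form, neg_mul_neg]
    rw [map_mul, h1, involute_ι_form, mul_neg]
  | add x _ y _ hx hy => rw [map_add, hx, hy, neg_add]

theorem one_form_mul_pullback_three_form (hθ : IsForm 1 θ) {T₀ : MixedForm m M} (hT : IsForm 3 T₀) :
    pullback p T₀ * θ = -(θ * pullback p T₀) := funext fun x => by
  obtain ⟨ξ, hξ⟩ := mem_exteriorPower_one (hθ.2 x)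
  have h1 : ∀ α : Forms (Euc m), α ∈ ⋀[ℝ]^3 (Module.Dual ℝ (Euc m)) →
      ∀ (τ : Forms (Euc (m + 1))) (ξ : Module.Dual ℝ (Euc (m + 1))), τ = ExteriorAlgebra.ι ℝ ξ →
      linPullback (projD p x) α * τ = -(τ * linPullback (projD p x) α) := by
    rintro α hα _ ξ rfl
    rw [involute_mul_ι, involute_linPullback, involute_three_form hα, map_neg, neg_mul, neg_neg]
  exact h1 _ (hT.2 (p x)) _ ξ hξ

theorem pullback_two_form_commute {F : MixedForm m M} (hF : IsForm 2 F) (α : MixedForm (m + 1) P) :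
    pullback p F * α = α * pullback p F := funext fun x =>
  exteriorPower_two_commute (V := Euc (m + 1))
    (linPullback_mem_exteriorPower (projD p x) (hF.2 (p x))) (α x)

variable [IsManifold (𝓡 m) ∞ M] [IsManifold (𝓡 (m + 1)) ∞ P] [IsManifold (𝓡 (m + 1)) ∞ Pt]

theorem IsBundlePair.extD_mul_pullback_add_pullback (h : IsBundlePair p pt θ θt F Ft)
    {a b : MixedForm m M} (ha : IsSmoothForm a) (hb : IsSmoothForm b) :
    extD (θ * pullback p a + pullback p b) =
      θ * pullback p (-extD a) + pullback p (F * a + extD b) := by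
  have hpa : IsSmoothForm (pullback (n := m + 1) p a) := ha.pullback h.bundle.smooth
  have hpb : IsSmoothForm (pullback (n := m + 1) p b) := hb.pullback h.bundle.smooth
  have h1 : extD (θ * pullback p a + pullback p b) =
      extD (θ * pullback p a) + extD (pullback p b) := funext fun x =>
    extD_add (isSmoothForm_iff.1 (h.connection.isForm.1.mul hpa) x) (isSmoothForm_iff.1 hpb x)
  rw [h1, extD_one_form_mul h.connection.isForm hpa, extD_pullback_eq h.bundle.smooth ha,
    extD_pullback_eq h.bundle.smooth hb, h.curvature, pullback_add, pullback_mul, pullback_neg]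
  noncomm_ring

/-- The curvature enters the second component through `dθ = F`, and `Fᵗ` enters the first through
`T`. The term `θ ∧ Fᵗ ∧ θ ∧ a` vanishes, and moving the 3-form past `θ` gives the sign that groups
`T₀ ∧ a` with `da`. -/
theorem IsBundlePair.twistedD_eq (h : IsBundlePair p pt θ θt F Ft) {T₀ : MixedForm m M}
    (hT : IsForm 3 T₀) {a b : MixedForm m M} (ha : IsSmoothForm a) (hb : IsSmoothForm b) :
    twistedD (-(θ * pullback p Ft) + pullback p T₀) (θ * pullback p a + pullback p b) =
      θ * pullback p (-(extD a + Ft * b + T₀ * a)) + pullback p (extD b + F * a + T₀ * b) := by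
  have h1 : θ * pullback p Ft * θ = 0 := by
    rw [mul_assoc, pullback_two_form_commute h.isForm_t, ← mul_assoc,
      one_form_mul_self h.connection.isForm, zero_mul]
  have h2 := one_form_mul_pullback_three_form (p := p) h.connection.isForm hT
  have h3 : (-(θ * pullback p Ft) + pullback p T₀) * (θ * pullback p a + pullback p b) =
      -(θ * pullback p Ft * θ * pullback p a) - θ * pullback p Ft * pullback p b +
        pullback p T₀ * θ * pullback p a + pullback p T₀ * pullback p b := by noncomm_ring
  rw [twistedD, h.extD_mul_pullback_add_pullback ha hb, h3, h1, h2]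
  simp only [pullback_add, pullback_mul, pullback_neg]
  noncomm_ring

/-- The formula for the components is symmetric under exchange of the two bundles except for the
sign of the `θ`-component; that sign later becomes the sign of the Killing number. -/
theorem IsBundlePair.isTDual_twistedD (h : IsBundlePair p pt θ θt F Ft)
    {T : MixedForm (m + 1) P} {Tt : MixedForm (m + 1) Pt}
    (hT : IsTDualTorsion p pt θ θt F Ft T Tt) {ρ : MixedForm (m + 1) P} {ρt : MixedForm (m + 1) Pt}
    (hρ : IsTDual p pt θ θt ρ ρt) : IsTDual p pt θ θt (twistedD T ρ) (-twistedD Tt ρt) := by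
  obtain ⟨T₀, hT₀, rfl, rfl⟩ := hT
  obtain ⟨a, b, ha, hb, rfl, rfl⟩ := hρ
  refine ⟨-(extD a + Ft * b + T₀ * a), extD b + F * a + T₀ * b,
    ((ha.extD.add (h.isForm_t.1.mul hb)).add (hT₀.1.mul ha)).neg,
    (hb.extD.add (h.isForm.1.mul ha)).add (hT₀.1.mul hb), h.twistedD_eq hT₀ ha hb, ?_⟩
  rw [h.symm.twistedD_eq hT₀ hb ha]
  simp only [pullback_neg]
  noncomm_ring

theorem IsTDual.smul {ρ : MixedForm (m + 1) P} {ρt : MixedForm (m + 1) Pt}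
    (h : IsTDual p pt θ θt ρ ρt) (c : ℝ) : IsTDual p pt θ θt (c • ρ) (c • ρt) := by
  obtain ⟨a, b, ha, hb, rfl, rfl⟩ := h
  refine ⟨c • a, c • b, ha.smul c, hb.smul c, ?_, ?_⟩
  · rw [pullback_smul, pullback_smul, smul_add, mul_smul_comm]
  · rw [pullback_smul, pullback_smul, smul_add, mul_smul_comm]

theorem IsTDual.isSmoothForm {ρ : MixedForm (m + 1) P} {ρt : MixedForm (m + 1) Pt}
    (h : IsBundlePair p pt θ θt F Ft) (hρ : IsTDual p pt θ θt ρ ρt) : IsSmoothForm ρ := by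
  obtain ⟨a, b, ha, hb, rfl, -⟩ := hρ
  exact (h.connection.isForm.1.mul (ha.pullback h.bundle.smooth)).add
    (hb.pullback h.bundle.smooth)

theorem IsTDual.eq_zero {ρt : MixedForm (m + 1) Pt} (h : IsBundlePair p pt θ θt F Ft)
    (hρ : IsTDual p pt θ θt 0 ρt) : ρt = 0 := by
  obtain ⟨a, b, -, -, h0, rfl⟩ := hρ
  have h1 : θ * pullback p (0 : MixedForm m M) + pullback p (0 : MixedForm m M) =
      θ * pullback p a + pullback p b := by
    rw [← h0, pullback_zero, mul_zero, add_zero]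
  obtain ⟨rfl, rfl⟩ := h.bundle.mul_pullback_add_pullback_inj h.connection h1
  rw [pullback_zero, mul_zero, add_zero]

/-- `d²θ = 0`, and pullback to the bundle is injective. -/
theorem IsBundlePair.extD_curvature (h : IsBundlePair p pt θ θt F Ft) : extD F = 0 := by
  have h1 := extD_extD (isSmoothForm_iff.1 h.connection.isForm.1)
  rw [h.curvature, extD_pullback_eq h.bundle.smooth h.isForm.1] at h1
  have h2 : θ * pullback p (0 : MixedForm m M) + pullback p (extD F) =
      θ * pullback p (0 : MixedForm m M) + pullback p (0 : MixedForm m M) := by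
    rw [h1, pullback_zero]
  exact (h.bundle.mul_pullback_add_pullback_inj h.connection h2).2

/-- As `Fᵗ` is closed, `dT` has no `θ`-component and equals the pullback of `dT₀ - F ∧ Fᵗ`. Since
2-forms commute, the criterion is symmetric in the two bundles. -/
theorem IsBundlePair.isClosedThreeForm_iff (h : IsBundlePair p pt θ θt F Ft) {T₀ : MixedForm m M}
    (hT : IsForm 3 T₀) : IsClosedThreeForm (-(θ * pullback p Ft) + pullback p T₀) ↔
      extD T₀ = F * Ft := by
  have h0 : -(θ * pullback p Ft) + pullback p T₀ = θ * pullback p (-Ft) + pullback p T₀ := by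
    rw [pullback_neg, mul_neg]
  have hd : extD (θ * pullback p (-Ft) + pullback p T₀) =
      θ * pullback p (0 : MixedForm m M) + pullback p (extD T₀ - F * Ft) := by
    have h1 : extD (-Ft) = 0 := funext fun x => by
      rw [extD_neg (isSmoothForm_iff.1 h.isForm_t.1 x), h.symm.extD_curvature]
      exact neg_zero
    rw [h.extD_mul_pullback_add_pullback h.isForm_t.1.neg hT.1, h1, neg_zero, mul_neg,
      neg_add_eq_sub]
  rw [h0]
  constructor
  · rintro ⟨-, h1⟩
    have h2 : θ * pullback p (0 : MixedForm m M) + pullback p (extD T₀ - F * Ft) =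
        θ * pullback p (0 : MixedForm m M) + pullback p (0 : MixedForm m M) := by
      rw [← hd, h1, pullback_zero, mul_zero, add_zero]
    exact sub_eq_zero.1 (h.bundle.mul_pullback_add_pullback_inj h.connection h2).2
  · intro h1
    refine ⟨⟨(h.connection.isForm.1.mul (h.isForm_t.1.neg.pullback h.bundle.smooth)).add
      (hT.1.pullback h.bundle.smooth), fun x => ?_⟩, ?_⟩
    · have h2 : ∀ α : Forms (Euc m), α ∈ ⋀[ℝ]^2 (Module.Dual ℝ (Euc m)) →
          ∀ β : Forms (Euc m), β ∈ ⋀[ℝ]^3 (Module.Dual ℝ (Euc m)) →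
          ∀ τ : Forms (Euc (m + 1)), τ ∈ ⋀[ℝ]^1 (Module.Dual ℝ (Euc (m + 1))) →
          τ * linPullback (projD p x) α + linPullback (projD p x) β ∈
            ⋀[ℝ]^3 (Module.Dual ℝ (Euc (m + 1))) := fun α hα β hβ τ hτ =>
        add_mem (mul_mem_exteriorPower hτ (linPullback_mem_exteriorPower _ hα))
          (linPullback_mem_exteriorPower _ hβ)
      exact h2 _ (neg_mem (h.isForm_t.2 (p x))) _ (hT.2 (p x)) _ (h.connection.isForm.2 x)
    · rw [hd, h1, sub_self, pullback_zero, mul_zero, add_zero]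

theorem IsBundlePair.isClosedThreeForm (h : IsBundlePair p pt θ θt F Ft)
    {T : MixedForm (m + 1) P} {Tt : MixedForm (m + 1) Pt}
    (hT : IsTDualTorsion p pt θ θt F Ft T Tt) (hc : IsClosedThreeForm T) :
    IsClosedThreeForm Tt := by
  obtain ⟨T₀, hT₀, rfl, rfl⟩ := hT
  have h1 : F * Ft = Ft * F := funext fun b =>
    exteriorPower_two_commute (V := Euc m) (h.isForm.2 b) (Ft b)
  rw [h.symm.isClosedThreeForm_iff hT₀, ← h1]
  exact (h.isClosedThreeForm_iff hT₀).1 hc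

end TwistedDifferential

/-! ## Invariant forms descend to the base -/

section Descent

open Filter Topology

variable {m : ℕ} {M P : Type*} [TopologicalSpace M] [TopologicalSpace P]
  [ChartedSpace (EuclideanSpace ℝ (Fin m)) M]
  [ChartedSpace (EuclideanSpace ℝ (Fin (m + 1))) P] [MulAction Circle P] {p : P → M}
  {θ : MixedForm (m + 1) P}

theorem IsPrincipalCircleBundle.linPullback_actD
    (h : IsPrincipalCircleBundle (n := m + 1) (n' := m) p) (hθ : IsConnectionForm θ)
    {a b : MixedForm m M} {ρ : MixedForm (m + 1) P} (hρ : ρ = θ * pullback p a + pullback p b)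
    (z : Circle) (x : P) :
    linPullback (actD (m := m) z x) (ρ (z • x)) = (ρ x : Forms (Euc (m + 1))) := by
  subst hρ
  have h1 : linPullback (actD (m := m) z x) (θ (z • x)) = (θ x : Forms (Euc (m + 1))) :=
    congrFun (hθ.invariant z) x
  have h2 : ∀ a : MixedForm m M, linPullback (projD p x) (a (p (z • x)) : Forms (Euc m)) =
      linPullback (projD p x) (a (p x) : Forms (Euc m)) := fun a =>
    linPullback_congr_point (h.invariant z x) (projD p x) a
  have h3 : ∀ (τ τ' : Forms (Euc (m + 1))) (a b : Forms (Euc m)),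
      linPullback (actD (m := m) z x) τ = τ' →
      linPullback (actD (m := m) z x) (τ * linPullback (projD p (z • x)) a +
        linPullback (projD p (z • x)) b) =
      τ' * linPullback (projD p x) a + linPullback (projD p x) b := by
    rintro τ _ a b rfl
    rw [map_add, map_mul, linPullback_comp, linPullback_comp, h.projD_comp_actD]
  have h4 := h3 (θ (z • x)) (θ x) (a (p (z • x))) (b (p (z • x))) h1
  rw [h2 a, h2 b] at h4
  exact h4

/-- At each point the components exist by linear algebra. Invariance of `ρ` and `θ` together with
uniqueness of the components makes them constant along orbits, which are the fibres. -/
theorem IsPrincipalCircleBundle.exists_eq_mul_pullback_add_pullback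
    (h : IsPrincipalCircleBundle (n := m + 1) (n' := m) p) (hθ : IsConnectionForm θ)
    {ρ : MixedForm (m + 1) P}
    (hρ : ∀ (z : Circle) (x : P),
      linPullback (actD (m := m) z x) (ρ (z • x)) = (ρ x : Forms (Euc (m + 1)))) :
    ∃ a b : MixedForm m M, ρ = θ * pullback p a + pullback p b := by
  have h1 : ∀ x, ∃ a b : Forms (Euc m), ∀ τ r : Forms (Euc (m + 1)), τ = θ x → r = ρ x →
      r = τ * linPullback (projD p x) a + linPullback (projD p x) b := fun x => by
    obtain ⟨ϑ, hϑ, hX⟩ := hθ.exists_covector x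
    obtain ⟨a, b, hab⟩ := exists_eq_ι_mul_add_linPullback (finrank_euc_succ m)
      (h.projD_surjective x) (h.projD_genVec x) hX (ρ x)
    refine ⟨a, b, ?_⟩
    rintro τ r hτ rfl
    rw [hτ.trans hϑ]
    exact hab
  choose A B hAB using h1
  have h2 : ∀ (z : Circle) (x : P), A x = A (z • x) ∧ B x = B (z • x) := fun z x => by
    obtain ⟨ϑ, hϑ, hX⟩ := hθ.exists_covector x
    have h3 : linPullback (actD (m := m) z x) (θ (z • x)) = (θ x : Forms (Euc (m + 1))) :=
      congrFun (hθ.invariant z) x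
    refine ι_mul_add_linPullback_inj (h.projD_surjective x) (h.projD_genVec x) hX ?_
    have h4 : ∀ τ r τ' r' : Forms (Euc (m + 1)), τ = θ x → r = ρ x → τ' = θ (z • x) →
        r' = ρ (z • x) → linPullback (actD (m := m) z x) τ' = τ →
        linPullback (actD (m := m) z x) r' = r →
        τ * linPullback (projD p x) (A x) + linPullback (projD p x) (B x) =
        τ * linPullback (projD p x) (A (z • x)) + linPullback (projD p x) (B (z • x)) := by
      intro τ r τ' r' hτ hr hτ' hr' e1 e2
      rw [← hAB x τ r hτ hr, ← e2, hAB (z • x) τ' r' hτ' hr', map_add, map_mul, e1,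
        linPullback_comp, linPullback_comp, h.projD_comp_actD]
    have h5 := h4 _ _ _ _ rfl rfl rfl rfl h3 (hρ z x)
    rw [hϑ] at h5
    exact h5
  have h3 : ∀ x, A (Function.surjInv h.surjective (p x)) = A x ∧
      B (Function.surjInv h.surjective (p x)) = B x := fun x => by
    obtain ⟨z, hz⟩ := h.exists_smul_eq (Function.surjInv_eq h.surjective (p x)).symm
    rw [← hz]
    exact ⟨(h2 z x).1.symm, (h2 z x).2.symm⟩
  refine ⟨fun y => A (Function.surjInv h.surjective y), fun y => B (Function.surjInv h.surjective y),
    funext fun x => ?_⟩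
  have h4 := hAB x _ _ rfl rfl
  rw [← (h3 x).1, ← (h3 x).2] at h4
  exact h4

/-- The contraction with the generator of the action. -/
def contractGenerator (ρ : MixedForm (m + 1) P) : MixedForm (m + 1) P :=
  fun x => contract (generator x) (ρ x)

theorem IsPrincipalCircleBundle.contractGenerator_eq
    (h : IsPrincipalCircleBundle (n := m + 1) (n' := m) p) (hθ : IsConnectionForm θ)
    (a b : MixedForm m M) :
    contractGenerator (θ * pullback p a + pullback p b) = pullback p a := funext fun x => by
  obtain ⟨ϑ, hϑ, hX⟩ := hθ.exists_covector x
  have h1 : ∀ (τ : Forms (Euc (m + 1))) (a b : Forms (Euc m)), τ = ExteriorAlgebra.ι ℝ ϑ →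
      contract (genVec (m := m) x) (τ * linPullback (projD p x) a + linPullback (projD p x) b) =
        linPullback (projD p x) a := by
    rintro _ a b rfl
    exact contract_ι_mul_add_linPullback (h.projD_genVec x) hX a b
  exact h1 _ _ _ hϑ

variable [IsManifold (𝓡 m) ∞ M] [IsManifold (𝓡 (m + 1)) ∞ P]

/-- Locally `a` is the pullback of `p^* a` along a smooth section. -/
theorem IsPrincipalCircleBundle.isSmoothForm_of_pullback
    (h : IsPrincipalCircleBundle (n := m + 1) (n' := m) p) {a : MixedForm m M}
    (ha : IsSmoothForm (pullback (n := m + 1) p a)) : IsSmoothForm a := by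
  refine isSmoothForm_iff.2 fun b => ?_
  obtain ⟨x, rfl⟩ := h.surjective b
  obtain ⟨σ, hσ, hx, hp⟩ := h.exists_section x
  have h1 : SmoothFormAt (pullback (n := m) (n' := m + 1) σ (pullback p a)) (p x) :=
    SmoothFormAt.pullback hσ (isSmoothForm_iff.1 ha _)
  refine h1.congr ?_
  filter_upwards [contMDiffAt_eventually_one hσ, hp.eventually_nhds] with b hb hpb
  have h2 : MDifferentiableAt (𝓡 (m + 1)) (𝓡 m) p (σ b) :=
    h.smooth.contMDiffAt.mdifferentiableAt infty_ne_zero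
  refine (pullback_comp h2 (hb.mdifferentiableAt one_ne_zero) a).symm.trans ?_
  exact (pullback_congr (g := id) hpb a).trans (pullback_id a b)

theorem IsPrincipalCircleBundle.exists_chart_generator
    (h : IsPrincipalCircleBundle (n := m + 1) (n' := m) p) (x₀ : P) :
    ∃ V : Euc (m + 1) → Euc (m + 1), ContDiffAt ℝ ∞ V (extChartAt (𝓡 (m + 1)) x₀ x₀) ∧
      ∀ᶠ y in 𝓝 (extChartAt (𝓡 (m + 1)) x₀ x₀),
        mfderiv (𝓡 (m + 1)) (𝓡 (m + 1)) (extChartAt (𝓡 (m + 1)) x₀).symm y (V y) =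
          generator (n := m + 1) ((extChartAt (𝓡 (m + 1)) x₀).symm y) := by
  set ψ := extChartAt (𝓡 (m + 1)) x₀ with hψ
  -- `G` is the flow of the circle action in the chart. Its time derivative at `0` is the coordinate
  -- expression of the generator, hence smooth in `y`.
  set G : ℝ × Euc (m + 1) → Euc (m + 1) := fun q =>
    ψ (Circle.exp (2 * Real.pi * q.1) • ψ.symm q.2) with hG
  have h0 : ∀ x : P, Circle.exp (2 * Real.pi * 0) • x = x := fun x => by simp
  have hGs : ∀ y ∈ ψ.target, ContDiffAt ℝ ∞ G (0, y) := fun y hy => by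
    rw [← contMDiffAt_iff_contDiffAt]
    have h1 : ContMDiffAt 𝓘(ℝ, ℝ × Euc (m + 1)) (𝓘(ℝ, ℝ).prod (𝓡 (m + 1))) ∞
        (fun q : ℝ × Euc (m + 1) => (q.1, ψ.symm q.2)) (0, y) :=
      contDiff_fst.contDiffAt.contMDiffAt.prodMk
        ((contMDiffAt_chart_symm x₀ hy).comp (0, y) contDiff_snd.contDiffAt.contMDiffAt)
    have h2 := h.contMDiff_flow.contMDiffAt.comp (0, y) h1
    refine ContMDiffAt.comp (0, y) (contMDiffAt_chart ?_) h2
    change Circle.exp (2 * Real.pi * 0) • ψ.symm y ∈ ψ.source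
    rw [h0]
    exact ψ.map_target hy
  refine ⟨fun y => fderiv ℝ G (0, y) (1, 0), ?_, ?_⟩
  · have h1 : ContDiffAt ℝ ∞ (fderiv ℝ G) (0, ψ x₀) :=
      (hGs _ (mem_extChartAt_target x₀)).fderiv_right (m := ∞) (by simp)
    exact (h1.comp (ψ x₀) (contDiffAt_const.prodMk contDiffAt_id)).clm_apply contDiffAt_const
  · filter_upwards [extChartAt_target_mem_nhds (I := 𝓡 (m + 1)) x₀] with y hy
    set x := ψ.symm y with hx
    have hxs : x ∈ ψ.source := ψ.map_target hy
    have h1 : MDifferentiableAt 𝓘(ℝ, ℝ) (𝓡 (m + 1))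
        (fun t : ℝ => Circle.exp (2 * Real.pi * t) • x) 0 :=
      (h.contMDiff_orbit x).contMDiffAt.mdifferentiableAt infty_ne_zero
    have h2 : MDifferentiableAt (𝓡 (m + 1)) (𝓡 (m + 1)) ψ x :=
      (contMDiffAt_chart hxs).mdifferentiableAt infty_ne_zero
    have h3 := mfderiv_comp_apply_of_eq (0 : ℝ) h2 h1 (h0 x) (1 : ℝ)
    have h4 : HasFDerivAt (fun t : ℝ => G (t, y))
        ((fderiv ℝ G (0, y)).comp (ContinuousLinearMap.inl ℝ ℝ (Euc (m + 1)))) 0 :=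
      HasFDerivAt.comp (g := G) (f := fun t : ℝ => (t, y)) (0 : ℝ)
        ((hGs y hy).differentiableAt infty_ne_zero).hasFDerivAt (hasFDerivAt_prodMk_left (0 : ℝ) y)
    have h5 : (fderiv ℝ G (0, y) (1, 0) : Euc (m + 1)) =
        mfderiv (𝓡 (m + 1)) (𝓡 (m + 1)) ψ x (generator (n := m + 1) x) := by
      refine Eq.trans ?_ h3
      have h6 : fderiv ℝ (fun t : ℝ => G (t, y)) 0 1 = fderiv ℝ G (0, y) (1, 0) := by
        rw [h4.fderiv]; rfl
      rw [← h6, ← mfderiv_eq_fderiv]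
      rfl
    have h7 : MDifferentiableAt (𝓡 (m + 1)) (𝓡 (m + 1)) ψ.symm y :=
      (contMDiffAt_chart_symm x₀ hy).mdifferentiableAt infty_ne_zero
    have h8 := mfderiv_comp_apply_of_eq x h7 h2 (ψ.right_inv hy) (generator (n := m + 1) x)
    have h9 : ψ.symm ∘ ψ =ᶠ[𝓝 x] id := by
      filter_upwards [(isOpen_extChartAt_source x₀).mem_nhds hxs] with z hz using ψ.left_inv hz
    rw [h9.mfderiv_eq, mfderiv_id] at h8
    exact (congrArg (mfderiv (𝓡 (m + 1)) (𝓡 (m + 1)) ψ.symm y) h5).trans h8.symm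

theorem IsPrincipalCircleBundle.isSmoothForm_contractGenerator
    (h : IsPrincipalCircleBundle (n := m + 1) (n' := m) p) {ρ : MixedForm (m + 1) P}
    (hρ : IsSmoothForm ρ) : IsSmoothForm (contractGenerator ρ) := by
  refine isSmoothForm_iff.2 fun x₀ => ?_
  obtain ⟨V, hV, hVg⟩ := h.exists_chart_generator x₀
  refine (contDiffAt_contract hV (isSmoothForm_iff.1 hρ x₀)).congr_of_eventuallyEq ?_
  filter_upwards [hVg] with y hy
  have h1 : ∀ (A : Euc (m + 1) →ₗ[ℝ] Euc (m + 1)) (v w : Euc (m + 1)) (α : Forms (Euc (m + 1))),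
      A v = w → linPullback A (contract w α) = contract v (linPullback A α) := by
    rintro A v _ α rfl
    exact (contract_linPullback A v α).symm
  exact h1 _ _ _ _ hy

/-- Contraction with the generator returns `p^* a`, and subtracting `θ ∧ p^* a` leaves `p^* b`;
smoothness then descends. -/
theorem IsPrincipalCircleBundle.isSmoothForm_of_mul_pullback_add_pullback
    (h : IsPrincipalCircleBundle (n := m + 1) (n' := m) p) (hθ : IsConnectionForm θ)
    {a b : MixedForm m M} (hs : IsSmoothForm (θ * pullback p a + pullback p b)) :
    IsSmoothForm a ∧ IsSmoothForm b := by
  have h1 := h.isSmoothForm_contractGenerator hs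
  rw [h.contractGenerator_eq hθ] at h1
  refine ⟨h.isSmoothForm_of_pullback h1, h.isSmoothForm_of_pullback ?_⟩
  have h2 := hs.add (hθ.isForm.1.mul h1).neg
  rwa [add_right_comm, add_neg_cancel, zero_add] at h2

end Descent

/-! ## T-duality of integrable structures -/

section IntegrableStructures

variable {m : ℕ} {M P Pt : Type*} [TopologicalSpace M] [TopologicalSpace P] [TopologicalSpace Pt]
  [ChartedSpace (EuclideanSpace ℝ (Fin m)) M] [IsManifold (𝓡 m) ∞ M]
  [ChartedSpace (EuclideanSpace ℝ (Fin (m + 1))) P] [IsManifold (𝓡 (m + 1)) ∞ P]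
  [ChartedSpace (EuclideanSpace ℝ (Fin (m + 1))) Pt] [IsManifold (𝓡 (m + 1)) ∞ Pt]
  [MulAction Circle P] [MulAction Circle Pt] {p : P → M} {pt : Pt → M}
  {θ : MixedForm (m + 1) P} {θt : MixedForm (m + 1) Pt} {F Ft ν : MixedForm m M}
  {T ρ : MixedForm (m + 1) P} {Tt ρt : MixedForm (m + 1) Pt}

/-- The action preserves `ρ` and the orientation form, so it carries the companion at `z • x` to a
companion at `x`, and companions are unique. -/
theorem IsBundlePair.linPullback_actD_companion (h : IsBundlePair p pt θ θt F Ft)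
    (hρ : IsTDual p pt θ θt ρ ρt) {ρ' : MixedForm (m + 1) P}
    (hc : ∀ x, IsCompanion ((θ * pullback p ν : MixedForm (m + 1) P) x) (ρ x) (ρ' x))
    (z : Circle) (x : P) :
    linPullback (actD (m := m) z x) (ρ' (z • x)) = (ρ' x : Forms (Euc (m + 1))) := by
  obtain ⟨a, b, -, -, h1, -⟩ := hρ
  obtain ⟨f, hf⟩ := h.bundle.exists_actD_equiv z x
  have h2 := h.bundle.linPullback_actD h.connection h1 z x
  have h3 := h.bundle.linPullback_actD h.connection (ρ := θ * pullback p ν) (a := ν) (b := 0)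
    (by rw [pullback_zero, add_zero]) z x
  have h4 : ∀ μ r r' μ' s s' : Forms (Euc (m + 1)), IsCompanion μ r r' → IsCompanion μ' s s' →
      linPullback (actD (m := m) z x) μ = μ' → linPullback (actD (m := m) z x) r = s →
      linPullback (actD (m := m) z x) r' = s' := by
    rintro μ r r' _ _ s' hr hs rfl rfl
    rw [← hf] at hs ⊢
    exact (hr.linPullback f).unique hs
  exact h4 _ _ _ _ _ _ (hc (z • x)) (hc x) h3 h2

theorem IsBundlePair.exists_isTDual_companion (h : IsBundlePair p pt θ θt F Ft)
    (hρ : IsTDual p pt θ θt ρ ρt) {ρ' : MixedForm (m + 1) P} (hs : IsSmoothForm ρ')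
    (hc : ∀ x, IsCompanion ((θ * pullback p ν : MixedForm (m + 1) P) x) (ρ x) (ρ' x)) :
    ∃ ρt', IsTDual p pt θ θt ρ' ρt' := by
  obtain ⟨a, b, rfl⟩ := h.bundle.exists_eq_mul_pullback_add_pullback h.connection
    (h.linPullback_actD_companion hρ hc)
  obtain ⟨ha, hb⟩ := h.bundle.isSmoothForm_of_mul_pullback_add_pullback h.connection hs
  exact ⟨_, a, b, ha, hb, rfl, rfl⟩

theorem IsBundlePair.twistedD_eq_zero (h : IsBundlePair p pt θ θt F Ft)
    (hT : IsTDualTorsion p pt θ θt F Ft T Tt) (hρ : IsTDual p pt θ θt ρ ρt)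
    (hd : twistedD T ρ = 0) : twistedD Tt ρt = 0 := by
  have h1 := h.isTDual_twistedD hT hρ
  rw [hd] at h1
  exact neg_eq_zero.1 (h1.eq_zero h)

theorem IsTDual.isGenG2Structure (h : IsBundlePair p pt θ θt F Ft)
    (hρ : IsTDual p pt θ θt ρ ρt) {ε : ZMod 2} (hg : IsGenG2Structure ε ρ) :
    IsGenG2Structure (ε + 1) ρt :=
  ⟨hρ.symm.isSmoothForm h.symm, fun y => ⟨hρ.mem_parityForms h (fun x => (hg.2 x).1) y,
    hρ.isG2Form h (fun x => (hg.2 x).2) y⟩⟩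

theorem IsTDual.isGenSpin7Structure (h : IsBundlePair p pt θ θt F Ft)
    (hρ : IsTDual p pt θ θt ρ ρt) {ε : ZMod 2} (hg : IsGenSpin7Structure ε ρ) :
    IsGenSpin7Structure (ε + 1) ρt :=
  ⟨hρ.symm.isSmoothForm h.symm, fun y => ⟨hρ.mem_parityForms h (fun x => (hg.2 x).1) y,
    hρ.isSpin7Form h (fun x => (hg.2 x).2) y⟩⟩

theorem IsBundlePair.isClosedStronglyIntegrableG2 (h : IsBundlePair p pt θ θt F Ft)
    (hT : IsTDualTorsion p pt θ θt F Ft T Tt) (hρ : IsTDual p pt θ θt ρ ρt)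
    (hs : IsClosedStronglyIntegrableG2 (θ * pullback p ν) T ρ) :
    IsClosedStronglyIntegrableG2 (-(θt * pullback pt ν)) Tt ρt := by
  obtain ⟨⟨ε, hg⟩, hTc, hd, ρ', hs', hc, hd'⟩ := hs
  obtain ⟨ρt', hρ'⟩ := h.exists_isTDual_companion hρ hs' hc
  exact ⟨⟨ε + 1, hρ.isGenG2Structure h hg⟩, h.isClosedThreeForm hT hTc,
    h.twistedD_eq_zero hT hρ hd, ρt', hρ'.symm.isSmoothForm h.symm, hρ.isCompanion h hρ' hc,
    h.twistedD_eq_zero hT hρ' hd'⟩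

/-- Here the equation itself gives the companion as `l⁻¹ d_T ρ`, whose T-dual is already known to be
`-l⁻¹ d_{Tᵗ} ρᵗ`; no descent argument is needed. -/
theorem IsBundlePair.isClosedWeaklyIntegrableG2 (h : IsBundlePair p pt θ θt F Ft)
    (hT : IsTDualTorsion p pt θ θt F Ft T Tt) (hρ : IsTDual p pt θ θt ρ ρt) {ε : ZMod 2} {l : ℝ}
    (hw : IsClosedWeaklyIntegrableG2 ε l (θ * pullback p ν) T ρ) :
    IsClosedWeaklyIntegrableG2 (ε + 1) (-l) (-(θt * pullback pt ν)) Tt ρt := by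
  obtain ⟨hl, hg, hTc, ρ', -, hc, hd⟩ := hw
  have h1 := (h.isTDual_twistedD hT hρ).smul l⁻¹
  rw [hd, inv_smul_smul₀ hl] at h1
  refine ⟨neg_ne_zero.2 hl, hρ.isGenG2Structure h hg, h.isClosedThreeForm hT hTc, _,
    h1.symm.isSmoothForm h.symm, hρ.isCompanion h h1 hc, ?_⟩
  rw [smul_neg, neg_smul_neg, smul_inv_smul₀ hl]

theorem IsBundlePair.isClosedIntegrableSpin7 (h : IsBundlePair p pt θ θt F Ft)
    (hT : IsTDualTorsion p pt θ θt F Ft T Tt) (hρ : IsTDual p pt θ θt ρ ρt) {ε : ZMod 2}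
    (hs : IsClosedIntegrableSpin7 ε T ρ) : IsClosedIntegrableSpin7 (ε + 1) Tt ρt :=
  ⟨hρ.isGenSpin7Structure h hs.1, h.isClosedThreeForm hT hs.2.1, h.twistedD_eq_zero hT hρ hs.2.2⟩

end IntegrableStructures

end GenGeom

end

theorem mainTheorem12 {m : ℕ} {M P Pt : Type*}
    [TopologicalSpace M] [ChartedSpace (EuclideanSpace ℝ (Fin m)) M] [IsManifold (𝓡 m) ∞ M]
    [TopologicalSpace P] [ChartedSpace (EuclideanSpace ℝ (Fin (m + 1))) P]
    [IsManifold (𝓡 (m + 1)) ∞ P] [MulAction Circle P]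
    [TopologicalSpace Pt] [ChartedSpace (EuclideanSpace ℝ (Fin (m + 1))) Pt]
    [IsManifold (𝓡 (m + 1)) ∞ Pt] [MulAction Circle Pt]
    (p : P → M) (pt : Pt → M)
    (θ : GenGeom.MixedForm (m + 1) P) (θt : GenGeom.MixedForm (m + 1) Pt)
    (F Ft : GenGeom.MixedForm m M)
    (hpair : GenGeom.IsBundlePair p pt θ θt F Ft)
    (T : GenGeom.MixedForm (m + 1) P) (Tt : GenGeom.MixedForm (m + 1) Pt)
    (hT : GenGeom.IsTDualTorsion p pt θ θt F Ft T Tt)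
    (ρ : GenGeom.MixedForm (m + 1) P) (ρt : GenGeom.MixedForm (m + 1) Pt)
    (hρ : GenGeom.IsTDual p pt θ θt ρ ρt) :
    (m = 6 → ∀ ν : GenGeom.MixedForm m M, GenGeom.IsOrientationForm ν →
      (GenGeom.IsClosedStronglyIntegrableG2 (θ * GenGeom.pullback p ν) T ρ ↔
        GenGeom.IsClosedStronglyIntegrableG2 (-(θt * GenGeom.pullback pt ν)) Tt ρt) ∧
      ∀ (ε : ZMod 2) (l : ℝ),
        (GenGeom.IsClosedWeaklyIntegrableG2 ε l (θ * GenGeom.pullback p ν) T ρ ↔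
          GenGeom.IsClosedWeaklyIntegrableG2 (ε + 1) (-l) (-(θt * GenGeom.pullback pt ν)) Tt ρt)) ∧
    (m = 7 → ∀ ε : ZMod 2,
      (GenGeom.IsClosedIntegrableSpin7 ε T ρ ↔
        GenGeom.IsClosedIntegrableSpin7 (ε + 1) Tt ρt)) := by
  -- The converses apply the same implications with the bundles exchanged. The orientation `-θᵗ ∧ ν`
  -- is `θᵗ ∧ (-ν)`, and the sign produced by dualising again restores `θ ∧ ν`; likewise both parity
  -- shifts cancel.
  have hν : ∀ ν : GenGeom.MixedForm m M, -(θ * GenGeom.pullback p (-ν)) = θ * GenGeom.pullback p ν :=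
    fun ν => by rw [GenGeom.pullback_neg, mul_neg, neg_neg]
  have hνt : ∀ ν : GenGeom.MixedForm m M,
      -(θt * GenGeom.pullback pt ν) = θt * GenGeom.pullback pt (-ν) :=
    fun ν => by rw [GenGeom.pullback_neg, mul_neg]
  have hε : ∀ ε : ZMod 2, ε + 1 + 1 = ε := by decide
  refine ⟨fun _ ν _ => ⟨⟨hpair.isClosedStronglyIntegrableG2 hT hρ, fun h => ?_⟩,
    fun ε l => ⟨hpair.isClosedWeaklyIntegrableG2 hT hρ, fun h => ?_⟩⟩,
    fun _ ε => ⟨hpair.isClosedIntegrableSpin7 hT hρ, fun h => ?_⟩⟩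
  · rw [hνt] at h
    have h1 := hpair.symm.isClosedStronglyIntegrableG2 hT.symm hρ.symm h
    rwa [hν] at h1
  · rw [hνt] at h
    have h1 := hpair.symm.isClosedWeaklyIntegrableG2 hT.symm hρ.symm h
    rwa [hν, neg_neg, hε] at h1
  · have h1 := hpair.symm.isClosedIntegrableSpin7 hT.symm hρ.symm h
    rwa [hε] at h1
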